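/- **Setting.** Let $d\ge1$, $k\ge0$, $\varrho>0$, and let $\Omega\subset\mathbb R^d$ be an open bounded connected polytope. (A polytope is a nonempty open set that equals the interior of its closure and whose closure is a finite union of nondegenerate closed simplices.) The diffusion $\nu\ge\underline\nu\ge0$ is constant on each element of a finite partition $P_\Omega$ of $\Omega$ into polytopes; the velocity $\beta$ is Lipschitz on $\overline\Omega$ with $\nabla\cdot\beta=0$ a.e.; $\mu\in L^\infty(\Omega)$ and $\mu\ge\mu_0>0$ a.e. Let $\mathcal T_h$ be a finite partition of $\Omega$ into open polytopal cells, with finitely many faces. Each face is closed, connected, contained in a hyperplane, of positive $(d-1)$-dimensional measure, and is contained either in $\partial T_1\cap\partial T_2$ for two distinct cells or in $\partial T\cap\partial\Omega$ for one cell (boundary face). Let $\mathcal F_T=\{F: F\subset\partial T\}$, let $\mathcal T_F=\{T:F\subset\partial T\}$ and let $\mathcal F_h^{b}$ be the set of boundary faces; for $F\in\mathcal F_h^b$, $T=T(F)$ denotes its cell. Distinct faces overlap in measure zero, $\partial T=\bigcup_{F\in\mathcal F_T}F$, and each $F\in\mathcal F_T$ has a unit normal $n_{TF}$ pointing out of $T$.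 Write $h_T=\operatorname{diam}T$ and $h_F=\operatorname{diam}F$; if $d=1$, $h_F:=\min_{T\in\mathcal T_F}h_T$. The mesh is admissible with parameter $\varrho$: there is a matching simplicial mesh of $\Omega$ such that each open simplex $S$ lies in one cell, each $(d-1)$-face of a simplex that lies in $\partial T$ lies in one $F\in\mathcal F_T$, the inradius satisfies $r_S\ge\varrho h_S$, and $h_S\ge\varrho h_T$ if $S\subset T$; if $d=1$, also $h_F\ge\varrho^2h_T$ for $F\in\mathcal F_T$. Each cell lies in one element of $P_\Omega$, so that $\nu=\nu_T$ on $T$; and for each face $F$ with $\nu_T=0$ for all $T\in\mathcal T_F$, $\beta\cdot n_{TF}$ is nonzero on a subset of $F$ of positive measure. Let $\nu_F=\min_{T\in\mathcal T_F}\nu_T$, $N_\partial=\max_T\#\mathcal F_T$, and let $C_{\rm tr}\ge0$ be the smallest constant with $\|v\|_F\le C_{\rm tr}h_F^{-1/2}\|v\|_T$ for all cells $T$, all $F\in\mathcal F_T$ and all $v\in P^k_d(T)$. Here $P^l_d(T)$ and $P^l_{d-1}(F)$ are the polynomials of degree at most $l$ on $T$ and $F$; $(\cdot,\cdot)_X$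 and $\|\cdot\|_X$ are those of $L^2(X)$, and $\pi_X^l$ is the $L^2(X)$-orthogonal projection on polynomials of degree at most $l$. The function $|A|:\mathbb R\to[0,\infty)$ satisfies: (A1) it is Lipschitz and even, and $|A|(0)=0$; (A2) there is $\underline a>0$ with $|A|(s)\ge\underline a|s|$ for $|s|\ge1$; (A3) if $\underline\nu=0$, then $|A|(s)/s\to1$ as $s\to+\infty$. Put $A^\pm(s)=\frac12(|A|(s)\pm s)$ and $s^\pm=\frac12(|s|\pm s)$. For $B\in\{|A|,A^+,A^-\}$ let $B_{TF}=\frac{\nu_F}{h_F}B\big(\frac{h_F\,\beta\cdot n_{TF}}{\nu_F}\big)$ if $\nu_F>0$; if $\nu_F=0$, let $|A|_{TF}=|\beta\cdot n_{TF}|$ and $A^\pm_{TF}=(\beta\cdot n_{TF})^\pm$. **Discrete operators and forms.** Let $U_h=\prod_TP^k_d(T)\times\prod_FP^k_{d-1}(F)$, with elements $v=((v_T)_T,(v_F)_F)$. For a cell $T$, $p_Tv\in P^{k+1}_d(T)$ is given by $\int_Tp_Tv=\int_Tv_T$ and $$(\nabla p_Tv,\nabla w)_T=(\nabla v_T,\nabla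 w)_T+\sum_{F\in\mathcal F_T}(v_F-v_T,\nabla w\cdot n_{TF})_F\quad\forall w\in P_d^{k+1}(T),$$ $P_Tv=v_T+p_Tv-\pi_T^kp_Tv$, and $G_Tv\in P^k_d(T)$ is given by $$(G_Tv,w)_T=-(v_T,\beta\cdot\nabla w)_T+\sum_{F\in\mathcal F_T}((\beta\cdot n_{TF})v_F,w)_F\quad\forall w\in P_d^{k}(T).$$ For a penalty parameter $\varsigma$ put $$a_{\nu,T}(w,v)=\nu_T(\nabla p_Tw,\nabla p_Tv)_T+\sum_{F\in\mathcal F_T}\tfrac{\nu_T}{h_F}\big(\pi_F^k(w_F-P_Tw),\pi_F^k(v_F-P_Tv)\big)_F,$$ $$a_{\nu,h}(w,v)=\sum_Ta_{\nu,T}(w,v)+\sum_{F\in\mathcal F_h^b}\Big\{-(\nu_F\nabla p_{T}w\cdot n_{TF},v_F)_F+\tfrac{\varsigma\nu_F}{h_F}(w_F,v_F)_F\Big\},$$ $$a_{\beta,\mu,h}(w,v)=\sum_T\Big\{-(w_T,G_Tv)_T+(\mu w_T,v_T)_T+\sum_{F\in\mathcal F_T}\big(A^-_{TF}(w_F-w_T),v_F-v_T\big)_F\Big\}+\sum_{F\in\mathcal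 F_h^b}(A^+_{TF}w_F,v_F)_F,$$ and $a_h=a_{\nu,h}+a_{\beta,\mu,h}$. **Norms.** With norms in $L^\infty(T)$, let $L_{\beta,T}=\max_i\|\nabla\beta_i\|_{L^\infty(T)}$, $\tau_{c,T}=\max(\|\mu\|_{L^\infty(T)},L_{\beta,T})^{-1}$ and $\beta_{c,T}=\|\beta\|_{L^\infty(T)}$. Let $$\|v\|_\flat^2=\sum_Ta_{\nu,T}(v,v)+\sum_{F\in\mathcal F^b_h}\tfrac{\nu_F}{h_F}\|v_F\|_F^2+\sum_T\Big\{\tfrac12\sum_{F\in\mathcal F_T}\big\||A|_{TF}^{1/2}(v_F-v_T)\big\|_F^2+\tau_{c,T}^{-1}\|v_T\|_T^2\Big\}+\tfrac12\sum_{F\in\mathcal F_h^b}\big\||A|_{TF}^{1/2}v_F\big\|_F^2,$$ $$\|v\|_\sharp^2=\|v\|_\flat^2+\sum_{T:\,\beta_{c,T}\ne0}h_T\beta_{c,T}^{-1}\|G_Tv\|_T^2 .$$ **Lemma (stability of $a_h$).** Assume $\varsigma\ge1+\frac12C_{\rm tr}^2N_\partial$ and (A1)–(A3). Then, with $\zeta=\min_T\min(\frac12,\tau_{c,T}\mu_0)>0$,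 $$\zeta\|v\|_\flat^2\le a_h(v,v)\qquad\forall v\in U_h .$$ If in addition $h_TL_{\beta,T}\le\beta_{c,T}$ and $h_T\mu_0\le\beta_{c,T}$ for every cell $T$, then for all $w\in U_h$ $$\gamma\zeta\|w\|_\sharp\le\sup_{v\in U_h\setminus\{0\}}\frac{a_h(w,v)}{\|v\|_\sharp}<\infty,$$ where $\gamma>0$ depends only on $d$, $k$, $\varrho$ and the function $|A|$; in particular it is independent of the mesh (hence of $h=\max_Th_T$), of $\nu$, $\beta$, $\mu$, and also of $\Omega$ and $\varsigma$. -/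

import Mathlib

open MeasureTheory Set Filter Topology
open scoped RealInnerProductSpace NNReal ENNReal

namespace HHO

noncomputable section

/-- The space `ℝ^d` with the Euclidean norm. -/
abbrev E (d : ℕ) := EuclideanSpace ℝ (Fin d)

/-! ### Polynomials -/

/-- The polynomial functions on `ℝ^d` of total degree at most `l`. For an open nonempty set `T` the
restriction of such a function to `T` determines it, so this is also the space `P^l_d(T)`. -/
def polyFun (d l : ℕ) : Submodule ℝ (E d → ℝ) :=
  (MvPolynomial.restrictTotalDegree (Fin d) ℝ l).map
    (LinearMap.pi fun x : E d => (MvPolynomial.aeval (R := ℝ) fun i => x i).toLinearMap)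

/-- Restriction to `F`, followed by extension by zero, as a linear map. -/
def restrictZero {d : ℕ} (F : Set (E d)) : (E d → ℝ) →ₗ[ℝ] (E d → ℝ) where
  toFun f := F.indicator f
  map_add' f g := Set.indicator_add F f g
  map_smul' c f := Set.indicator_const_smul F c f

/-- The space `P^l_{d-1}(F)` of a subset `F` of a hyperplane: the restrictions to `F` of the
polynomials of degree at most `l` (as the hyperplane is the image of an affine
parametrization, it does not matter whether `d` or `d - 1` variables are used). A function
on `F` is represented by its extension by zero. -/
def facePoly (d l : ℕ) (F : Set (E d)) : Submodule ℝ (E d → ℝ) :=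
  (polyFun d l).map (restrictZero F)

/-! ### Polytopes and meshes -/

/-- The vertex set of a nondegenerate `d`-simplex of `ℝ^d`. -/
def IsSimplex {d : ℕ} (S : Finset (E d)) : Prop :=
  S.card = d + 1 ∧ AffineIndependent ℝ (fun x : S => (x : E d))

/-- The closed convex hull of the finite vertex set `S`. -/
def hull {d : ℕ} (S : Finset (E d)) : Set (E d) := convexHull ℝ (S : Set (E d))

/-- Open (not necessarily convex) polytopes: nonempty open sets whose closure is a finite union of
closed simplices, and which lie on one side of their boundary (no slits). -/
def IsPolytope {d : ℕ} (P : Set (E d)) : Prop :=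
  P.Nonempty ∧ interior (closure P) = P ∧
    ∃ 𝒮 : Finset (Finset (E d)), (∀ S ∈ 𝒮, IsSimplex S) ∧ closure P = ⋃ S ∈ 𝒮, hull S

/-- A finite collection of disjoint open polytopes whose closures cover the closure of `Ω`. -/
structure IsPolytopalPartition {d : ℕ} (Ω : Set (E d)) (parts : Finset (Set (E d))) : Prop where
  polytope : ∀ P ∈ parts, IsPolytope P
  disjoint : ∀ P ∈ parts, ∀ Q ∈ parts, P ≠ Q → Disjoint P Q
  cover : closure Ω = ⋃ P ∈ parts, closure P

/-- `n` is the unit normal to the hyperplanar set `F` (a part of the boundary of `T`) which points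
out of `T`. -/
structure IsOutwardNormal {d : ℕ} (T F : Set (E d)) (n : E d) : Prop where
  norm_eq : ‖n‖ = 1
  hyperplane : ∃ c : ℝ, ∀ x ∈ F, ⟪n, x⟫ = c
  outward : ∀ᵐ x ∂(μHE[d - 1].restrict F),
    ∀ᶠ t : ℝ in 𝓝[>] 0, x - t • n ∈ T ∧ x + t • n ∉ T

/-- A polytopal mesh of `Ω`: cells, faces, and unit outward normals `n_TF`. -/
structure Mesh {d : ℕ} (Ω : Set (E d)) where
  /-- The cells, which are disjoint open polytopes. -/
  cells : Finset (Set (E d))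
  /-- The faces, which are hyperplanar, closed, connected, of positive `(d-1)`-measure. -/
  faces : Finset (Set (E d))
  /-- `normal T F` is the unit normal to the face `F` of `T` pointing out of `T`. -/
  normal : Set (E d) → Set (E d) → E d
  partition : IsPolytopalPartition Ω cells
  face_closed : ∀ F ∈ faces, IsClosed F
  face_connected : ∀ F ∈ faces, IsConnected F
  face_pos : ∀ F ∈ faces, 0 < μHE[d - 1] F
  /-- A face is an interface or a boundary face. -/
  face_type : ∀ F ∈ faces,
    (∃ T₁ ∈ cells, ∃ T₂ ∈ cells, T₁ ≠ T₂ ∧ F ⊆ frontier T₁ ∩ frontier T₂) ∨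
      (∃ T ∈ cells, F ⊆ frontier T ∩ frontier Ω)
  /-- The boundary of a cell is made of the faces of the cell. -/
  frontier_eq : ∀ T ∈ cells, frontier T = ⋃₀ {F | F ∈ faces ∧ F ⊆ frontier T}
  /-- Distinct faces do not overlap. -/
  face_overlap : ∀ F ∈ faces, ∀ F' ∈ faces, F ≠ F' → μHE[d - 1] (F ∩ F') = 0
  normal_spec : ∀ T ∈ cells, ∀ F ∈ faces, F ⊆ frontier T → IsOutwardNormal T F (normal T F)

/-- The radius of the largest ball contained in `S`. -/
def inradius {d : ℕ} (S : Set (E d)) : ℝ := sSup {r : ℝ | ∃ x, Metric.ball x r ⊆ S}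

namespace Mesh

variable {d : ℕ} {Ω : Set (E d)}

/-- The type of cells. -/
abbrev Cell (M : Mesh Ω) := {T : Set (E d) // T ∈ M.cells}

/-- The type of faces. -/
abbrev Face (M : Mesh Ω) := {F : Set (E d) // F ∈ M.faces}

open Classical in
/-- The set `F_T` of faces of the cell `T`. -/
def facesOf (M : Mesh Ω) (T : M.Cell) : Finset M.Face := {F | F.1 ⊆ frontier T.1}

open Classical in
/-- The boundary faces of the cell `T`. A boundary face belongs to exactly one cell, so
that a sum over the cells and over `bdryFacesOf` is a sum over all boundary faces. -/
def bdryFacesOf (M : Mesh Ω) (T : M.Cell) : Finset M.Face :=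
  {F | F.1 ⊆ frontier T.1 ∧ F.1 ⊆ frontier Ω}

/-- The unit normal to `F` pointing out of `T`. -/
def nrm (M : Mesh Ω) (T : M.Cell) (F : M.Face) : E d := M.normal T.1 F.1

/-- The cell diameter `h_T`. -/
def hT (M : Mesh Ω) (T : M.Cell) : ℝ := Metric.diam T.1

/-- The set `T_F` of cells having `F` as a face, as a type. -/
abbrev CellsOf (M : Mesh Ω) (F : M.Face) := {T : M.Cell // F.1 ⊆ frontier T.1}

/-- The face diameter `h_F`. In dimension one, where faces are points, it is replaced, as usual,
by the smallest diameter of the cells sharing `F`. -/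
def hF (M : Mesh Ω) (F : M.Face) : ℝ :=
  if d = 1 then ⨅ T : M.CellsOf F, M.hT T.1 else Metric.diam F.1

/-- The maximal number `N_∂` of faces of a cell. -/
def maxFaces (M : Mesh Ω) : ℕ := Finset.univ.sup fun T : M.Cell => (M.facesOf T).card

/-- `𝒮` is a matching simplicial submesh of the mesh. -/
structure IsMatchingSubmesh (M : Mesh Ω) (𝒮 : Finset (Finset (E d))) : Prop where
  simplex : ∀ S ∈ 𝒮, IsSimplex S
  /-- The intersection of two closed simplices is the hull of their common vertices. -/
  matching : ∀ S ∈ 𝒮, ∀ S' ∈ 𝒮,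
    hull S ∩ hull S' = convexHull ℝ ((S : Set (E d)) ∩ (S' : Set (E d)))
  cover : closure Ω = ⋃ S ∈ 𝒮, hull S
  in_cell : ∀ S ∈ 𝒮, ∃ T ∈ M.cells, interior (hull S) ⊆ T
  /-- A simplex face lying in the boundary of a cell lies in a single face of that cell. -/
  in_face : ∀ S ∈ 𝒮, ∀ v ∈ S, ∀ T ∈ M.cells,
    convexHull ℝ ((S : Set (E d)) \ {v}) ⊆ frontier T →
      ∃ F ∈ M.faces, F ⊆ frontier T ∧ convexHull ℝ ((S : Set (E d)) \ {v}) ⊆ F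

/-- Admissibility of the mesh with the regularity parameter `ϱ`: there is a matching simplicial
submesh which is shape-regular and whose simplices are comparable to the cells that contain
them. In dimension one, where this does not compare `h_F` with `h_T`, the comparison
is required as well. -/
def IsAdmissible (M : Mesh Ω) (ϱ : ℝ) : Prop :=
  (∃ 𝒮 : Finset (Finset (E d)), M.IsMatchingSubmesh 𝒮 ∧
    (∀ S ∈ 𝒮, ϱ * Metric.diam (hull S) ≤ inradius (hull S)) ∧
    (∀ T ∈ M.cells, ∀ S ∈ 𝒮, interior (hull S) ⊆ T →
      ϱ * Metric.diam T ≤ Metric.diam (hull S))) ∧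
  (d = 1 → ∀ T : M.Cell, ∀ F ∈ M.facesOf T, ϱ ^ 2 * M.hT T ≤ M.hF F)

/-- The smallest constant `C_tr` of the discrete trace inequality
`‖v‖_F ≤ C_tr h_F^{-1/2} ‖v‖_T` for `T` a cell, `F` a face of `T` and `v ∈ P^k_d(T)`. -/
def traceConst (M : Mesh Ω) (k : ℕ) : ℝ :=
  sInf {C : ℝ | 0 ≤ C ∧ ∀ T : M.Cell, ∀ F ∈ M.facesOf T, ∀ v ∈ polyFun d k,
    √(∫ x in F.1, v x ^ 2 ∂μHE[d - 1]) ≤ C * (√(M.hF F))⁻¹ * √(∫ x in T.1, v x ^ 2)}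

/-! ### Degrees of freedom and reconstructions -/

/-- The global space of degrees of freedom: a polynomial of degree at most `k` in every cell and
on every face. -/
abbrev Dof (M : Mesh Ω) (k : ℕ) : Type :=
  (M.Cell → polyFun d k) × ((F : M.Face) → facePoly d k F.1)

variable (M : Mesh Ω) {k : ℕ}

/-- The cell component `v_T`. -/
def cellPart (v : M.Dof k) (T : M.Cell) : E d → ℝ := (v.1 T : E d → ℝ)

/-- The face component `v_F`. -/
def facePart (v : M.Dof k) (F : M.Face) : E d → ℝ := (v.2 F : E d → ℝ)

/-- The `L²(T)`-orthogonal projection of `f` on `P^l_d(T)`. -/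
def cellProj (l : ℕ) (T : M.Cell) (f : E d → ℝ) : polyFun d l :=
  Classical.epsilon fun p : polyFun d l =>
    ∀ w ∈ polyFun d l, ∫ x in T.1, (p : E d → ℝ) x * w x = ∫ x in T.1, f x * w x

/-- The `L²(F)`-orthogonal projection of `f` on `P^l_{d-1}(F)`. -/
def faceProj (l : ℕ) (F : M.Face) (f : E d → ℝ) : facePoly d l F.1 :=
  Classical.epsilon fun p : facePoly d l F.1 =>
    ∀ w ∈ facePoly d l F.1,
      ∫ x in F.1, (p : E d → ℝ) x * w x ∂μHE[d - 1] = ∫ x in F.1, f x * w x ∂μHE[d - 1]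

/-- The potential reconstruction `p_T v ∈ P^{k+1}_d(T)`, the solution of the local discrete
Neumann problem. -/
def potRec (T : M.Cell) (v : M.Dof k) : polyFun d (k + 1) :=
  Classical.epsilon fun p : polyFun d (k + 1) =>
    (∀ w ∈ polyFun d (k + 1),
      ∫ x in T.1, ⟪gradient (p : E d → ℝ) x, gradient w x⟫ =
        (∫ x in T.1, ⟪gradient (M.cellPart v T) x, gradient w x⟫) +
          ∑ F ∈ M.facesOf T, ∫ x in F.1,
            (M.facePart v F x - M.cellPart v T x) * ⟪gradient w x, M.nrm T F⟫ ∂μHE[d - 1]) ∧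
    ∫ x in T.1, (p : E d → ℝ) x = ∫ x in T.1, M.cellPart v T x

/-- The corrected reconstruction `P_T v = v_T + (p_T v - π_T^k p_T v)`. -/
def potRecFull (T : M.Cell) (v : M.Dof k) (x : E d) : ℝ :=
  M.cellPart v T x +
    ((M.potRec T v : E d → ℝ) x - (M.cellProj k T (M.potRec T v) : E d → ℝ) x)

/-- The discrete advective derivative `G_{β,T} v ∈ P^k_d(T)`. -/
def advRec (β : E d → E d) (T : M.Cell) (v : M.Dof k) : polyFun d k :=
  Classical.epsilon fun p : polyFun d k =>
    ∀ w ∈ polyFun d k,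
      ∫ x in T.1, (p : E d → ℝ) x * w x =
        -(∫ x in T.1, M.cellPart v T x * ⟪β x, gradient w x⟫) +
          ∑ F ∈ M.facesOf T, ∫ x in F.1,
            ⟪β x, M.nrm T F⟫ * M.facePart v F x * w x ∂μHE[d - 1]

end Mesh

/-! ### The coefficients of the problem -/

/-- The diffusion, advection and reaction coefficients on `Ω`, with the standing assumptions. -/
structure Coeffs {d : ℕ} (Ω : Set (E d)) where
  /-- The partition `P_Ω` on which the diffusion is piecewise constant. -/
  parts : Finset (Set (E d))
  /-- The diffusion coefficient. -/
  ν : E d → ℝ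
  /-- The lower bound of the diffusion coefficient, which may be zero. -/
  νmin : ℝ
  /-- The advective velocity, extended by continuity to the closure of `Ω`. -/
  β : E d → E d
  /-- The reaction coefficient. -/
  μ : E d → ℝ
  /-- The lower bound of the reaction coefficient. -/
  μ₀ : ℝ
  partition : IsPolytopalPartition Ω parts
  ν_const : ∀ P ∈ parts, ∃ c : ℝ, ∀ x ∈ P, ν x = c
  νmin_nonneg : 0 ≤ νmin
  ν_ge : ∀ᵐ x ∂(volume.restrict Ω), νmin ≤ ν x
  β_lip : ∃ K : ℝ≥0, LipschitzOnWith K β (closure Ω)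
  β_div : ∀ᵐ x ∂(volume.restrict Ω), ∑ i, fderiv ℝ β x (EuclideanSpace.single i 1) i = 0
  μ_bdd : MemLp μ ∞ (volume.restrict Ω)
  μ₀_pos : 0 < μ₀
  μ_ge : ∀ᵐ x ∂(volume.restrict Ω), μ₀ ≤ μ x

/-! ### The functions `|A|` and `A^±` -/

/-- First design condition on `|A|`. -/
def CondA1 (A : ℝ → ℝ) : Prop :=
  (∃ K : ℝ≥0, LipschitzWith K A) ∧ A 0 = 0 ∧ ∀ s, 0 ≤ A s ∧ A (-s) = A s

/-- Second design condition on `|A|`. -/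
def CondA2 (A : ℝ → ℝ) : Prop := ∃ a : ℝ, 0 < a ∧ ∀ s, 1 ≤ |s| → a * |s| ≤ A s

/-- Third design condition on `|A|`, required only if the lower bound on `ν` is zero. -/
def CondA3 (A : ℝ → ℝ) (νmin : ℝ) : Prop :=
  νmin = 0 → Tendsto (fun s => A s / s) atTop (𝓝 1)

/-- `A^+(s) = (|A|(s) + s) / 2`; in particular `plusPart abs` is the positive part. -/
def plusPart (A : ℝ → ℝ) (s : ℝ) : ℝ := (A s + s) / 2

/-- `A^-(s) = (|A|(s) - s) / 2`; in particular `minusPart abs` is the negative part. -/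
def minusPart (A : ℝ → ℝ) (s : ℝ) : ℝ := (A s - s) / 2

/-- The quantity `(ν_F / h_F) B(Pe_TF)` where `Pe_TF = h_F b / ν_F` and `b = β ⋅ n_TF`, with the
value `B₀ b` of its limit if `ν_F = 0`. -/
def pecletCoef (B B₀ : ℝ → ℝ) (νF hF b : ℝ) : ℝ :=
  if νF = 0 then B₀ b else νF / hF * B (hF * b / νF)

namespace Mesh

variable {d : ℕ} {Ω : Set (E d)} (M : Mesh Ω) (D : Coeffs Ω) {k : ℕ}

/-- The value `ν_T` of the diffusion coefficient, constant on `T`, written as its mean value. -/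
def νT (T : M.Cell) : ℝ := ⨍ x in T.1, D.ν x

/-- `ν_F`, the minimum of `ν_T` over the cells `T` having `F` as a face. -/
def νF (F : M.Face) : ℝ := ⨅ T : M.CellsOf F, M.νT D T.1

/-- Compatibility of the mesh with the coefficients: any cell belongs to one subdomain of the
partition, and in any face such that the diffusion vanishes on all its sides, the normal
component of `β` is nonzero in a subset of positive measure. -/
structure IsCompatible : Prop where
  cell_part : ∀ T ∈ M.cells, ∃ P ∈ D.parts, T ⊆ P
  normal_ne_zero : ∀ F : M.Face, (∀ T : M.CellsOf F, M.νT D T.1 = 0) →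
    ∀ T : M.CellsOf F, ¬ ∀ᵐ x ∂(μHE[d - 1].restrict F.1), ⟪D.β x, M.nrm T.1 F⟫ = 0

/-- `L_{β,T}`, the maximum over `i` of the `L^∞(T)`-norms of `∇β_i`. -/
def Lβ (T : M.Cell) : ℝ :=
  ⨆ i : Fin d,
    (eLpNorm (fun x => gradient (fun y => D.β y i) x) ∞ (volume.restrict T.1)).toReal

/-- The reference time `τ_{c,T}`. -/
def τc (T : M.Cell) : ℝ := (max (eLpNorm D.μ ∞ (volume.restrict T.1)).toReal (M.Lβ D T))⁻¹

/-- The reference velocity `β_{c,T}`. -/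
def βc (T : M.Cell) : ℝ := (eLpNorm D.β ∞ (volume.restrict T.1)).toReal

/-- The coercivity constant `ζ`, the minimum over the cells of `1/2` and `τ_{c,T} μ₀`. -/
def ζ : ℝ := ⨅ T : M.Cell, min (1 / 2) (M.τc D T * D.μ₀)

/-! ### Bilinear forms -/

/-- The local diffusion bilinear form `a_{ν,T}`, including its stabilization. -/
def aνT (T : M.Cell) (w v : M.Dof k) : ℝ :=
  (∫ x in T.1, M.νT D T *
    ⟪gradient (M.potRec T w : E d → ℝ) x, gradient (M.potRec T v : E d → ℝ) x⟫) +
  ∑ F ∈ M.facesOf T, M.νT D T / M.hF F *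
    ∫ x in F.1,
      (M.faceProj k F (fun y => M.facePart w F y - M.potRecFull T w y) : E d → ℝ) x *
      (M.faceProj k F (fun y => M.facePart v F y - M.potRecFull T v y) : E d → ℝ) x ∂μHE[d - 1]

/-- The diffusion bilinear form `a_{ν,h}` with the boundary penalty `ς`. -/
def aν (ς : ℝ) (w v : M.Dof k) : ℝ :=
  (∑ T : M.Cell, M.aνT D T w v) +
  ∑ T : M.Cell, ∑ F ∈ M.bdryFacesOf T,
    (-(∫ x in F.1, M.νF D F * ⟪gradient (M.potRec T w : E d → ℝ) x, M.nrm T F⟫ *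
        M.facePart v F x ∂μHE[d - 1]) +
      ς * M.νF D F / M.hF F *
        ∫ x in F.1, M.facePart w F x * M.facePart v F x ∂μHE[d - 1])

/-- The function `(ν_F / h_F) B(Pe_TF)` on the face `F` of `T`. -/
def faceCoef (B B₀ : ℝ → ℝ) (T : M.Cell) (F : M.Face) (x : E d) : ℝ :=
  pecletCoef B B₀ (M.νF D F) (M.hF F) ⟪D.β x, M.nrm T F⟫

/-- The local stabilization `s^-_{β,T}` of the advection. -/
def sMinusT (A : ℝ → ℝ) (T : M.Cell) (w v : M.Dof k) : ℝ :=
  ∑ F ∈ M.facesOf T, ∫ x in F.1,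
    M.faceCoef D (minusPart A) (minusPart abs) T F x *
      (M.facePart w F x - M.cellPart w T x) * (M.facePart v F x - M.cellPart v T x) ∂μHE[d - 1]

/-- The local advection-reaction bilinear form `a_{β,μ,T}`. -/
def aβμT (A : ℝ → ℝ) (T : M.Cell) (w v : M.Dof k) : ℝ :=
  -(∫ x in T.1, M.cellPart w T x * (M.advRec D.β T v : E d → ℝ) x) +
    (∫ x in T.1, D.μ x * M.cellPart w T x * M.cellPart v T x) + M.sMinusT D A T w v

/-- The advection-reaction bilinear form `a_{β,μ,h}`. -/
def aβμ (A : ℝ → ℝ) (w v : M.Dof k) : ℝ :=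
  (∑ T : M.Cell, M.aβμT D A T w v) +
  ∑ T : M.Cell, ∑ F ∈ M.bdryFacesOf T, ∫ x in F.1,
    M.faceCoef D (plusPart A) (plusPart abs) T F x *
      M.facePart w F x * M.facePart v F x ∂μHE[d - 1]

/-- The bilinear form `a_h`. -/
def ah (A : ℝ → ℝ) (ς : ℝ) (w v : M.Dof k) : ℝ := M.aν D ς w v + M.aβμ D A w v

/-! ### Norms -/

/-- The square of the diffusion seminorm `‖v‖_{ν,h}`. -/
def normνSq (v : M.Dof k) : ℝ :=
  (∑ T : M.Cell, M.aνT D T v v) +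
  ∑ T : M.Cell, ∑ F ∈ M.bdryFacesOf T,
    M.νF D F / M.hF F * ∫ x in F.1, M.facePart v F x ^ 2 ∂μHE[d - 1]

/-- The square of the advection-reaction seminorm `‖v‖_{β,μ,h}`. -/
def normβμSq (A : ℝ → ℝ) (v : M.Dof k) : ℝ :=
  (∑ T : M.Cell,
    (1 / 2 * (∑ F ∈ M.facesOf T, ∫ x in F.1, M.faceCoef D A abs T F x *
        (M.facePart v F x - M.cellPart v T x) ^ 2 ∂μHE[d - 1]) +
      (M.τc D T)⁻¹ * ∫ x in T.1, M.cellPart v T x ^ 2)) +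
  1 / 2 * ∑ T : M.Cell, ∑ F ∈ M.bdryFacesOf T, ∫ x in F.1,
    M.faceCoef D A abs T F x * M.facePart v F x ^ 2 ∂μHE[d - 1]

/-- The `♭`-norm. -/
def flatNorm (A : ℝ → ℝ) (v : M.Dof k) : ℝ := √(M.normνSq D v + M.normβμSq D A v)

open Classical in
/-- The `♯`-norm; the additional term is summed over the cells with `β_{c,T} ≠ 0`. -/
def sharpNorm (A : ℝ → ℝ) (v : M.Dof k) : ℝ :=
  √(M.flatNorm D A v ^ 2 + ∑ T : M.Cell with M.βc D T ≠ 0,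
    M.hT T * (M.βc D T)⁻¹ * ∫ x in T.1, (M.advRec D.β T v : E d → ℝ) x ^ 2)

end Mesh

end

end HHO

/-!
The two estimates rest on two different mechanisms.

*Coercivity* (`HHO.Mesh.coercive`) is an energy identity. Adding the definition of the advective
derivative `G_T v`, tested with `v_T`, to its form after integration by parts cancels the volume
terms, as `β` is divergence-free, so that the advective terms in a cell reduce to half of the upwind
stabilization and a boundary term which is odd in the normal (`HHO.Mesh.advective_identity`). The boundary terms
cancel across interfaces (`HHO.Mesh.sum_faces_eq_sum_bdry`), and the terms in `A^+` complete them
on the boundary. In the diffusion form, the boundary flux is absorbed by half of the diffusive energy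
and by the penalty, by the trace inequality with the constant `C_tr` (`HHO.Mesh.aν_ge`).

*The inf-sup condition* has to recover the additional term of the `♯`-norm. In a cell where diffusion
or reaction dominates, the `♭`-norm already controls it (`HHO.Mesh.advEnergy_le_cellEnergy`). In the
other cells (`HHO.Mesh.IsAdvective`) one takes the test function `(h_T / β_c) G_T w`, which vanishes
on the faces (`HHO.Mesh.advTest`). Testing with it gives the missing term up to a multiple of the
`♭`-norm of `w` (`HHO.Mesh.ah_advTest_ge`), and the `♯`-norm of the test function is bounded by the
square root of the missing term (`HHO.Mesh.sharpNorm_advTest_sq_le`). Together with coercivity, this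
bounds the `♯`-norm of `w` by the supremum (`HHO.infsup_algebra`). The supremum is finite because
`a_h` is bounded in the `♯`-norm (`HHO.Mesh.isBoundedForm_ah`). Boundedness also shows that `a_h`
vanishes where the `♯`-norm does, so that it never matters whether the latter is definite.

The constant depends only on two sources. One is the function `|A|`, through the two-sided
comparison of the coefficient `|A|_TF` with `|β ⋅ n_TF|` in `HHO.UpwindBounds`. The other is a
constant for the local inequalities for polynomials on cells and faces in `HHO.Mesh.LocalBounds`,
from which the equivalence of the energy of the reconstruction with a discrete `H¹`-energy follows
(`HHO.Mesh.LocalBounds.energy_equiv`). These inequalities hold with a constant depending on the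
dimension, the degree and the mesh regularity (`HHO.Mesh.exists_localBounds`): each cell lies in a
ball of radius `h_T` whose concentric ball of radius `ϱ ^ 2 / 2 * h_T` it contains
(`HHO.Mesh.exists_ball_subset_cell`), so that equivalence of norms on a finite-dimensional space and
scaling bound polynomials and their gradients at every point of the cell
(`HHO.exists_inverse_bound`).
The number of faces of a cell and their measures are bounded as well
(`HHO.Mesh.card_facesOf_le`, `HHO.Mesh.exists_face_measure_bound`).

Integration by parts on cells needs a divergence theorem for bounded open sets whose boundary is a
finite union of hyperplanar pieces (`HHO.IsFaceted.integral_lineDeriv`). It is obtained by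
differentiating the integral of a Lipschitz function over translates of the set: the symmetric
difference of the set and its translate is covered by thin layers over the faces, on which Fubini's
theorem applies.
-/

namespace HHO

/-! ### Polynomial functions -/

section Polynomials

variable {d : ℕ}

theorem mem_polyFun {l : ℕ} {f : E d → ℝ} :
    f ∈ polyFun d l ↔ ∃ p : MvPolynomial (Fin d) ℝ, p.totalDegree ≤ l ∧
      ∀ x, f x = MvPolynomial.aeval (R := ℝ) (fun i => x i) p := by
  simp only [polyFun, Submodule.mem_map, MvPolynomial.mem_restrictTotalDegree]
  constructor
  · rintro ⟨p, hp, rfl⟩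
    exact ⟨p, hp, fun x => rfl⟩
  · rintro ⟨p, hp, h⟩
    exact ⟨p, hp, funext fun x => (h x).symm⟩

theorem polyFun_mono {l m : ℕ} (h : l ≤ m) : polyFun d l ≤ polyFun d m := by
  intro f hf
  obtain ⟨p, hp, hf⟩ := mem_polyFun.1 hf
  exact mem_polyFun.2 ⟨p, hp.trans h, hf⟩

theorem const_mem_polyFun (l : ℕ) (c : ℝ) : (fun _ : E d => c) ∈ polyFun d l :=
  mem_polyFun.2 ⟨MvPolynomial.C c, by simp, fun x => by simp⟩

theorem coord_mem_polyFun (i : Fin d) : (fun x : E d => x i) ∈ polyFun d 1 :=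
  mem_polyFun.2 ⟨MvPolynomial.X i, by simp, fun x => by simp⟩

theorem mul_mem_polyFun {l m : ℕ} {f g : E d → ℝ} (hf : f ∈ polyFun d l) (hg : g ∈ polyFun d m) :
    (fun x => f x * g x) ∈ polyFun d (l + m) := by
  obtain ⟨p, hp, hf⟩ := mem_polyFun.1 hf
  obtain ⟨q, hq, hg⟩ := mem_polyFun.1 hg
  exact mem_polyFun.2 ⟨p * q, (MvPolynomial.totalDegree_mul p q).trans (by gcongr),
    fun x => by simp [hf, hg]⟩

/-- Induction on polynomial functions which keeps track of the degree: `Q l f` may depend on a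
bound `l` for the degree, and multiplication by a coordinate raises the bound by one. -/
theorem polyFun_induction {Q : ℕ → (E d → ℝ) → Prop} (const : ∀ l c, Q l fun _ => c)
    (add : ∀ l f g, f ∈ polyFun d l → g ∈ polyFun d l → Q l f → Q l g → Q l (fun x => f x + g x))
    (coord : ∀ l i f, f ∈ polyFun d l → Q l f → Q (l + 1) fun x => x i * f x)
    {l : ℕ} {f : E d → ℝ} (hf : f ∈ polyFun d l) : Q l f := by
  have mon_mem : ∀ (l : ℕ) (s : Fin d →₀ ℕ) (c : ℝ), s.degree ≤ l →
      (fun x : E d => MvPolynomial.aeval (R := ℝ) (fun i => x i) (MvPolynomial.monomial s c))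
        ∈ polyFun d l := fun l s c hs =>
    mem_polyFun.2 ⟨_, (MvPolynomial.totalDegree_monomial_le s c).trans hs, fun x => rfl⟩
  have mon : ∀ (l : ℕ) (s : Fin d →₀ ℕ) (c : ℝ), s.degree ≤ l →
      Q l fun x => MvPolynomial.aeval (R := ℝ) (fun i => x i) (MvPolynomial.monomial s c) := by
    intro l
    induction l with
    | zero =>
      intro s c hs
      obtain rfl : s = 0 := (Finsupp.degree_eq_zero_iff s).1 (Nat.le_zero.1 hs)
      simpa using const 0 c
    | succ l ih =>
      intro s c hs
      by_cases h0 : s = 0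
      · subst h0
        simpa using const (l + 1) c
      obtain ⟨i, hi⟩ := Finsupp.ne_iff.1 h0
      have hle : Finsupp.single i 1 ≤ s := by
        rw [Finsupp.single_le_iff]
        exact Nat.one_le_iff_ne_zero.2 hi
      obtain ⟨t, rfl⟩ := exists_add_of_le hle
      have ht : t.degree ≤ l := by
        rw [map_add, Finsupp.degree_single] at hs
        omega
      convert coord l i _ (mon_mem l t c ht) (ih t c ht) using 2 with x
      have : (MvPolynomial.monomial (Finsupp.single i 1 + t)) c
          = MvPolynomial.X i * MvPolynomial.monomial t c := by
        rw [MvPolynomial.X, MvPolynomial.monomial_mul, one_mul]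
      rw [this, map_mul, MvPolynomial.aeval_X]
  obtain ⟨p, hp, hf⟩ := mem_polyFun.1 hf
  have key : ∀ S : Finset (Fin d →₀ ℕ), (∀ s ∈ S, s.degree ≤ l) →
      (fun x : E d => ∑ s ∈ S, MvPolynomial.aeval (R := ℝ) (fun i => x i)
        (MvPolynomial.monomial s (p.coeff s))) ∈ polyFun d l ∧
      Q l fun x => ∑ s ∈ S, MvPolynomial.aeval (R := ℝ) (fun i => x i)
        (MvPolynomial.monomial s (p.coeff s)) := by
    classical
    intro S
    induction S using Finset.induction_on with
    | empty => intro _; simpa using ⟨const_mem_polyFun l 0, const l 0⟩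
    | insert s S hs ih =>
      intro h
      obtain ⟨h1, h2⟩ := ih fun t ht => h t (Finset.mem_insert_of_mem ht)
      have h3 := h s (Finset.mem_insert_self s S)
      simp_rw [Finset.sum_insert hs]
      exact ⟨(polyFun d l).add_mem (mon_mem l s _ h3) h1, add l _ _ (mon_mem l s _ h3) h1
        (mon l s _ h3) h2⟩
  have : f = fun x => ∑ s ∈ p.support, MvPolynomial.aeval (R := ℝ) (fun i => x i)
      (MvPolynomial.monomial s (p.coeff s)) := by
    funext x
    rw [hf x]
    conv_lhs => rw [p.as_sum]
    rw [map_sum]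
  rw [this]
  refine (key p.support fun s hs => ?_).2
  exact (MvPolynomial.le_totalDegree hs).trans hp

/-- Substitution of affine functions does not raise the degree. -/
theorem comp_mem_polyFun {l : ℕ} {f : E d → ℝ} (hf : f ∈ polyFun d l) {g : E d → E d}
    (hg : ∀ i, (fun x => g x i) ∈ polyFun d 1) : (fun x => f (g x)) ∈ polyFun d l := by
  refine polyFun_induction (Q := fun l f => (fun x => f (g x)) ∈ polyFun d l) ?_ ?_ ?_ hf
  · exact fun l c => const_mem_polyFun l c
  · exact fun l f₁ f₂ _ _ h₁ h₂ => (polyFun d l).add_mem h₁ h₂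
  · intro l i f _ h
    rw [add_comm]
    exact mul_mem_polyFun (hg i) h

theorem comp_affine_mem_polyFun {l : ℕ} {f : E d → ℝ} (hf : f ∈ polyFun d l) (a : E d) (h : ℝ) :
    (fun x => f (a + h • x)) ∈ polyFun d l := by
  refine comp_mem_polyFun hf fun i => ?_
  have : (fun x : E d => (a + h • x) i) = (fun _ => a i) + h • fun x : E d => x i := by
    ext x; simp
  rw [this]
  exact (polyFun d 1).add_mem (const_mem_polyFun 1 _) ((polyFun d 1).smul_mem h (coord_mem_polyFun i))

theorem contDiff_of_mem_polyFun {l : ℕ} {f : E d → ℝ} (hf : f ∈ polyFun d l) :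
    ContDiff ℝ 1 f := by
  refine polyFun_induction (Q := fun l f => ContDiff ℝ 1 f) ?_ ?_ ?_ hf
  · exact fun l c => contDiff_const
  · exact fun l f₁ f₂ _ _ h₁ h₂ => h₁.add h₂
  · intro l i f _ h
    exact ContDiff.mul (EuclideanSpace.proj i : E d →L[ℝ] ℝ).contDiff h

theorem continuous_of_mem_polyFun {l : ℕ} {f : E d → ℝ} (hf : f ∈ polyFun d l) : Continuous f :=
  (contDiff_of_mem_polyFun hf).continuous

theorem differentiable_of_mem_polyFun {l : ℕ} {f : E d → ℝ} (hf : f ∈ polyFun d l) :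
    Differentiable ℝ f :=
  (contDiff_of_mem_polyFun hf).differentiable one_ne_zero

theorem fderiv_mem_polyFun {l : ℕ} {f : E d → ℝ} (hf : f ∈ polyFun d l) (v : E d) :
    (fun x => fderiv ℝ f x v) ∈ polyFun d (l - 1) := by
  suffices h : (fun x => fderiv ℝ f x v) ∈ polyFun d (l - 1) ∧
      (l = 0 → ∀ x, fderiv ℝ f x v = 0) from h.1
  refine polyFun_induction (Q := fun l f => (fun x => fderiv ℝ f x v) ∈ polyFun d (l - 1) ∧
      (l = 0 → ∀ x, fderiv ℝ f x v = 0)) ?_ ?_ ?_ hf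
  · intro l c
    simpa using const_mem_polyFun (l - 1) 0
  · intro l f₁ f₂ m₁ m₂ h₁ h₂
    have : ∀ x, fderiv ℝ (fun x => f₁ x + f₂ x) x v = fderiv ℝ f₁ x v + fderiv ℝ f₂ x v :=
      fun x => by
        rw [fderiv_fun_add (differentiable_of_mem_polyFun m₁ x) (differentiable_of_mem_polyFun m₂ x)]
        rfl
    simp_rw [this]
    exact ⟨(polyFun d (l - 1)).add_mem h₁.1 h₂.1, fun h x => by rw [h₁.2 h, h₂.2 h, add_zero]⟩
  · intro l i f hf h
    have : ∀ x, fderiv ℝ (fun x : E d => x i * f x) x v = x i * fderiv ℝ f x v + v i * f x := by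
      intro x
      have h1 : HasFDerivAt (fun x : E d => x i)
          (EuclideanSpace.proj i : E d →L[ℝ] ℝ) x :=
        (EuclideanSpace.proj i : E d →L[ℝ] ℝ).hasFDerivAt
      rw [HasFDerivAt.fderiv (h1.fun_mul (differentiable_of_mem_polyFun hf x).hasFDerivAt)]
      simp [mul_comm]
    simp_rw [this]
    refine ⟨?_, by simp⟩
    refine (polyFun d l).add_mem ?_ ((polyFun d l).smul_mem (v i) hf)
    rcases Nat.eq_zero_or_pos l with rfl | hl
    · simpa [h.2 rfl] using const_mem_polyFun 0 0
    · have := mul_mem_polyFun (coord_mem_polyFun i) h.1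
      rwa [show 1 + (l - 1) = l by omega] at this

theorem exists_polynomial_on_line {l : ℕ} {f : E d → ℝ} (hf : f ∈ polyFun d l) (a u : E d) :
    ∃ q : Polynomial ℝ, ∀ t : ℝ, f (a + t • u) = q.eval t := by
  refine polyFun_induction (Q := fun l f => ∃ q : Polynomial ℝ, ∀ t : ℝ,
    f (a + t • u) = q.eval t) ?_ ?_ ?_ hf
  · exact fun l c => ⟨Polynomial.C c, by simp⟩
  · intro l f₁ f₂ _ _ h₁ h₂
    obtain ⟨p, hp⟩ := h₁
    obtain ⟨q, hq⟩ := h₂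
    exact ⟨p + q, fun t => by simp [hp, hq]⟩
  · intro l i f _ h
    obtain ⟨q, hq⟩ := h
    exact ⟨(Polynomial.C (a i) + Polynomial.X * Polynomial.C (u i)) * q,
      fun t => by simp [hq, mul_comm t]⟩

/-- On a line through a point where it does not vanish, a polynomial function has finitely many
zeros. -/
theorem finite_zeros_on_line {l : ℕ} {f : E d → ℝ} (hf : f ∈ polyFun d l) {a u : E d}
    (ha : f a ≠ 0) : {t : ℝ | f (a + t • u) = 0}.Finite := by
  obtain ⟨q, hq⟩ := exists_polynomial_on_line hf a u
  have hq0 : q ≠ 0 := by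
    rintro rfl
    exact ha (by simpa using hq 0)
  refine (q.roots.toFinset.finite_toSet).subset fun t ht => ?_
  simpa [hq0, ← hq t] using ht

theorem eq_zero_of_eqOn_isOpen {l : ℕ} {f : E d → ℝ} (hf : f ∈ polyFun d l) {T : Set (E d)}
    (hT : IsOpen T) (hne : T.Nonempty) (h : ∀ x ∈ T, f x = 0) : f = 0 := by
  by_contra hf0
  obtain ⟨a, ha⟩ := Function.ne_iff.1 hf0
  obtain ⟨x, hx⟩ := hne
  have hfin := finite_zeros_on_line hf (a := a) (u := x - a) ha
  have hcont : Continuous fun t : ℝ => a + t • (x - a) := by fun_prop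
  have hmem : {t : ℝ | a + t • (x - a) ∈ T} ∈ 𝓝 (1 : ℝ) :=
    (hT.preimage hcont).mem_nhds (by simpa using hx)
  exact (infinite_of_mem_nhds (1 : ℝ) hmem) (hfin.subset fun t ht => h _ ht)

theorem continuous_gradient_of_mem_polyFun {l : ℕ} {f : E d → ℝ} (hf : f ∈ polyFun d l) :
    Continuous (gradient f) := by
  have := (contDiff_of_mem_polyFun hf).continuous_fderiv one_ne_zero
  exact (InnerProductSpace.toDual ℝ (E d)).symm.continuous.comp this

theorem inner_gradient (f : E d → ℝ) (x v : E d) : ⟪gradient f x, v⟫ = fderiv ℝ f x v := by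
  rw [gradient, InnerProductSpace.toDual_symm_apply]

theorem norm_gradient_sq (f : E d → ℝ) (x : E d) :
    ‖gradient f x‖ ^ 2 = ∑ j, fderiv ℝ f x (EuclideanSpace.single j 1) ^ 2 := by
  rw [EuclideanSpace.norm_sq_eq]
  refine Finset.sum_congr rfl fun j _ => ?_
  rw [← inner_gradient, EuclideanSpace.inner_single_right]
  simp

theorem gradient_add_of_mem {l m : ℕ} {f g : E d → ℝ} (hf : f ∈ polyFun d l) (hg : g ∈ polyFun d m)
    (x : E d) : gradient (f + g) x = gradient f x + gradient g x := by
  simp only [gradient]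
  rw [fderiv_add (differentiable_of_mem_polyFun hf x) (differentiable_of_mem_polyFun hg x), map_add]

theorem gradient_smul_of_mem {l : ℕ} {f : E d → ℝ} (hf : f ∈ polyFun d l) (c : ℝ)
    (x : E d) : gradient (c • f) x = c • gradient f x := by
  simp only [gradient]
  rw [fderiv_const_smul (differentiable_of_mem_polyFun hf x), map_smul]

theorem gradient_const' (c : ℝ) (x : E d) : gradient (fun _ : E d => c) x = 0 := by
  simp [gradient]

instance finiteDimensional_polyFun (l : ℕ) : FiniteDimensional ℝ (polyFun d l) := by
  unfold polyFun
  infer_instance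

instance finiteDimensional_facePoly (l : ℕ) (F : Set (E d)) :
    FiniteDimensional ℝ (facePoly d l F) := by
  unfold facePoly
  infer_instance

end Polynomials

/-! ### Positive definite bilinear forms on finite-dimensional spaces -/

section Forms

variable {V : Type*} [AddCommGroup V] [Module ℝ V]

theorem bilin_sq_le (B : V →ₗ[ℝ] V →ₗ[ℝ] ℝ) (symm : ∀ u v, B u v = B v u)
    (nonneg : ∀ v, 0 ≤ B v v) (u v : V) : B u v ^ 2 ≤ B u u * B v v := by
  have h : ∀ t : ℝ, 0 ≤ B u u * (t * t) + 2 * B u v * t + B v v := by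
    intro t
    have := nonneg (t • u + v)
    simp only [map_add, LinearMap.add_apply, map_smul, LinearMap.smul_apply, smul_eq_mul,
      symm v u] at this
    linarith
  have := discrim_le_zero h
  rw [discrim] at this
  linarith

/-- Representation of functionals on a finite-dimensional space; symmetry of `B` is not needed. -/
theorem bilin_representation [FiniteDimensional ℝ V] (B : V →ₗ[ℝ] V →ₗ[ℝ] ℝ)
    (definite : ∀ v, B v v = 0 → v = 0) (φ : V →ₗ[ℝ] ℝ) : ∃ u, ∀ v, B u v = φ v := by
  have hinj : Function.Injective B := by
    rw [← LinearMap.ker_eq_bot, LinearMap.ker_eq_bot']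
    intro v hv
    exact definite v (by simp [hv])
  have hsurj := (LinearMap.injective_iff_surjective_of_finrank_eq_finrank
    (f := B) (Subspace.dual_finrank_eq).symm).1 hinj
  obtain ⟨u, hu⟩ := hsurj φ
  exact ⟨u, fun v => by rw [hu]⟩

/-- A single functional is bounded by a positive definite form: represent it and apply the
Cauchy–Schwarz inequality. -/
theorem exists_functional_bound [FiniteDimensional ℝ V] (B : V →ₗ[ℝ] V →ₗ[ℝ] ℝ)
    (symm : ∀ u v, B u v = B v u) (nonneg : ∀ v, 0 ≤ B v v)
    (definite : ∀ v, B v v = 0 → v = 0) (φ : V →ₗ[ℝ] ℝ) :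
    ∃ C : ℝ, 0 ≤ C ∧ ∀ v, φ v ^ 2 ≤ C * B v v := by
  obtain ⟨u, hu⟩ := bilin_representation B definite φ
  exact ⟨B u u, nonneg u, fun v => hu v ▸ bilin_sq_le B symm nonneg u v⟩

/-- A family of linear functionals which is bounded at every vector is uniformly bounded with
respect to a positive definite form. -/
theorem exists_functional_family_bound [FiniteDimensional ℝ V] (B : V →ₗ[ℝ] V →ₗ[ℝ] ℝ)
    (symm : ∀ u v, B u v = B v u) (nonneg : ∀ v, 0 ≤ B v v)
    (definite : ∀ v, B v v = 0 → v = 0) {ι : Type*} (φ : ι → V →ₗ[ℝ] ℝ)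
    (hφ : ∀ v, ∃ M : ℝ, ∀ i, |φ i v| ≤ M) :
    ∃ C : ℝ, 0 ≤ C ∧ ∀ i v, φ i v ^ 2 ≤ C * B v v := by
  let b := Module.finBasis ℝ V
  choose c hc0 hc using fun j => exists_functional_bound B symm nonneg definite (b.coord j)
  choose M hM using fun j => hφ (b j)
  refine ⟨(∑ j, c j) * ∑ j, M j ^ 2, mul_nonneg (Finset.sum_nonneg fun j _ => hc0 j)
    (Finset.sum_nonneg fun j _ => sq_nonneg _), fun i v => ?_⟩
  have hv : φ i v = ∑ j, b.coord j v * φ i (b j) := by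
    conv_lhs => rw [← b.sum_repr v]
    simp only [map_sum, map_smul, smul_eq_mul, Module.Basis.coord_apply]
  rw [hv]
  calc (∑ j, b.coord j v * φ i (b j)) ^ 2
      ≤ (∑ j, b.coord j v ^ 2) * ∑ j, φ i (b j) ^ 2 := Finset.sum_mul_sq_le_sq_mul_sq _ _ _
    _ ≤ (∑ j, c j * B v v) * ∑ j, M j ^ 2 := by
        refine mul_le_mul (Finset.sum_le_sum fun j _ => hc j v)
          (Finset.sum_le_sum fun j _ => sq_le_sq.2 ((hM j i).trans (le_abs_self _)))
          (Finset.sum_nonneg fun j _ => sq_nonneg _)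
          (Finset.sum_nonneg fun j _ => mul_nonneg (hc0 j) (nonneg v))
    _ = _ := by rw [← Finset.sum_mul]; ring

end Forms

/-! ### Finite-dimensional subspaces of `L²` -/

section L2

variable {α : Type*} [MeasurableSpace α] {m : Measure α} {V : Submodule ℝ (α → ℝ)}

/-- A space of square-integrable functions on which the `L²(m)` seminorm is a norm. -/
structure IsL2Space (m : Measure α) (V : Submodule ℝ (α → ℝ)) : Prop where
  integrable : ∀ f ∈ V, ∀ g ∈ V, Integrable (fun x => f x * g x) m
  definite : ∀ f ∈ V, ∫ x, f x ^ 2 ∂m = 0 → f = 0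

namespace IsL2Space

/-- The `L²(m)` inner product. -/
noncomputable def form (h : IsL2Space m V) : V →ₗ[ℝ] V →ₗ[ℝ] ℝ :=
  LinearMap.mk₂ ℝ (fun p q => ∫ x, (p : α → ℝ) x * (q : α → ℝ) x ∂m)
    (fun p p' q => by
      rw [← integral_add (h.integrable _ p.2 _ q.2) (h.integrable _ p'.2 _ q.2)]
      exact integral_congr_ae (.of_forall fun x => by simp [add_mul]))
    (fun c p q => by
      rw [smul_eq_mul, ← integral_const_mul]
      exact integral_congr_ae (.of_forall fun x => by simp [mul_assoc]))
    (fun p q q' => by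
      rw [← integral_add (h.integrable _ p.2 _ q.2) (h.integrable _ p.2 _ q'.2)]
      exact integral_congr_ae (.of_forall fun x => by simp [mul_add]))
    (fun c p q => by
      rw [smul_eq_mul, ← integral_const_mul]
      exact integral_congr_ae (.of_forall fun x => by simp; ring))

@[simp]
theorem form_apply (h : IsL2Space m V) (p q : V) :
    h.form p q = ∫ x, (p : α → ℝ) x * (q : α → ℝ) x ∂m := rfl

theorem form_self (h : IsL2Space m V) (p : V) : h.form p p = ∫ x, (p : α → ℝ) x ^ 2 ∂m := by
  simp [sq]

theorem form_symm (h : IsL2Space m V) (p q : V) : h.form p q = h.form q p := by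
  simp [mul_comm]

theorem form_nonneg (h : IsL2Space m V) (p : V) : 0 ≤ h.form p p := by
  rw [form_self]
  exact integral_nonneg fun x => sq_nonneg _

theorem form_definite (h : IsL2Space m V) (p : V) (hp : h.form p p = 0) : p = 0 := by
  rw [form_self] at hp
  exact Subtype.ext (h.definite _ p.2 hp)

theorem exists_repr (h : IsL2Space m V) [FiniteDimensional ℝ V] (φ : V →ₗ[ℝ] ℝ) :
    ∃ p : V, ∀ w : V, ∫ x, (p : α → ℝ) x * (w : α → ℝ) x ∂m = φ w :=
  bilin_representation h.form h.form_definite φ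

theorem eq_of_forall (h : IsL2Space m V) {p p' : V}
    (hp : ∀ w ∈ V, ∫ x, (p : α → ℝ) x * w x ∂m = ∫ x, (p' : α → ℝ) x * w x ∂m) : p = p' := by
  rw [← sub_eq_zero]
  refine h.form_definite _ ?_
  rw [LinearMap.map_sub₂, sub_eq_zero]
  exact hp _ (p - p').2

theorem exists_proj (h : IsL2Space m V) [FiniteDimensional ℝ V] {f : α → ℝ}
    (hf : ∀ w ∈ V, Integrable (fun x => f x * w x) m) :
    ∃ p : V, ∀ w ∈ V, ∫ x, (p : α → ℝ) x * w x ∂m = ∫ x, f x * w x ∂m := by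
  obtain ⟨p, hp⟩ := h.exists_repr
    { toFun := fun w => ∫ x, f x * (w : α → ℝ) x ∂m
      map_add' := fun w w' => by
        rw [← integral_add (hf _ w.2) (hf _ w'.2)]
        exact integral_congr_ae (.of_forall fun x => by simp [mul_add])
      map_smul' := fun c w => by
        rw [RingHom.id_apply, smul_eq_mul, ← integral_const_mul]
        exact integral_congr_ae (.of_forall fun x => by simp; ring) }
  exact ⟨p, fun w hw => hp ⟨w, hw⟩⟩

/-- Pythagoras' identity for the orthogonal projection. -/
theorem integral_sub_sq (h : IsL2Space m V) {f : α → ℝ} {p q : V}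
    (hf : ∀ w ∈ V, Integrable (fun x => f x * w x) m) (hff : Integrable (fun x => f x ^ 2) m)
    (hp : ∀ w ∈ V, ∫ x, (p : α → ℝ) x * w x ∂m = ∫ x, f x * w x ∂m) :
    ∫ x, (f x - (q : α → ℝ) x) ^ 2 ∂m
      = (∫ x, (f x - (p : α → ℝ) x) ^ 2 ∂m) + ∫ x, ((p - q : V) : α → ℝ) x ^ 2 ∂m := by
  have i1 : Integrable (fun x => (f x - (p : α → ℝ) x) ^ 2) m := by
    refine ((hff.sub ((hf p p.2).const_mul 2)).add (h.integrable p p.2 p p.2)).congr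
      (.of_forall fun x => ?_)
    simp only [Pi.add_apply, Pi.sub_apply]; ring
  have i2 : Integrable (fun x => ((p - q : V) : α → ℝ) x ^ 2) m := by
    simpa [sq] using h.integrable _ (p - q).2 _ (p - q).2
  have i3 : Integrable (fun x => (f x - (p : α → ℝ) x) * ((p - q : V) : α → ℝ) x) m := by
    refine ((hf _ (p - q).2).sub (h.integrable p p.2 _ (p - q).2)).congr (.of_forall fun x => ?_)
    simp only [Pi.sub_apply]; ring
  have h0 : ∫ x, (f x - (p : α → ℝ) x) * ((p - q : V) : α → ℝ) x ∂m = 0 := by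
    have := hp _ (p - q).2
    rw [eq_comm, ← sub_eq_zero, ← integral_sub (hf _ (p - q).2) (h.integrable p p.2 _ (p - q).2)]
      at this
    rw [← this]
    exact integral_congr_ae (.of_forall fun x => by simp only; ring)
  have i12 : Integrable (fun x => (f x - (p : α → ℝ) x) ^ 2 + ((p - q : V) : α → ℝ) x ^ 2) m :=
    i1.add i2
  rw [← integral_add i1 i2, ← add_zero (∫ x, _ + _ ∂m), ← mul_zero 2, ← h0, ← integral_const_mul,
    ← integral_add i12 (i3.const_mul 2)]
  refine integral_congr_ae (.of_forall fun x => ?_)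
  simp only [Submodule.coe_sub, Pi.sub_apply]; ring

theorem integral_sub_proj_sq_le (h : IsL2Space m V) {f : α → ℝ} {p q : V}
    (hf : ∀ w ∈ V, Integrable (fun x => f x * w x) m) (hff : Integrable (fun x => f x ^ 2) m)
    (hp : ∀ w ∈ V, ∫ x, (p : α → ℝ) x * w x ∂m = ∫ x, f x * w x ∂m) :
    ∫ x, (f x - (p : α → ℝ) x) ^ 2 ∂m ≤ ∫ x, (f x - (q : α → ℝ) x) ^ 2 ∂m := by
  rw [h.integral_sub_sq hf hff hp (q := q)]
  exact le_add_of_nonneg_right (integral_nonneg fun x => sq_nonneg _)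

theorem integral_proj_sq_le (h : IsL2Space m V) {f : α → ℝ} {p : V}
    (hf : ∀ w ∈ V, Integrable (fun x => f x * w x) m) (hff : Integrable (fun x => f x ^ 2) m)
    (hp : ∀ w ∈ V, ∫ x, (p : α → ℝ) x * w x ∂m = ∫ x, f x * w x ∂m) :
    ∫ x, (p : α → ℝ) x ^ 2 ∂m ≤ ∫ x, f x ^ 2 ∂m := by
  have := h.integral_sub_sq hf hff hp (q := 0)
  simp only [Submodule.coe_zero, Pi.zero_apply, sub_zero] at this
  rw [this]
  exact le_add_of_nonneg_left (integral_nonneg fun x => sq_nonneg _)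

end IsL2Space

end L2

/-! ### Inverse inequalities for polynomials -/

section Inverse

variable {d : ℕ}

theorem integrableOn_of_continuousOn_closure {m : Measure (E d)} {K : Set (E d)} {f : E d → ℝ}
    (hK : Bornology.IsBounded K) (hmK : MeasurableSet K) (hm : m K ≠ ∞)
    (hf : ContinuousOn f (closure K)) : IntegrableOn f K m := by
  obtain ⟨M, hM⟩ := hK.isCompact_closure.exists_bound_of_continuousOn hf
  have : IsFiniteMeasure (m.restrict K) := ⟨by simpa using hm.lt_top⟩
  refine Integrable.of_bound ((hf.mono subset_closure).aestronglyMeasurable hmK) M ?_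
  filter_upwards [ae_restrict_mem hmK] with x hx
  exact hM x (subset_closure hx)

theorem integrable_of_mem_polyFun {T : Set (E d)} (hT : MeasurableSet T)
    (hb : Bornology.IsBounded T) (l : ℕ) (f : E d → ℝ) (hf : f ∈ polyFun d l) :
    Integrable f (volume.restrict T) :=
  integrableOn_of_continuousOn_closure hb hT hb.measure_lt_top.ne
    (continuous_of_mem_polyFun hf).continuousOn

theorem eqOn_zero_of_setIntegral_sq_eq_zero {T : Set (E d)} (hT : IsOpen T)
    {f : E d → ℝ} (hf : ContinuousOn f T) (hi : IntegrableOn (fun x => f x ^ 2) T)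
    (h : ∫ x in T, f x ^ 2 = 0) : ∀ x ∈ T, f x = 0 := by
  rw [integral_eq_zero_iff_of_nonneg (fun x => sq_nonneg _) hi] at h
  have h' : ∀ᵐ x ∂(volume.restrict T), f x = 0 := by
    filter_upwards [h] with x hx
    simpa using hx
  have := Measure.eqOn_open_of_ae_eq (g := fun _ => (0 : ℝ)) h' hT hf continuousOn_const
  exact fun x hx => this hx

theorem eq_zero_of_setIntegral_sq_eq_zero {T : Set (E d)} (hT : IsOpen T) (hne : T.Nonempty)
    (hb : Bornology.IsBounded T) {l : ℕ} {f : E d → ℝ} (hf : f ∈ polyFun d l)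
    (h : ∫ x in T, f x ^ 2 = 0) : f = 0 := by
  refine eq_zero_of_eqOn_isOpen hf hT hne (eqOn_zero_of_setIntegral_sq_eq_zero hT
    (continuous_of_mem_polyFun hf).continuousOn ?_ h)
  simpa [sq, IntegrableOn] using integrable_of_mem_polyFun hT.measurableSet hb _ _ (mul_mem_polyFun hf hf)

theorem isL2Space_polyFun {T : Set (E d)} (hT : IsOpen T) (hne : T.Nonempty)
    (hb : Bornology.IsBounded T) (l : ℕ) : IsL2Space (volume.restrict T) (polyFun d l) where
  integrable _ hf _ hg := integrable_of_mem_polyFun hT.measurableSet hb _ _ (mul_mem_polyFun hf hg)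
  definite _ hf h := eq_zero_of_setIntegral_sq_eq_zero hT hne hb hf h

/-- Equivalence of norms on the polynomials of degree at most `l`, on the reference
configuration. -/
theorem exists_reference_bound (d l : ℕ) {ρ : ℝ} (hρ : 0 < ρ) :
    ∃ C : ℝ, 0 ≤ C ∧ ∀ q ∈ polyFun d l, ∀ y ∈ Metric.closedBall (0 : E d) 1,
      q y ^ 2 ≤ C * ∫ x in Metric.ball (0 : E d) ρ, q x ^ 2 ∧
      ‖gradient q y‖ ^ 2 ≤ C * ∫ x in Metric.ball (0 : E d) ρ, q x ^ 2 := by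
  have hb : Bornology.IsBounded (Metric.ball (0 : E d) ρ) := Metric.isBounded_ball
  have hV := isL2Space_polyFun Metric.isOpen_ball (Metric.nonempty_ball.2 hρ) hb l
  have hK := isCompact_closedBall (0 : E d) 1
  -- the point evaluations, and below the partial derivatives, at the points of the closed unit ball
  -- are families of functionals which are bounded at every polynomial, by compactness
  obtain ⟨C₁, hC₁, h₁⟩ := exists_functional_family_bound hV.form hV.form_symm
    hV.form_nonneg hV.form_definite
    (ι := Metric.closedBall (0 : E d) 1)
    (fun y => { toFun := fun q => (q : E d → ℝ) y
                map_add' := fun _ _ => rfl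
                map_smul' := fun _ _ => rfl })
    (fun v => by
      obtain ⟨M, hM⟩ := hK.exists_bound_of_continuousOn
        (continuous_of_mem_polyFun v.2).continuousOn
      exact ⟨M, fun y => hM y y.2⟩)
  obtain ⟨C₂, hC₂, h₂⟩ := exists_functional_family_bound hV.form hV.form_symm
    hV.form_nonneg hV.form_definite
    (ι := Metric.closedBall (0 : E d) 1 × Fin d)
    (fun y => { toFun := fun q => fderiv ℝ (q : E d → ℝ) y.1 (EuclideanSpace.single y.2 1)
                map_add' := fun p q => by
                  rw [Submodule.coe_add, fderiv_add (differentiable_of_mem_polyFun p.2 _)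
                    (differentiable_of_mem_polyFun q.2 _)]
                  rfl
                map_smul' := fun c p => by
                  rw [Submodule.coe_smul, fderiv_const_smul (differentiable_of_mem_polyFun p.2 _)]
                  rfl })
    (fun v => by
      obtain ⟨M, hM⟩ := hK.exists_bound_of_continuousOn
        (continuous_gradient_of_mem_polyFun v.2).continuousOn
      refine ⟨M, fun y => ?_⟩
      change |fderiv ℝ (v : E d → ℝ) y.1 (EuclideanSpace.single y.2 1)| ≤ M
      rw [← inner_gradient]
      refine (abs_real_inner_le_norm _ _).trans ?_
      simpa using hM y.1 y.1.2)
  refine ⟨max C₁ (d * C₂), hC₁.trans (le_max_left _ _), fun q hq y hy => ?_⟩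
  have hnn : 0 ≤ ∫ x in Metric.ball (0 : E d) ρ, q x ^ 2 := integral_nonneg fun x => sq_nonneg _
  constructor
  · have := h₁ ⟨y, hy⟩ ⟨q, hq⟩
    rw [hV.form_self] at this
    exact this.trans (mul_le_mul_of_nonneg_right (le_max_left _ _) hnn)
  · rw [norm_gradient_sq]
    refine le_trans (Finset.sum_le_sum (g := fun _ => C₂ * ∫ x in Metric.ball (0 : E d) ρ, q x ^ 2)
      fun j _ => ?_) ?_
    · have := h₂ (⟨y, hy⟩, j) ⟨q, hq⟩
      rw [hV.form_self] at this
      exact this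
    · rw [Finset.sum_const, Finset.card_univ, Fintype.card_fin, nsmul_eq_mul, ← mul_assoc]
      exact mul_le_mul_of_nonneg_right (le_max_right _ _) hnn

theorem setIntegral_ball_comp_affine (f : E d → ℝ) (a : E d) {h : ℝ} (hh : 0 < h) (ρ : ℝ) :
    ∫ x in Metric.ball (0 : E d) ρ, f (a + h • x)
      = (h ^ d)⁻¹ * ∫ x in Metric.ball a (ρ * h), f x := by
  have h1 := Measure.setIntegral_comp_smul_of_pos (volume : Measure (E d)) (fun x => f (a + x))
    (Metric.ball (0 : E d) ρ) hh
  rw [h1, finrank_euclideanSpace_fin, smul_eq_mul, smul_ball hh.ne', smul_zero,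
    Real.norm_of_nonneg hh.le, mul_comm h ρ]
  congr 1
  have h2 := (measurePreserving_add_left (volume : Measure (E d)) a).setIntegral_preimage_emb
    (measurableEmbedding_addLeft a) f (Metric.ball a (ρ * h))
  rw [← h2]
  congr 2
  ext x
  simp [Metric.mem_ball, dist_eq_norm]

/-- Inverse inequality: the values and the gradient of a polynomial on a ball are controlled by its
`L²` norm on a concentric ball of comparable radius. -/
theorem exists_inverse_bound (d l : ℕ) {ρ : ℝ} (hρ : 0 < ρ) :
    ∃ C : ℝ, 0 ≤ C ∧ ∀ (a : E d) (h : ℝ), 0 < h → ∀ q ∈ polyFun d l,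
      ∀ x ∈ Metric.closedBall a h,
      q x ^ 2 ≤ C * (h ^ d)⁻¹ * ∫ x in Metric.ball a (ρ * h), q x ^ 2 ∧
      h ^ 2 * ‖gradient q x‖ ^ 2 ≤ C * (h ^ d)⁻¹ * ∫ x in Metric.ball a (ρ * h), q x ^ 2 := by
  obtain ⟨C, hC, H⟩ := exists_reference_bound d l hρ
  refine ⟨C, hC, fun a h hh q hq x hx => ?_⟩
  have hy : h⁻¹ • (x - a) ∈ Metric.closedBall (0 : E d) 1 := by
    rw [mem_closedBall_zero_iff, norm_smul, norm_inv, Real.norm_of_nonneg hh.le,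
      inv_mul_le_iff₀ hh, mul_one, ← dist_eq_norm]
    exact hx
  have hxy : a + h • h⁻¹ • (x - a) = x := by
    rw [smul_inv_smul₀ hh.ne']; abel
  obtain ⟨h1, h2⟩ := H _ (comp_affine_mem_polyFun hq a h) _ hy
  rw [setIntegral_ball_comp_affine (fun x => q x ^ 2) a hh] at h1 h2
  rw [hxy, ← mul_assoc] at h1
  refine ⟨h1, ?_⟩
  have hgrad : gradient (fun x => q (a + h • x)) (h⁻¹ • (x - a)) = h • gradient q x := by
    refine ext_inner_right ℝ fun v => ?_
    rw [inner_gradient, inner_smul_left, inner_gradient]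
    have hd : HasFDerivAt (fun y : E d => a + h • y) (h • ContinuousLinearMap.id ℝ (E d))
        (h⁻¹ • (x - a)) := ((hasFDerivAt_id _).const_smul h).const_add a
    have hq' : HasFDerivAt q (fderiv ℝ q x) (a + h • h⁻¹ • (x - a)) := by
      rw [hxy]; exact (differentiable_of_mem_polyFun hq x).hasFDerivAt
    have hcomp := HasFDerivAt.comp (g := q) (f := fun y => a + h • y) (h⁻¹ • (x - a)) hq' hd
    change fderiv ℝ (q ∘ fun y => a + h • y) _ v = _
    rw [hcomp.fderiv]
    simp
  rw [hgrad, norm_smul, mul_pow, Real.norm_eq_abs, sq_abs, ← mul_assoc] at h2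
  exact h2

end Inverse

/-! ### The surface measure on hyperplanes -/

section Hyperplanes

variable {d : ℕ}

/-- The hyperplane with normal `n` and offset `c`. -/
def hyp (n : E d) (c : ℝ) : Set (E d) := {x | ⟪n, x⟫ = c}

theorem mem_hyp {n : E d} {c : ℝ} {x : E d} : x ∈ hyp n c ↔ ⟪n, x⟫ = c := Iff.rfl

theorem isClosed_hyp (n : E d) (c : ℝ) : IsClosed (hyp n c) :=
  isClosed_eq (by fun_prop) continuous_const

theorem measurableSet_hyp (n : E d) (c : ℝ) : MeasurableSet (hyp n c) :=
  (isClosed_hyp n c).measurableSet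

/-- Fubini for slicing by parallel hyperplanes; the dimensional constants agree since `μHE` is
normalized as Lebesgue measure. -/
theorem volume_eq_lintegral_hyp {n : E d} (hn : ‖n‖ = 1) {t : Set (E d)} (ht : MeasurableSet t) :
    volume t = ∫⁻ s : ℝ, μHE[d - 1] (t ∩ hyp n s) := by
  have h := EuclideanGeometry.euclideanHausdorffMeasure_eq_lintegral (0 : E d)
    (v := n) (by rintro rfl; simp at hn) ht
  rw [InnerProductSpace.euclideanHausdorffMeasure_eq_volume, finrank_euclideanSpace_fin,
    ← ofReal_norm, hn, ENNReal.ofReal_one, one_mul] at h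
  rw [h]
  refine lintegral_congr fun s => ?_
  congr 2
  ext x
  rw [SetLike.mem_coe, AffineSubspace.mem_mk', Submodule.mem_orthogonal_singleton_iff_inner_right,
    mem_hyp, vsub_eq_sub, vadd_eq_add, add_zero, inner_sub_right, inner_smul_right,
    real_inner_self_eq_norm_sq, hn]
  constructor <;> intro h <;> linarith

/-- Fubini for slicing by the translates along `e` of a hyperplane with unit normal `n`;
the Jacobian is `|⟪n, e⟫|`. -/
theorem volume_eq_lintegral_translate {n e : E d} (hn : ‖n‖ = 1) (c : ℝ) (he : ⟪n, e⟫ ≠ 0)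
    {t : Set (E d)} (ht : MeasurableSet t) :
    volume t = ENNReal.ofReal |⟪n, e⟫| *
      ∫⁻ s : ℝ, μHE[d - 1] (hyp n c ∩ {y | y + s • e ∈ t}) := by
  rw [volume_eq_lintegral_hyp hn ht, ← lintegral_add_left_eq_self _ c]
  conv_lhs => rw [← Real.smul_map_volume_mul_left he]
  rw [lintegral_smul_measure, smul_eq_mul,
    (measurableEmbedding_mulLeft₀ he).lintegral_map]
  congr 1
  refine lintegral_congr fun s => ?_
  rw [← measure_preimage_add_right (μHE[d - 1] : Measure (E d)) (s • e)]
  congr 1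
  ext y
  simp only [mem_preimage, mem_inter_iff, mem_hyp, inner_add_right, inner_smul_right, mem_ofPred_eq]
  constructor
  · rintro ⟨h1, h2⟩; exact ⟨by linarith, h1⟩
  · rintro ⟨h1, h2⟩; exact ⟨h2, by linarith⟩

theorem volume_hyp {n : E d} (hn : ‖n‖ = 1) (c : ℝ) : volume (hyp n c) = 0 := by
  rw [volume_eq_lintegral_hyp hn (measurableSet_hyp n c)]
  have : ∀ᵐ s : ℝ, μHE[d - 1] (hyp n c ∩ hyp n s) = 0 := by
    have h : ∀ᵐ s : ℝ, s ≠ c := by simp [ae_iff]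
    filter_upwards [h] with s hs
    have : hyp n c ∩ hyp n s = ∅ := by
      ext x
      simp only [mem_inter_iff, mem_hyp, mem_empty_iff_false, iff_false, not_and]
      intro h h'
      exact hs (h'.symm.trans h)
    rw [this, measure_empty]
  rw [lintegral_congr_ae this, lintegral_zero]

/-- A set contained in two hyperplanes that are not parallel is negligible. -/
theorem hausdorff_eq_zero_of_subset_hyp {n n' : E d} (hn : ‖n‖ = 1) (hn' : ‖n'‖ = 1)
    (h1 : n' ≠ n) (h2 : n' ≠ -n) {c c' : ℝ} {F : Set (E d)} (hF : F ⊆ hyp n c)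
    (hF' : F ⊆ hyp n' c') : μHE[d - 1] F = 0 := by
  set b := ⟪n', n⟫ with hb
  have hne : ⟪n, n - b • n'⟫ ≠ 0 := by
    rw [inner_sub_right, inner_smul_right, real_inner_self_eq_norm_sq, hn, real_inner_comm, ← hb]
    intro h
    have hsq : b ^ 2 = 1 := by linarith
    rcases sq_eq_one_iff.1 hsq with h | h
    · exact h1 ((inner_eq_one_iff_of_norm_eq_one hn' hn).1 h)
    · refine h2 ((inner_eq_one_iff_of_norm_eq_one (𝕜 := ℝ) hn' (by simpa using hn)).1 ?_)
      rw [inner_neg_right, ← hb, h, neg_neg]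
  have hz := volume_eq_lintegral_translate hn c hne (measurableSet_hyp n' c')
  rw [volume_hyp hn', eq_comm, mul_eq_zero] at hz
  rcases hz with hz | hz
  · rw [ENNReal.ofReal_eq_zero] at hz
    exact absurd (abs_nonpos_iff.1 hz) hne
  have hle : ∫⁻ _ : ℝ, μHE[d - 1] F ≤ 0 := by
    rw [← hz]
    refine lintegral_mono fun s => measure_mono fun y hy => ⟨hF hy, ?_⟩
    have hy' : ⟪n', y⟫ = c' := hF' hy
    rw [mem_ofPred_eq, mem_hyp, inner_add_right, inner_smul_right, inner_sub_right, inner_smul_right,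
      real_inner_self_eq_norm_sq, hn', hy', ← hb]
    ring
  rw [lintegral_const, Real.volume_univ] at hle
  by_contra h
  rw [ENNReal.mul_top h] at hle
  simp at hle

/-- The volume of the cylinder of height `δ` over a subset of a hyperplane bounds the surface
measure of its base. -/
theorem ofReal_mul_hausdorff_le {n : E d} (hn : ‖n‖ = 1) {c : ℝ} {F : Set (E d)} (hF : F ⊆ hyp n c)
    (hcl : IsClosed F) {y₀ : E d} {r δ : ℝ} (hr : F ⊆ Metric.closedBall y₀ r) :
    ENNReal.ofReal δ * μHE[d - 1] F ≤ volume (Metric.closedBall y₀ (r + δ)) := by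
  have hnn : ⟪n, n⟫ = (1 : ℝ) := by rw [real_inner_self_eq_norm_sq, hn]; norm_num
  set t : Set (E d) := {x | ⟪n, x⟫ - c ∈ Icc 0 δ ∧ x - (⟪n, x⟫ - c) • n ∈ F} with ht
  have htm : MeasurableSet t :=
    (measurableSet_Icc.preimage (by fun_prop)).inter
      (hcl.measurableSet.preimage (f := fun x : E d => x - (⟪n, x⟫ - c) • n)
        (Continuous.measurable (by fun_prop)))
  have hsub : t ⊆ Metric.closedBall y₀ (r + δ) := by
    rintro x ⟨h1, h2⟩
    have h3 := hr h2
    rw [Metric.mem_closedBall, dist_eq_norm] at h3 ⊢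
    calc ‖x - y₀‖ = ‖(x - (⟪n, x⟫ - c) • n - y₀) + (⟪n, x⟫ - c) • n‖ := by congr 1; abel
      _ ≤ ‖x - (⟪n, x⟫ - c) • n - y₀‖ + ‖(⟪n, x⟫ - c) • n‖ := norm_add_le _ _
      _ ≤ r + δ := by
        gcongr
        rw [norm_smul, hn, mul_one, Real.norm_of_nonneg h1.1]
        exact h1.2
  refine le_trans ?_ (measure_mono hsub)
  rw [volume_eq_lintegral_translate hn c (e := n) (by rw [hnn]; exact one_ne_zero) htm, hnn, abs_one,
    ENNReal.ofReal_one, one_mul]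
  calc ENNReal.ofReal δ * μHE[d - 1] F
      = ∫⁻ s in Icc (0 : ℝ) δ, μHE[d - 1] F := by
        rw [lintegral_const, Measure.restrict_apply_univ, Real.volume_Icc, sub_zero, mul_comm]
    _ = ∫⁻ s : ℝ, (Icc (0 : ℝ) δ).indicator (fun _ => μHE[d - 1] F) s :=
        (lintegral_indicator measurableSet_Icc _).symm
    _ ≤ _ := by
        refine lintegral_mono fun s => ?_
        by_cases hs : s ∈ Icc (0 : ℝ) δ
        · rw [indicator_of_mem hs]
          refine measure_mono fun y hy => ⟨hF hy, ?_⟩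
          have hy' : ⟪n, y⟫ = c := hF hy
          have : ⟪n, y + s • n⟫ - c = s := by
            rw [inner_add_right, inner_smul_right, hnn, hy']; ring
          rw [mem_ofPred_eq, ht, mem_ofPred_eq, this, add_sub_cancel_right]
          exact ⟨hs, hy⟩
        · rw [indicator_of_notMem hs]
          exact zero_le

theorem hausdorff_lt_top {n : E d} (hn : ‖n‖ = 1) {c : ℝ} {F : Set (E d)} (hF : F ⊆ hyp n c)
    (hc : IsCompact F) : μHE[d - 1] F < ∞ := by
  obtain ⟨r, hr⟩ := hc.isBounded.subset_closedBall (0 : E d)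
  have h := ofReal_mul_hausdorff_le hn hF hc.isClosed (δ := 1) hr
  rw [ENNReal.ofReal_one, one_mul] at h
  exact h.trans_lt measure_closedBall_lt_top

theorem sigmaFinite_restrict_hyp {n : E d} (hn : ‖n‖ = 1) (c : ℝ) :
    SigmaFinite ((μHE[d - 1] : Measure (E d)).restrict (hyp n c)) := by
  refine ⟨⟨⟨fun m => Metric.closedBall 0 m, fun _ => trivial, fun m => ?_, ?_⟩⟩⟩
  · rw [Measure.restrict_apply measurableSet_closedBall]
    exact hausdorff_lt_top hn inter_subset_right
      ((isCompact_closedBall _ _).inter_right (isClosed_hyp n c))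
  · exact Metric.iUnion_closedBall_nat 0

/-- The measure of a subset of a hyperplane, in terms of its size. -/
theorem exists_hausdorff_bound (d : ℕ) : ∃ C : ℝ, 0 ≤ C ∧ ∀ (n : E d), ‖n‖ = 1 → ∀ (c : ℝ)
    (F : Set (E d)), F ⊆ hyp n c → IsCompact F → ∀ h : ℝ, 0 < h → Metric.diam F ≤ h →
    (μHE[d - 1] : Measure (E d)).real F ≤ C * h ^ (d - 1) := by
  refine ⟨2 ^ d * (volume (Metric.ball (0 : E d) 1)).toReal, by positivity, ?_⟩
  intro n hn c F hF hc h hh hdiam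
  rcases F.eq_empty_or_nonempty with rfl | ⟨y, hy⟩
  · simp only [measureReal_empty]; positivity
  have hr : F ⊆ Metric.closedBall y h := fun x hx =>
    (Metric.dist_le_diam_of_mem hc.isBounded hx hy).trans hdiam
  have key := ofReal_mul_hausdorff_le hn hF hc.isClosed (δ := h) hr
  rw [Measure.addHaar_closedBall _ _ (by positivity), finrank_euclideanSpace_fin] at key
  have hd : d ≠ 0 := by
    rintro rfl
    rw [Subsingleton.elim n 0, norm_zero] at hn
    exact zero_ne_one hn
  have key' := ENNReal.toReal_mono (ENNReal.mul_ne_top ENNReal.ofReal_ne_top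
    measure_ball_lt_top.ne) key
  rw [ENNReal.toReal_mul, ENNReal.toReal_mul, ENNReal.toReal_ofReal hh.le,
    ENNReal.toReal_ofReal (by positivity)] at key'
  have : (h + h) ^ d = h * (2 ^ d * h ^ (d - 1)) := by
    obtain ⟨m, rfl⟩ := Nat.exists_eq_succ_of_ne_zero hd
    simp only [Nat.succ_eq_add_one, Nat.add_sub_cancel]
    ring
  rw [this, mul_assoc] at key'
  have := le_of_mul_le_mul_left key' hh
  calc _ ≤ _ := this
    _ = _ := by ring

theorem volume_eq_smul_map {n e : E d} (hn : ‖n‖ = 1) (c : ℝ) (he : ⟪n, e⟫ ≠ 0) :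
    (volume : Measure (E d)) = ENNReal.ofReal |⟪n, e⟫| •
      ((volume : Measure ℝ).prod ((μHE[d - 1] : Measure (E d)).restrict (hyp n c))).map
        (fun z => z.2 + z.1 • e) := by
  have := sigmaFinite_restrict_hyp hn c
  have hm : Measurable fun z : ℝ × E d => z.2 + z.1 • e := by fun_prop
  ext t ht
  rw [Measure.smul_apply, Measure.map_apply hm ht, Measure.prod_apply (hm ht), smul_eq_mul,
    volume_eq_lintegral_translate hn c he ht]
  congr 1
  refine lintegral_congr fun s => ?_
  rw [Measure.restrict_apply (measurable_prodMk_left (hm ht)), inter_comm]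
  rfl

/-- The union of the translates `F + θ e` for `0 ≤ θ ≤ 1`. -/
def layer (F : Set (E d)) (e : E d) : Set (E d) :=
  (fun z : ℝ × E d => z.2 + z.1 • e) '' (Icc 0 1 ×ˢ F)

theorem mem_layer {F : Set (E d)} {e x : E d} :
    x ∈ layer F e ↔ ∃ θ ∈ Icc (0 : ℝ) 1, ∃ y ∈ F, y + θ • e = x := by
  constructor
  · rintro ⟨⟨θ, y⟩, ⟨h1, h2⟩, rfl⟩; exact ⟨θ, h1, y, h2, rfl⟩
  · rintro ⟨θ, h1, y, h2, rfl⟩; exact ⟨⟨θ, y⟩, ⟨h1, h2⟩, rfl⟩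

theorem isCompact_layer {F : Set (E d)} (hF : IsCompact F) (e : E d) : IsCompact (layer F e) :=
  (isCompact_Icc.prod hF).image (by fun_prop)

theorem volume_layer_eq_zero {n e : E d} (hn : ‖n‖ = 1) {c : ℝ} {F : Set (E d)} (hF : F ⊆ hyp n c)
    (he : ⟪n, e⟫ = 0) : volume (layer F e) = 0 := by
  refine measure_mono_null (fun x hx => ?_) (volume_hyp hn c)
  obtain ⟨θ, -, y, hy, rfl⟩ := mem_layer.1 hx
  rw [mem_hyp, inner_add_right, inner_smul_right, he, mul_zero, add_zero]
  exact hF hy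

/-- Integration over a layer in the coordinates `(θ, y) ↦ y + θ e`. -/
theorem setIntegral_layer {n e : E d} (hn : ‖n‖ = 1) {c : ℝ} {F : Set (E d)} (hF : F ⊆ hyp n c)
    (hc : IsCompact F) (he : ⟪n, e⟫ ≠ 0) {g : E d → ℝ} (hg : Measurable g) :
    ∫ x in layer F e, g x = |⟪n, e⟫| *
      ∫ z, g (z.2 + z.1 • e) ∂((volume.restrict (Icc (0 : ℝ) 1)).prod
        ((μHE[d - 1] : Measure (E d)).restrict F)) := by
  have := sigmaFinite_restrict_hyp hn c
  have hm : Measurable fun z : ℝ × E d => z.2 + z.1 • e := by fun_prop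
  have hlm : MeasurableSet (layer F e) := (isCompact_layer hc e).measurableSet
  have hres : (μHE[d - 1] : Measure (E d)).restrict F
      = ((μHE[d - 1] : Measure (E d)).restrict (hyp n c)).restrict F := by
    rw [Measure.restrict_restrict hc.measurableSet, inter_eq_left.2 hF]
  rw [hres, Measure.prod_restrict, volume_eq_smul_map hn c he, Measure.restrict_smul,
    integral_smul_measure, ENNReal.toReal_ofReal (abs_nonneg _), smul_eq_mul,
    ← integral_indicator hlm, integral_map hm.aemeasurable (hg.indicator hlm).aestronglyMeasurable,
    ← integral_indicator (measurableSet_Icc.prod hc.measurableSet)]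
  congr 1
  have hae : ∀ᵐ z ∂((volume : Measure ℝ).prod ((μHE[d - 1] : Measure (E d)).restrict (hyp n c))),
      z.2 ∈ hyp n c :=
    (Measure.quasiMeasurePreserving_snd).ae (ae_restrict_mem (measurableSet_hyp n c))
  refine integral_congr_ae ?_
  filter_upwards [hae] with z hz
  have : z.2 + z.1 • e ∈ layer F e ↔ z ∈ Icc (0 : ℝ) 1 ×ˢ F := by
    constructor
    · intro h
      obtain ⟨θ, hθ, y, hy, h⟩ := mem_layer.1 h
      have hin := congrArg (fun v => ⟪n, v⟫) h
      have hy' : ⟪n, y⟫ = c := hF hy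
      have hz' : ⟪n, z.2⟫ = c := hz
      simp only [inner_add_right, inner_smul_right, hy', hz', add_right_inj] at hin
      have hθz : θ = z.1 := mul_right_cancel₀ he hin
      subst hθz
      exact ⟨hθ, by rwa [← add_right_cancel h]⟩
    · exact fun h => mem_layer.2 ⟨z.1, h.1, z.2, h.2, rfl⟩
  by_cases hz' : z ∈ Icc (0 : ℝ) 1 ×ˢ F
  · rw [indicator_of_mem hz', indicator_of_mem (this.2 hz')]
  · rw [indicator_of_notMem hz', indicator_of_notMem (fun h => hz' (this.1 h))]

/-- A polynomial function which does not vanish at some point of a hyperplane is nonzero almost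
everywhere on it: the zero set `Z` meets almost every line through that point in a finite set, so
that almost all of its homothetic images, hence `Z` itself, are negligible. -/
theorem ae_ne_zero_on_hyp {n : E d} (hn : ‖n‖ = 1) {c : ℝ} {l : ℕ} {f : E d → ℝ}
    (hf : f ∈ polyFun d l) {a : E d} (ha : a ∈ hyp n c) (hfa : f a ≠ 0) :
    (μHE[d - 1] : Measure (E d)) (hyp n c ∩ {x | f x = 0}) = 0 := by
  have := sigmaFinite_restrict_hyp hn c
  have hcf := continuous_of_mem_polyFun hf
  have h0 : ∀ᵐ x ∂((μHE[d - 1] : Measure (E d)).restrict (hyp n c)), ∀ᵐ t : ℝ,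
      f (a + t • (x - a)) ≠ 0 := by
    refine .of_forall fun x => ?_
    rw [ae_iff]
    simpa using (finite_zeros_on_line hf (u := x - a) hfa).measure_zero volume
  rw [Measure.ae_ae_comm
    (isClosed_eq (hcf.comp (by fun_prop)) continuous_const).measurableSet.compl] at h0
  have hne : ∀ᵐ t : ℝ, t ≠ 0 := by simp [ae_iff]
  obtain ⟨t, h2, ht⟩ := (h0.and hne).exists
  have hSm : MeasurableSet {x : E d | f (a + t • (x - a)) = 0} :=
    (isClosed_eq (hcf.comp (by fun_prop)) continuous_const).measurableSet
  rw [ae_iff] at h2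
  simp only [ne_eq, not_not] at h2
  rw [Measure.restrict_apply hSm] at h2
  have h3 : {x : E d | f (a + t • (x - a)) = 0} ∩ hyp n c
      = AffineMap.homothety a t ⁻¹' (hyp n c ∩ {x | f x = 0}) := by
    have ha' : ⟪n, a⟫ = c := ha
    ext x
    simp only [mem_inter_iff, mem_preimage, mem_hyp, mem_ofPred_eq, AffineMap.homothety_apply,
      vsub_eq_sub, vadd_eq_add, inner_add_right, inner_smul_right, inner_sub_right, ha',
      add_comm (t • (x - a)) a]
    constructor
    · rintro ⟨h1, h2⟩; exact ⟨by rw [h2]; ring, h1⟩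
    · rintro ⟨h1, h2⟩
      refine ⟨h2, ?_⟩
      have : t * (⟪n, x⟫ - c) = 0 := by linarith
      rcases mul_eq_zero.1 this with h | h
      · exact absurd h ht
      · linarith
  rw [h3, euclideanHausdorffMeasure_homothety_preimage (𝕜 := ℝ) (d - 1) a ht] at h2
  rw [ENNReal.smul_def, smul_eq_mul, mul_eq_zero] at h2
  refine h2.resolve_left ?_
  simp [ht]

end Hyperplanes

/-! ### The divergence theorem on faceted domains -/

section Divergence

variable {d : ℕ} {ι : Type*}

/-- A bounded open set whose boundary consists of finitely many hyperplanar pieces `F i` which do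
not overlap, with outward unit normals `N i`. -/
structure IsFaceted (T : Set (E d)) (F : ι → Set (E d)) (N : ι → E d) : Prop where
  isOpen : IsOpen T
  isBounded : Bornology.IsBounded T
  isClosed : ∀ i, IsClosed (F i)
  frontier_eq : frontier T = ⋃ i, F i
  normal : ∀ i, IsOutwardNormal T (F i) (N i)
  overlap : ∀ i j, i ≠ j → μHE[d - 1] (F i ∩ F j) = 0

namespace IsFaceted

variable {T : Set (E d)} {F : ι → Set (E d)} {N : ι → E d}

theorem isCompact_face (h : IsFaceted T F N) (i : ι) : IsCompact (F i) := by
  refine Metric.isCompact_of_isClosed_isBounded (h.isClosed i) (h.isBounded.closure.subset ?_)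
  exact ((subset_iUnion F i).trans h.frontier_eq.symm.subset).trans frontier_subset_closure

/-- Near almost every point of a face, the domain is one of the two sides of the face. -/
theorem ae_half_ball [Finite ι] (h : IsFaceted T F N) (i : ι) :
    ∀ᵐ y ∂((μHE[d - 1] : Measure (E d)).restrict (F i)), y ∈ F i ∧ (∀ j, j ≠ i → y ∉ F j) ∧
      ∃ ε > 0, ∀ z ∈ Metric.ball y ε, (⟪N i, z⟫ < ⟪N i, y⟫ → z ∈ T) ∧
        (⟪N i, y⟫ < ⟪N i, z⟫ → z ∉ closure T) := by
  obtain ⟨c, hc⟩ := (h.normal i).hyperplane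
  have h1 : ∀ᵐ y ∂((μHE[d - 1] : Measure (E d)).restrict (F i)), ∀ j, j ≠ i → y ∉ F j := by
    rw [ae_all_iff]
    intro j
    by_cases hj : j = i
    · exact .of_forall fun y h => absurd hj h
    · have : ∀ᵐ y ∂((μHE[d - 1] : Measure (E d)).restrict (F i)), y ∉ F j := by
        rw [ae_iff]
        simp only [not_not]
        change (μHE[d - 1] : Measure (E d)).restrict (F i) (F j) = 0
        rw [Measure.restrict_apply (h.isClosed j).measurableSet]
        exact h.overlap j i hj
      filter_upwards [this] with y hy _ using hy
  filter_upwards [ae_restrict_mem (h.isClosed i).measurableSet, h1, (h.normal i).outward]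
    with y hy hyj hout
  refine ⟨hy, hyj, ?_⟩
  have hcl : IsClosed (⋃ j : {j // j ≠ i}, F j) := isClosed_iUnion_of_finite fun j => h.isClosed j
  have hyU : y ∈ (⋃ j : {j // j ≠ i}, F j)ᶜ := by
    simp only [mem_compl_iff, mem_iUnion, not_exists]
    exact fun j => hyj j j.2
  obtain ⟨ε, hε, hball⟩ := Metric.isOpen_iff.1 hcl.isOpen_compl y hyU
  -- in a ball around `y` which meets no other face, the boundary lies in the hyperplane of `F i`
  have hfr : ∀ z ∈ Metric.ball y ε, ⟪N i, z⟫ ≠ ⟪N i, y⟫ → z ∉ frontier T := by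
    intro z hz hne hzT
    rw [h.frontier_eq] at hzT
    obtain ⟨j, hj⟩ := mem_iUnion.1 hzT
    by_cases hji : j = i
    · subst hji
      exact hne ((hc z hj).trans (hc y hy).symm)
    · exact hball hz (mem_iUnion.2 ⟨⟨j, hji⟩, hj⟩)
  -- hence each of the two half balls, being connected, lies in `T` as soon as it meets `T`
  have hsep : ∀ s : Set (E d), IsPreconnected s → s ⊆ Metric.ball y ε →
      (∀ z ∈ s, ⟪N i, z⟫ ≠ ⟪N i, y⟫) → (s ∩ T).Nonempty → s ⊆ T := by
    intro s hs hsb hne hT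
    refine hs.subset_left_of_subset_union h.isOpen isClosed_closure.isOpen_compl
      (disjoint_compl_right_iff_subset.2 subset_closure) (fun z hz => ?_) hT
    by_cases hzc : z ∈ closure T
    · left
      by_contra hzT
      refine hfr z (hsb hz) (hne z hz) ?_
      rw [frontier, h.isOpen.interior_eq]
      exact ⟨hzc, hzT⟩
    · exact Or.inr hzc
  have hlin : IsLinearMap ℝ fun z : E d => ⟪N i, z⟫ :=
    ⟨fun a b => inner_add_right _ _ _, fun a b => by simp [inner_smul_right]⟩
  have hNN : ⟪N i, N i⟫ = (1 : ℝ) := by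
    rw [real_inner_self_eq_norm_sq, (h.normal i).norm_eq]; norm_num
  have hsmall : ∀ᶠ t : ℝ in 𝓝[>] 0, t < ε ∧ 0 < t := by
    filter_upwards [Ioo_mem_nhdsGT hε] with t ht using ⟨ht.2, ht.1⟩
  obtain ⟨t, ⟨ht1, ht2⟩, htε, ht0⟩ := (hout.and hsmall).exists
  refine ⟨ε, hε, fun z hz => ⟨fun hlt => ?_, fun hgt hzT => ?_⟩⟩
  · have hconv : Convex ℝ (Metric.ball y ε ∩ {z | ⟪N i, z⟫ < ⟪N i, y⟫}) :=
      (convex_ball y ε).inter (convex_halfSpace_lt hlin _)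
    refine hsep _ hconv.isPreconnected inter_subset_left (fun w hw => ne_of_lt hw.2)
      ⟨y - t • N i, ⟨?_, ?_⟩, ht1⟩ ⟨hz, hlt⟩
    · rw [Metric.mem_ball, dist_eq_norm]
      simpa [norm_smul, (h.normal i).norm_eq, abs_of_pos ht0] using htε
    · rw [mem_ofPred_eq, inner_sub_right, inner_smul_right, hNN]; linarith
  · have hzT' : z ∈ T := by
      by_contra hz'
      refine hfr z hz (ne_of_gt hgt) ?_
      rw [frontier, h.isOpen.interior_eq]
      exact ⟨hzT, hz'⟩
    have hconv : Convex ℝ (Metric.ball y ε ∩ {z | ⟪N i, y⟫ < ⟪N i, z⟫}) :=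
      (convex_ball y ε).inter (convex_halfSpace_gt hlin _)
    refine ht2 (hsep _ hconv.isPreconnected inter_subset_left (fun w hw => ne_of_gt hw.2)
      ⟨z, ⟨hz, hgt⟩, hzT'⟩ ⟨?_, ?_⟩)
    · rw [Metric.mem_ball, dist_eq_norm]
      simpa [norm_smul, (h.normal i).norm_eq, abs_of_pos ht0] using htε
    · rw [mem_ofPred_eq, inner_add_right, inner_smul_right, hNN]; linarith

/-- The jump `1_T(x - e) - 1_T(x)` of the indicator function of `T` under a shift. -/
noncomputable def shiftJump (T : Set (E d)) (e x : E d) : ℝ :=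
  T.indicator (fun _ => 1) (x - e) - T.indicator (fun _ => 1) x

/-- The number of the layers `layer (F i) e` which contain `x`. -/
noncomputable def layerCount [Fintype ι] (F : ι → Set (E d)) (e x : E d) : ℝ :=
  ∑ i, (layer (F i) e).indicator (fun _ => 1) x

theorem abs_shiftJump_le (T : Set (E d)) (e x : E d) : |shiftJump T e x| ≤ 1 := by
  unfold shiftJump indicator
  split_ifs <;> simp

theorem measurable_shiftJump (hT : MeasurableSet T) (e : E d) : Measurable (shiftJump T e) := by
  unfold shiftJump
  exact ((measurable_const.indicator hT).comp (measurable_id.sub_const e)).sub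
    (measurable_const.indicator hT)

theorem measurable_layerCount [Fintype ι] (h : IsFaceted T F N) (e : E d) :
    Measurable (layerCount F e) := by
  unfold layerCount
  exact Finset.measurable_sum _ fun i _ =>
    measurable_const.indicator (isCompact_layer (h.isCompact_face i) e).measurableSet

theorem layerCount_inv_le [Fintype ι] (F : ι → Set (E d)) (e x : E d) :
    |(layerCount F e x)⁻¹| ≤ 1 := by
  have : ∃ m : ℕ, layerCount F e x = m := by
    classical
    refine ⟨∑ i, if x ∈ layer (F i) e then 1 else 0, ?_⟩
    rw [layerCount, Nat.cast_sum]
    refine Finset.sum_congr rfl fun i _ => ?_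
    by_cases hx : x ∈ layer (F i) e <;> simp [hx]
  obtain ⟨m, hm⟩ := this
  rw [hm, abs_of_nonneg (by positivity)]
  exact Nat.cast_inv_le_one m

/-- If the indicator function of `T` jumps between `x - e` and `x`, then the segment between these
points crosses the boundary, so that `x` lies in a layer. -/
theorem layerCount_ne_zero [Fintype ι] (h : IsFaceted T F N) {e x : E d}
    (hx : shiftJump T e x ≠ 0) : layerCount F e x ≠ 0 := by
  have hfr : ∃ θ ∈ Icc (0 : ℝ) 1, x - θ • e ∈ frontier T := by
    by_contra hcon
    push Not at hcon
    set s : Set (E d) := (fun θ : ℝ => x - θ • e) '' Icc 0 1 with hs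
    have hpre : IsPreconnected s := isPreconnected_Icc.image _ (by fun_prop)
    have hsub : s ⊆ T ∪ (closure T)ᶜ := by
      rintro _ ⟨θ, hθ, rfl⟩
      by_cases hc : x - θ • e ∈ closure T
      · left
        by_contra hT
        exact hcon θ hθ (by rw [frontier, h.isOpen.interior_eq]; exact ⟨hc, hT⟩)
      · exact Or.inr hc
    have hdis : Disjoint T (closure T)ᶜ := disjoint_compl_right_iff_subset.2 subset_closure
    have h0 : x ∈ s := ⟨0, by simp, by simp⟩
    have h1 : x - e ∈ s := ⟨1, by simp, by simp⟩
    apply hx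
    by_cases hT : (s ∩ T).Nonempty
    · have := hpre.subset_left_of_subset_union h.isOpen isClosed_closure.isOpen_compl hdis hsub hT
      simp [shiftJump, this h0, this h1]
    · have h0' : x ∉ T := fun hh => hT ⟨x, h0, hh⟩
      have h1' : x - e ∉ T := fun hh => hT ⟨_, h1, hh⟩
      simp [shiftJump, h0', h1']
  obtain ⟨θ, hθ, hmem⟩ := hfr
  rw [h.frontier_eq] at hmem
  obtain ⟨i, hi⟩ := mem_iUnion.1 hmem
  have hxi : x ∈ layer (F i) e := mem_layer.2 ⟨θ, hθ, _, hi, by simp⟩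
  have : (1 : ℝ) ≤ layerCount F e x := by
    have h1 := Finset.single_le_sum (f := fun i => (layer (F i) e).indicator (fun _ => (1 : ℝ)) x)
      (fun j _ => indicator_nonneg (fun _ _ => zero_le_one) _) (Finset.mem_univ i)
    rwa [indicator_of_mem hxi] at h1
  exact (zero_lt_one.trans_le this).ne'

/-- Near a good point of a face, only this face counts, and the jump is determined by the side to
which `e` points. -/
theorem eventually_shiftJump_eq [Fintype ι] (h : IsFaceted T F N) {i : ι} {y e : E d}
    (hy : y ∈ F i) (hyj : ∀ j, j ≠ i → y ∉ F j)
    (hball : ∃ ε > 0, ∀ z ∈ Metric.ball y ε, (⟪N i, z⟫ < ⟪N i, y⟫ → z ∈ T) ∧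
        (⟪N i, y⟫ < ⟪N i, z⟫ → z ∉ closure T))
    (he : ⟪N i, e⟫ ≠ 0) {θ : ℝ} (hθ : θ ∈ Ioo (0 : ℝ) 1) :
    ∀ᶠ t : ℝ in 𝓝[>] 0, shiftJump T (t • e) (y + θ • t • e) *
      (layerCount F (t • e) (y + θ • t • e))⁻¹ = SignType.sign ⟪N i, e⟫ := by
  obtain ⟨ε, hε, hb⟩ := hball
  have hcl : IsClosed (⋃ j : {j // j ≠ i}, F j) := isClosed_iUnion_of_finite fun j => h.isClosed j
  have hyU : y ∈ (⋃ j : {j // j ≠ i}, F j)ᶜ := by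
    simp only [mem_compl_iff, mem_iUnion, not_exists]
    exact fun j => hyj j j.2
  obtain ⟨δ, hδ, hballδ⟩ := Metric.isOpen_iff.1 hcl.isOpen_compl y hyU
  have hsmall : ∀ᶠ t : ℝ in 𝓝[>] 0, 0 < t ∧ t * ‖e‖ < ε ∧ t * ‖e‖ < δ := by
    have hten : Tendsto (fun t : ℝ => t * ‖e‖) (𝓝[>] 0) (𝓝 0) := by
      have : Tendsto (fun t : ℝ => t * ‖e‖) (𝓝 0) (𝓝 (0 * ‖e‖)) := tendsto_id.mul_const _
      rw [zero_mul] at this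
      exact this.mono_left nhdsWithin_le_nhds
    filter_upwards [self_mem_nhdsWithin, hten.eventually_lt_const hε, hten.eventually_lt_const hδ]
      with t h1 h2 h3 using ⟨h1, h2, h3⟩
  filter_upwards [hsmall] with t ⟨ht, htε, htδ⟩
  have hdist : ∀ s : ℝ, |s| ≤ 1 → dist (y + s • t • e) y ≤ t * ‖e‖ := by
    intro s hs
    rw [dist_eq_norm, add_sub_cancel_left, norm_smul, norm_smul, Real.norm_of_nonneg ht.le]
    exact mul_le_of_le_one_left (by positivity) hs
  have hcount : layerCount F (t • e) (y + θ • t • e) = 1 := by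
    rw [layerCount, Finset.sum_eq_single i, indicator_of_mem]
    · exact mem_layer.2 ⟨θ, ⟨hθ.1.le, hθ.2.le⟩, y, hy, rfl⟩
    · intro j _ hj
      refine indicator_of_notMem (fun hmem => ?_) _
      obtain ⟨s, hs, z, hz, hzeq⟩ := mem_layer.1 hmem
      have hz' : z = y + (θ - s) • t • e := by
        rw [sub_smul, ← add_sub_assoc, ← hzeq, add_sub_cancel_right]
      have hzb : z ∈ Metric.ball y δ := by
        rw [Metric.mem_ball, hz']
        refine (hdist _ ?_).trans_lt htδ
        rw [abs_le]; constructor <;> linarith [hs.1, hs.2, hθ.1, hθ.2]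
      exact hballδ hzb (mem_iUnion.2 ⟨⟨j, hj⟩, hz⟩)
    · exact fun hi => absurd (Finset.mem_univ i) hi
  have hshift : y + θ • t • e - t • e = y + (θ - 1) • t • e := by
    rw [sub_smul, one_smul]; abel
  have hb1 := hb (y + θ • t • e) (by
    rw [Metric.mem_ball]
    exact (hdist _ (by rw [abs_le]; constructor <;> linarith [hθ.1, hθ.2])).trans_lt htε)
  have hb2 := hb (y + (θ - 1) • t • e) (by
    rw [Metric.mem_ball]
    exact (hdist _ (by rw [abs_le]; constructor <;> linarith [hθ.1, hθ.2])).trans_lt htε)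
  have hin : ∀ s : ℝ, ⟪N i, y + s • t • e⟫ = ⟪N i, y⟫ + s * (t * ⟪N i, e⟫) := by
    intro s
    rw [inner_add_right, inner_smul_right, inner_smul_right]
  rw [hin] at hb1 hb2
  rw [hcount, inv_one, mul_one, shiftJump, hshift]
  rcases lt_or_gt_of_ne he with hneg | hpos
  · have hta : t * ⟪N i, e⟫ < 0 := mul_neg_of_pos_of_neg ht hneg
    have h1 : y + θ • t • e ∈ T := hb1.1 (by nlinarith [hθ.1])
    have h2 : y + (θ - 1) • t • e ∉ T := fun hh =>
      hb2.2 (by nlinarith [hθ.2]) (subset_closure hh)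
    simp [h1, h2, sign_neg hneg]
  · have hta : 0 < t * ⟪N i, e⟫ := mul_pos ht hpos
    have h1 : y + θ • t • e ∉ T := fun hh =>
      hb1.2 (by nlinarith [hθ.1]) (subset_closure hh)
    have h2 : y + (θ - 1) • t • e ∈ T := hb2.1 (by nlinarith [hθ.2])
    simp [h1, h2, sign_pos hpos]

/-- The contribution of a face to the difference quotient: the layer over it has volume of order
`t * |⟪N i, e⟫|`, and at almost all of its points the jump tends to the sign of `⟪N i, e⟫`. -/
theorem tendsto_layer_integral [Fintype ι] (h : IsFaceted T F N) {φ : E d → ℝ} (hφ : Continuous φ)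
    (e : E d) (i : ι) :
    Tendsto (fun t : ℝ => t⁻¹ * ∫ x in layer (F i) (t • e),
        φ x * (shiftJump T (t • e) x * (layerCount F (t • e) x)⁻¹)) (𝓝[>] 0)
      (𝓝 (⟪N i, e⟫ * ∫ x in F i, φ x ∂μHE[d - 1])) := by
  obtain ⟨c, hc⟩ := (h.normal i).hyperplane
  have hF : F i ⊆ hyp (N i) c := hc
  have hn := (h.normal i).norm_eq
  have hcpt := h.isCompact_face i
  by_cases he : ⟪N i, e⟫ = 0
  · rw [he, zero_mul]
    refine tendsto_const_nhds.congr fun t => ?_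
    rw [setIntegral_measure_zero _ (volume_layer_eq_zero hn hF (by rw [inner_smul_right, he, mul_zero])),
      mul_zero]
  set P : Measure (ℝ × E d) := (volume.restrict (Icc (0 : ℝ) 1)).prod
        ((μHE[d - 1] : Measure (E d)).restrict (F i)) with hP
  have hfin : IsFiniteMeasure ((μHE[d - 1] : Measure (E d)).restrict (F i)) :=
    ⟨by simpa using hausdorff_lt_top hn hF hcpt⟩
  set G : ℝ → E d → ℝ := fun t x =>
    φ x * (shiftJump T (t • e) x * (layerCount F (t • e) x)⁻¹) with hG
  have hGm : ∀ t, Measurable (G t) := fun t => hφ.measurable.mul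
    ((measurable_shiftJump h.isOpen.measurableSet _).mul (h.measurable_layerCount _).inv)
  have hlim : Tendsto (fun t : ℝ => ∫ z, G t (z.2 + z.1 • t • e) ∂P) (𝓝[>] 0)
      (𝓝 (∫ z, φ z.2 * SignType.sign ⟪N i, e⟫ ∂P)) := by
    obtain ⟨M, hM⟩ := (isCompact_layer hcpt e).exists_bound_of_continuousOn hφ.continuousOn
    refine tendsto_integral_filter_of_dominated_convergence (fun _ => M) ?_ ?_
      (integrable_const M) ?_
    · exact .of_forall fun t => ((hGm t).comp (by fun_prop)).aestronglyMeasurable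
    · filter_upwards [Ioo_mem_nhdsGT zero_lt_one] with t ht
      have hmem1 : ∀ᵐ z ∂P, z.1 ∈ Icc (0 : ℝ) 1 :=
        Measure.quasiMeasurePreserving_fst.ae (ae_restrict_mem measurableSet_Icc)
      have hmem2 : ∀ᵐ z ∂P, z.2 ∈ F i :=
        Measure.quasiMeasurePreserving_snd.ae (ae_restrict_mem hcpt.measurableSet)
      filter_upwards [hmem1, hmem2] with z hz1 hz2
      have hz : z ∈ Icc (0 : ℝ) 1 ×ˢ F i := ⟨hz1, hz2⟩
      have hz' : z.2 + z.1 • t • e ∈ layer (F i) e := by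
        refine mem_layer.2 ⟨z.1 * t, ⟨mul_nonneg hz.1.1 ht.1.le, ?_⟩, z.2, hz.2, by rw [mul_smul]⟩
        exact mul_le_one₀ hz.1.2 ht.1.le ht.2.le
      rw [hG]
      simp only [norm_mul]
      calc _ ≤ M * (1 * 1) := by
            gcongr
            · exact (norm_nonneg _).trans (hM _ hz')
            · exact hM _ hz'
            · exact abs_shiftJump_le _ _ _
            · exact layerCount_inv_le _ _ _
        _ = M := by ring
    · have h1 : ∀ᵐ z ∂P, z.1 ∈ Ioo (0 : ℝ) 1 := by
        refine Measure.quasiMeasurePreserving_fst.ae (p := fun θ => θ ∈ Ioo (0 : ℝ) 1) ?_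
        rw [Measure.restrict_congr_set Ioo_ae_eq_Icc.symm]
        exact ae_restrict_mem measurableSet_Ioo
      have h2 := Measure.quasiMeasurePreserving_snd
        (μ := volume.restrict (Icc (0 : ℝ) 1)) |>.ae (h.ae_half_ball i)
      filter_upwards [h1, h2] with z hz1 ⟨hz2, hz3, hz4⟩
      have hev := h.eventually_shiftJump_eq hz2 hz3 hz4 he hz1
      have hφz : Tendsto (fun t : ℝ => φ (z.2 + z.1 • t • e) * SignType.sign ⟪N i, e⟫) (𝓝[>] 0)
          (𝓝 (φ z.2 * SignType.sign ⟪N i, e⟫)) := by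
        have hcont : Continuous fun t : ℝ => φ (z.2 + z.1 • t • e) * SignType.sign ⟪N i, e⟫ := by
          fun_prop
        have := hcont.tendsto 0
        simp only [zero_smul, smul_zero, add_zero] at this
        exact this.mono_left nhdsWithin_le_nhds
      refine hφz.congr' ?_
      filter_upwards [hev] with t ht
      rw [hG]
      simp only
      rw [ht]
  have hval : ⟪N i, e⟫ * ∫ x in F i, φ x ∂μHE[d - 1]
      = |⟪N i, e⟫| * ∫ z, φ z.2 * SignType.sign ⟪N i, e⟫ ∂P := by
    rw [hP, integral_mul_const, integral_fun_snd]
    simp only [measureReal_restrict_apply_univ, Real.volume_real_Icc_of_le zero_le_one, sub_zero,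
      one_smul]
    rw [mul_comm (∫ x in F i, φ x ∂μHE[d - 1]), ← mul_assoc, abs_mul_sign]
  rw [hval]
  refine (hlim.const_mul _).congr' ?_
  filter_upwards [self_mem_nhdsWithin] with t ht
  have ht0 : (0 : ℝ) < t := ht
  rw [setIntegral_layer hn hF hcpt (by rw [inner_smul_right]; exact mul_ne_zero ht0.ne' he) (hGm t),
    inner_smul_right, abs_mul, abs_of_pos ht0, ← mul_assoc, ← mul_assoc, inv_mul_cancel₀ ht0.ne',
    one_mul]

/-- The divergence theorem in the direction `e`, for Lipschitz functions. The integral over `T` is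
the limit of the difference quotients; shifting the difference onto the indicator function of `T`
leaves integrals over the layers of the faces. Points in several layers are not counted twice, due to
the weight `1 / layerCount`. -/
theorem integral_lineDeriv [Fintype ι] (h : IsFaceted T F N) {φ : E d → ℝ} {K : ℝ≥0}
    (hφ : LipschitzWith K φ) (e : E d) :
    ∫ x in T, lineDeriv ℝ φ x e = ∑ i, ⟪N i, e⟫ * ∫ x in F i, φ x ∂μHE[d - 1] := by
  have hTm := h.isOpen.measurableSet
  have hφc := hφ.continuous
  have hTfin : volume T ≠ ∞ := h.isBounded.measure_lt_top.ne
  have hg : Integrable (T.indicator fun _ => (1 : ℝ)) :=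
    (integrable_indicator_iff hTm).2 (integrableOn_const hTfin)
  have hL := hφ.integral_inv_smul_sub_mul_tendsto_integral_lineDeriv_mul (μ := volume) hg e
  have hval : ∫ x, lineDeriv ℝ φ x e * T.indicator (fun _ => (1 : ℝ)) x
      = ∫ x in T, lineDeriv ℝ φ x e := by
    rw [← integral_indicator hTm]
    refine integral_congr_ae (.of_forall fun x => ?_)
    by_cases hx : x ∈ T <;> simp [hx]
  rw [hval] at hL
  refine tendsto_nhds_unique hL ?_
  have hR := tendsto_finsetSum Finset.univ
    fun i (_ : i ∈ Finset.univ) => h.tendsto_layer_integral hφc e i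
  refine hR.congr' ?_
  filter_upwards [self_mem_nhdsWithin] with t ht
  have ht0 : (0 : ℝ) < t := ht
  have hφT : ∀ a : E d, Integrable fun x => φ x * T.indicator (fun _ => (1 : ℝ)) (x - a) := by
    intro a
    have h1 : Integrable fun x => φ (x + a) * T.indicator (fun _ => (1 : ℝ)) x := by
      have : (fun x => φ (x + a) * T.indicator (fun _ => (1 : ℝ)) x)
          = T.indicator fun x => φ (x + a) := by
        ext x
        by_cases hx : x ∈ T <;> simp [hx]
      rw [this, integrable_indicator_iff hTm]
      exact integrableOn_of_continuousOn_closure h.isBounded hTm hTfin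
        (Continuous.continuousOn (by fun_prop))
    simpa using h1.comp_sub_right a
  -- shift the difference quotient onto the indicator function
  have hD : ∫ x, (t⁻¹ • (φ (x + t • e) - φ x)) * T.indicator (fun _ => (1 : ℝ)) x
      = t⁻¹ * ∫ x, φ x * shiftJump T (t • e) x := by
    have h1 : ∫ x, φ x * shiftJump T (t • e) x
        = (∫ x, φ x * T.indicator (fun _ => (1 : ℝ)) (x - t • e))
          - ∫ x, φ x * T.indicator (fun _ => (1 : ℝ)) x := by
      rw [← integral_sub (hφT _) (by simpa using hφT 0)]
      refine integral_congr_ae (.of_forall fun x => ?_)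
      simp only [shiftJump]; ring
    have h2 : ∫ x, φ x * T.indicator (fun _ => (1 : ℝ)) (x - t • e)
        = ∫ x, φ (x + t • e) * T.indicator (fun _ => (1 : ℝ)) x := by
      rw [← integral_add_right_eq_self _ (t • e)]
      simp
    rw [h1, h2, ← integral_sub ?_ (by simpa using hφT 0), ← integral_const_mul]
    · refine integral_congr_ae (.of_forall fun x => ?_)
      simp only [smul_eq_mul]; ring
    · simpa using (hφT (t • e)).comp_add_right (t • e)
  rw [hD, ← Finset.mul_sum]
  congr 1
  -- distribute the integral over the layers
  have hint : Integrable fun x => φ x * shiftJump T (t • e) x := by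
    refine ((hφT (t • e)).sub (by simpa using hφT 0)).congr (.of_forall fun x => ?_)
    simp only [shiftJump, Pi.sub_apply]; ring
  have hint2 : ∀ i, Integrable ((layer (F i) (t • e)).indicator fun x =>
      φ x * (shiftJump T (t • e) x * (layerCount F (t • e) x)⁻¹)) := by
    intro i
    refine Integrable.indicator ?_ (isCompact_layer (h.isCompact_face i) _).measurableSet
    refine (hint.mul_bdd (g := fun x => (layerCount F (t • e) x)⁻¹) (c := 1) ?_ ?_).congr
      (.of_forall fun x => ?_)
    · exact (h.measurable_layerCount _).inv.aestronglyMeasurable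
    · exact .of_forall fun x => layerCount_inv_le _ _ _
    · simp only; ring
  have hsplit : ∀ i, ∫ x in layer (F i) (t • e),
      φ x * (shiftJump T (t • e) x * (layerCount F (t • e) x)⁻¹)
      = ∫ x, (layer (F i) (t • e)).indicator (fun x =>
          φ x * (shiftJump T (t • e) x * (layerCount F (t • e) x)⁻¹)) x := fun i =>
    (integral_indicator (isCompact_layer (h.isCompact_face i) _).measurableSet).symm
  simp_rw [hsplit]
  rw [← integral_finsetSum _ fun i _ => hint2 i]
  refine integral_congr_ae (.of_forall fun x => ?_)
  have hsum : ∀ m : E d → ℝ, ∑ i, (layer (F i) (t • e)).indicator (fun x =>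
      φ x * (shiftJump T (t • e) x * m x)) x
      = φ x * (shiftJump T (t • e) x * m x) * layerCount F (t • e) x := by
    intro m
    rw [layerCount, Finset.mul_sum]
    refine Finset.sum_congr rfl fun i _ => ?_
    by_cases hx : x ∈ layer (F i) (t • e) <;> simp [hx]
  simp only
  rw [hsum fun x => (layerCount F (t • e) x)⁻¹]
  by_cases hx : shiftJump T (t • e) x = 0
  · simp [hx]
  · have := h.layerCount_ne_zero hx
    field_simp

end IsFaceted

end Divergence

/-! ### Integration by parts against a divergence-free field -/

section PartialIntegration

variable {d : ℕ} {ι : Type*}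

theorem exists_lipschitzOnWith_mul {K : Set (E d)} (hK : Bornology.IsBounded K) {f g : E d → ℝ}
    (hf : ∃ C : ℝ≥0, LipschitzOnWith C f K) (hg : ∃ C : ℝ≥0, LipschitzOnWith C g K) :
    ∃ C : ℝ≥0, LipschitzOnWith C (fun x => f x * g x) K := by
  obtain ⟨C, hC⟩ := hf
  obtain ⟨D, hD⟩ := hg
  have hbd : ∀ {C : ℝ≥0} {f : E d → ℝ}, LipschitzOnWith C f K →
      ∃ M : ℝ≥0, ∀ x ∈ K, |f x| ≤ M := by
    intro C f hf
    rcases K.eq_empty_or_nonempty with rfl | ⟨y, hy⟩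
    · exact ⟨0, by simp⟩
    refine ⟨(|f y| + C * Metric.diam K).toNNReal, fun x hx => ?_⟩
    refine le_trans ?_ (Real.le_coe_toNNReal _)
    have h1 := hf.dist_le_mul x hx y hy
    have h2 := Metric.dist_le_diam_of_mem hK hx hy
    rw [Real.dist_eq] at h1
    calc |f x| ≤ |f y| + |f x - f y| := by
          have := abs_add_le (f y) (f x - f y)
          rwa [add_sub_cancel] at this
      _ ≤ _ := by gcongr; exact h1.trans (by gcongr)
  obtain ⟨M, hM⟩ := hbd hC
  obtain ⟨M', hM'⟩ := hbd hD
  refine ⟨M * D + M' * C, LipschitzOnWith.of_dist_le_mul fun x hx y hy => ?_⟩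
  have h1 := hC.dist_le_mul x hx y hy
  have h2 := hD.dist_le_mul x hx y hy
  rw [Real.dist_eq] at h1 h2 ⊢
  calc |f x * g x - f y * g y| = |f x * (g x - g y) + g y * (f x - f y)| := by ring_nf
    _ ≤ |f x| * |g x - g y| + |g y| * |f x - f y| := by
        rw [← abs_mul, ← abs_mul]; exact abs_add_le _ _
    _ ≤ M * (D * dist x y) + M' * (C * dist x y) := by
        gcongr
        · exact hM x hx
        · exact hM' y hy
    _ = _ := by push_cast; ring

theorem exists_lipschitzOnWith_of_mem_polyFun {K : Set (E d)} (hK : Bornology.IsBounded K) {l : ℕ}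
    {f : E d → ℝ} (hf : f ∈ polyFun d l) : ∃ C : ℝ≥0, LipschitzOnWith C f K := by
  obtain ⟨r, hr⟩ := hK.subset_closedBall (0 : E d)
  obtain ⟨C, hC⟩ := (contDiff_of_mem_polyFun hf).contDiffOn.exists_lipschitzOnWith one_ne_zero
    (convex_closedBall (0 : E d) r) (isCompact_closedBall _ _)
  exact ⟨C, hC.mono hr⟩

/-- Integration by parts against a divergence-free Lipschitz field: the divergence theorem for the
components of `g β`, which are Lipschitz functions. -/
theorem IsFaceted.integral_inner_gradient [Fintype ι] {T : Set (E d)} {F : ι → Set (E d)}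
    {N : ι → E d} (h : IsFaceted T F N) {β : E d → E d}
    (hβ : ∃ K : ℝ≥0, LipschitzOnWith K β (closure T))
    (hdiv : ∀ᵐ x ∂(volume.restrict T), ∑ i, fderiv ℝ β x (EuclideanSpace.single i 1) i = 0)
    {l : ℕ} {g : E d → ℝ} (hg : g ∈ polyFun d l) :
    ∫ x in T, ⟪β x, gradient g x⟫ = ∑ i, ∫ x in F i, ⟪β x, N i⟫ * g x ∂μHE[d - 1] := by
  have hTm := h.isOpen.measurableSet
  have hbc : Bornology.IsBounded (closure T) := h.isBounded.closure
  obtain ⟨K, hK⟩ := hβ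
  -- the components of `g β`, extended to Lipschitz functions on the whole space
  have hex : ∀ j : Fin d, ∃ φ : E d → ℝ, (∃ C : ℝ≥0, LipschitzWith C φ) ∧
      EqOn (fun x => β x j * g x) φ (closure T) := by
    intro j
    have hj : LipschitzOnWith K (fun x => β x j) (closure T) := by
      refine LipschitzOnWith.of_dist_le_mul fun x hx y hy => ?_
      refine le_trans ?_ (hK.dist_le_mul x hx y hy)
      rw [dist_eq_norm, dist_eq_norm, ← PiLp.sub_apply]
      exact PiLp.norm_apply_le _ _
    obtain ⟨C, hC⟩ := exists_lipschitzOnWith_mul hbc ⟨K, hj⟩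
      (exists_lipschitzOnWith_of_mem_polyFun hbc hg)
    obtain ⟨φ, h1, h2⟩ := hC.extend_real
    exact ⟨φ, ⟨C, h1⟩, h2⟩
  choose φ hφ hφeq using hex
  choose C hC using hφ
  set e : Fin d → E d := fun j => EuclideanSpace.single j 1 with he
  have hfaceT : ∀ i, F i ⊆ closure T := fun i =>
    ((subset_iUnion F i).trans h.frontier_eq.symm.subset).trans frontier_subset_closure
  have hsum : ∀ x v : E d, ⟪x, v⟫ = ∑ j, x j * v j := by
    intro x v
    rw [PiLp.inner_apply]
    refine Finset.sum_congr rfl fun j _ => ?_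
    simp [mul_comm]
  have hLint : ∀ j, IntegrableOn (fun x => lineDeriv ℝ (φ j) x (e j)) T := fun j =>
    ((hC j).locallyIntegrable_lineDeriv (e j)).integrableOn_isCompact
      (Metric.isCompact_of_isClosed_isBounded isClosed_closure hbc) |>.mono_set subset_closure
  have hL : ∫ x in T, ⟪β x, gradient g x⟫ = ∫ x in T, ∑ j, lineDeriv ℝ (φ j) x (e j) := by
    have hdiff : ∀ᵐ x ∂(volume.restrict T), DifferentiableWithinAt ℝ β T x :=
      (hK.mono subset_closure).ae_differentiableWithinAt hTm
    refine integral_congr_ae ?_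
    filter_upwards [hdiv, hdiff, ae_restrict_mem hTm] with x hx1 hx2 hxT
    have hT : T ∈ 𝓝 x := h.isOpen.mem_nhds hxT
    have hβx := (hx2.differentiableAt hT).hasFDerivAt
    have hline : ∀ j, lineDeriv ℝ (φ j) x (e j)
        = β x j * fderiv ℝ g x (e j) + g x * fderiv ℝ β x (e j) j := by
      intro j
      have h1 : HasFDerivAt (fun y => β y j)
          ((EuclideanSpace.proj j : E d →L[ℝ] ℝ).comp (fderiv ℝ β x)) x :=
        (EuclideanSpace.proj j : E d →L[ℝ] ℝ).hasFDerivAt.comp x hβx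
      have h2 := h1.fun_mul (differentiable_of_mem_polyFun hg x).hasFDerivAt
      have h3 : HasFDerivAt (φ j) _ x := h2.congr_of_eventuallyEq (by
        filter_upwards [hT] with y hy using (hφeq j (subset_closure hy)).symm)
      rw [(h3.hasLineDerivAt (e j)).lineDeriv]
      simp
    simp_rw [hline]
    rw [Finset.sum_add_distrib, ← Finset.mul_sum, hx1, mul_zero, add_zero, hsum]
    refine Finset.sum_congr rfl fun j _ => ?_
    rw [← inner_gradient, he, EuclideanSpace.inner_single_right]
    simp
  rw [hL, integral_finsetSum _ fun j _ => hLint j]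
  simp_rw [h.integral_lineDeriv (hC _)]
  rw [Finset.sum_comm]
  refine Finset.sum_congr rfl fun i _ => ?_
  obtain ⟨c, hc⟩ := (h.normal i).hyperplane
  have hFfin := (hausdorff_lt_top (h.normal i).norm_eq hc (h.isCompact_face i)).ne
  have hFm := (h.isClosed i).measurableSet
  have hφint : ∀ j, IntegrableOn (φ j) (F i) μHE[d - 1] := fun j =>
    integrableOn_of_continuousOn_closure (h.isCompact_face i).isBounded hFm hFfin
      (hC j).continuous.continuousOn
  simp_rw [← integral_const_mul]
  rw [← integral_finsetSum _ fun j _ => (hφint j).const_mul _]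
  refine setIntegral_congr_fun hFm fun x hx => ?_
  rw [hsum, Finset.sum_mul]
  refine Finset.sum_congr rfl fun j _ => ?_
  rw [← hφeq j (hfaceT i hx), he, EuclideanSpace.inner_single_right]
  simp only [one_mul, conj_trivial]
  ring

end PartialIntegration

/-! ### Polytopes and simplices -/

section Simplices

variable {d : ℕ}

theorem isCompact_hull (S : Finset (E d)) : IsCompact (hull S) :=
  S.finite_toSet.isCompact_convexHull ℝ

theorem IsPolytope.isOpen {P : Set (E d)} (h : IsPolytope P) : IsOpen P := by
  rw [← h.2.1]; exact isOpen_interior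

theorem IsPolytope.isCompact_closure {P : Set (E d)} (h : IsPolytope P) :
    IsCompact (closure P) := by
  obtain ⟨𝒮, -, h𝒮⟩ := h.2.2
  rw [h𝒮]
  exact 𝒮.isCompact_biUnion fun S _ => isCompact_hull S

theorem IsPolytope.isBounded {P : Set (E d)} (h : IsPolytope P) : Bornology.IsBounded P :=
  h.isCompact_closure.isBounded.subset subset_closure

/-- The affine basis formed by the vertices of a simplex. -/
noncomputable def IsSimplex.basis {S : Finset (E d)} (h : IsSimplex S) :
    AffineBasis S ℝ (E d) where
  toFun x := x
  ind' := h.2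
  tot' := by
    rw [h.2.affineSpan_eq_top_iff_card_eq_finrank_add_one]
    simp [h.1]

theorem IsSimplex.range_basis {S : Finset (E d)} (h : IsSimplex S) :
    range h.basis = (S : Set (E d)) := by
  ext x
  constructor
  · rintro ⟨y, rfl⟩; exact y.2
  · intro hx; exact ⟨⟨x, hx⟩, rfl⟩

theorem IsSimplex.mem_hull_iff {S : Finset (E d)} (h : IsSimplex S) {x : E d} :
    x ∈ hull S ↔ ∀ i, 0 ≤ h.basis.coord i x := by
  rw [hull, ← h.range_basis, AffineBasis.convexHull_eq_nonneg_coord]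
  rfl

theorem IsSimplex.mem_interior_hull_iff {S : Finset (E d)} (h : IsSimplex S) {x : E d} :
    x ∈ interior (hull S) ↔ ∀ i, 0 < h.basis.coord i x := by
  rw [hull, ← h.range_basis, AffineBasis.interior_convexHull]
  rfl

theorem IsSimplex.interior_nonempty {S : Finset (E d)} (h : IsSimplex S) :
    (interior (hull S)).Nonempty := by
  rw [hull, interior_convexHull_nonempty_iff_affineSpan_eq_top, ← h.range_basis]
  exact h.basis.tot

theorem IsSimplex.closure_interior {S : Finset (E d)} (h : IsSimplex S) :
    closure (interior (hull S)) = hull S := by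
  have hc : Convex ℝ (hull S) := convex_convexHull ℝ _
  rw [hc.closure_interior_eq_closure_of_nonempty_interior h.interior_nonempty]
  exact (isCompact_hull S).isClosed.closure_eq

/-- The face of the simplex `S` opposite to the vertex `v`. -/
def oppFace (S : Finset (E d)) (v : E d) : Set (E d) := convexHull ℝ ((S : Set (E d)) \ {v})

theorem oppFace_subset_hull (S : Finset (E d)) (v : E d) : oppFace S v ⊆ hull S :=
  convexHull_mono sdiff_subset

theorem isCompact_oppFace (S : Finset (E d)) (v : E d) : IsCompact (oppFace S v) :=
  (S.finite_toSet.subset sdiff_subset).isCompact_convexHull ℝ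

theorem IsSimplex.coord_eq_zero_of_mem_oppFace {S : Finset (E d)} (h : IsSimplex S) (v : S)
    {x : E d} (hx : x ∈ oppFace S v) : h.basis.coord v x = 0 := by
  have hconv : Convex ℝ {x | h.basis.coord v x = 0} :=
    (convex_singleton (0 : ℝ)).affine_preimage (h.basis.coord v)
  refine convexHull_min ?_ hconv hx
  rintro w ⟨hw, hwv⟩
  have : h.basis.coord v (h.basis ⟨w, hw⟩) = 0 :=
    h.basis.coord_apply_ne fun heq => hwv (by rw [heq]; rfl)
  exact this

theorem IsSimplex.mem_oppFace_of_coord_eq_zero {S : Finset (E d)} (h : IsSimplex S) (v : S)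
    {x : E d} (hx : x ∈ hull S) (h0 : h.basis.coord v x = 0) : x ∈ oppFace S v := by
  classical
  have hx' := h.mem_hull_iff.1 hx
  have hsum : ∑ i ∈ Finset.univ.erase v, h.basis.coord i x = 1 := by
    rw [← h.basis.sum_coord_apply_eq_one x, ← Finset.add_sum_erase _ _ (Finset.mem_univ v), h0,
      zero_add]
  have hcomb : ∑ i ∈ Finset.univ.erase v, h.basis.coord i x • (i : E d) = x := by
    have := h.basis.linear_combination_coord_eq_self x
    rwa [← Finset.add_sum_erase _ _ (Finset.mem_univ v), h0, zero_smul, zero_add] at this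
  rw [← hcomb]
  refine (convex_convexHull ℝ _).sum_mem (fun i _ => hx' i) hsum fun i hi => ?_
  refine subset_convexHull ℝ _ ⟨i.2, fun heq => Finset.ne_of_mem_erase hi (Subtype.ext heq)⟩

theorem IsSimplex.exists_mem_oppFace {S : Finset (E d)} (h : IsSimplex S) {x : E d}
    (hx : x ∈ hull S) (hxi : x ∉ interior (hull S)) : ∃ v : S, x ∈ oppFace S v := by
  rw [h.mem_interior_hull_iff] at hxi
  push Not at hxi
  obtain ⟨v, hv⟩ := hxi
  exact ⟨v, h.mem_oppFace_of_coord_eq_zero v hx (le_antisymm hv (h.mem_hull_iff.1 hx v))⟩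

/-- Every neighbourhood of a point of a simplex face contains points of the relative interior of
that face. -/
theorem IsSimplex.exists_relative_interior {S : Finset (E d)} (h : IsSimplex S) (hd : 1 ≤ d) (v : S)
    {x : E d} (hx : x ∈ oppFace S v) {U : Set (E d)} (hU : U ∈ 𝓝 x) :
    ∃ y ∈ U, y ∈ oppFace S v ∧ ∀ w, w ≠ v → 0 < h.basis.coord w y := by
  classical
  obtain ⟨p, hp⟩ := h.interior_nonempty
  rw [h.mem_interior_hull_iff] at hp
  have hlt : h.basis.coord v p < 1 := by
    obtain ⟨w, hw⟩ : ∃ w : S, w ≠ v := by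
      have : 1 < Fintype.card S := by simp [h.1]; omega
      have := Fintype.one_lt_card_iff_nontrivial.1 this
      exact exists_ne v
    have h1 := h.basis.sum_coord_apply_eq_one p
    rw [← Finset.add_sum_erase _ _ (Finset.mem_univ v)] at h1
    have h2 : 0 < ∑ i ∈ Finset.univ.erase v, h.basis.coord i p :=
      Finset.sum_pos (fun i _ => hp i) ⟨w, by simp [hw]⟩
    linarith
  set t := (1 - h.basis.coord v p)⁻¹ with ht
  have htpos : 0 < t := inv_pos.2 (by linarith)
  -- the point where the ray from `v` through `p` meets the opposite face
  set q : E d := AffineMap.lineMap (v : E d) p t with hq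
  have hqv : h.basis.coord v q = 0 := by
    rw [hq, AffineMap.apply_lineMap]
    have : h.basis.coord v (v : E d) = 1 := h.basis.coord_apply_eq v
    rw [this, AffineMap.lineMap_apply, vsub_eq_sub, vadd_eq_add, smul_eq_mul, ht]
    field_simp [(by linarith : (1 - h.basis.coord v p) ≠ 0)]
    ring
  have hqw : ∀ w, w ≠ v → 0 < h.basis.coord w q := by
    intro w hw
    rw [hq, AffineMap.apply_lineMap]
    have : h.basis.coord w (v : E d) = 0 := h.basis.coord_apply_ne hw
    rw [this, AffineMap.lineMap_apply, vsub_eq_sub, vadd_eq_add, smul_eq_mul, sub_zero, add_zero]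
    exact mul_pos htpos (hp w)
  have hqh : q ∈ hull S := h.mem_hull_iff.2 fun w => by
    by_cases hw : w = v
    · rw [hw, hqv]
    · exact (hqw w hw).le
  have hqo : q ∈ oppFace S v := h.mem_oppFace_of_coord_eq_zero v hqh hqv
  have hcont : Tendsto (fun s : ℝ => AffineMap.lineMap x q s) (𝓝[>] 0) (𝓝 x) := by
    have : Continuous fun s : ℝ => AffineMap.lineMap x q s := AffineMap.lineMap_continuous
    have := this.tendsto 0
    simp only [AffineMap.lineMap_apply_zero] at this
    exact this.mono_left nhdsWithin_le_nhds
  obtain ⟨s, hsU, hs⟩ := ((hcont.eventually hU).and (Ioo_mem_nhdsGT zero_lt_one)).exists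
  refine ⟨_, hsU, ?_, fun w hw => ?_⟩
  · exact (convex_convexHull ℝ _).lineMap_mem hx hqo ⟨hs.1.le, hs.2.le⟩
  · rw [AffineMap.apply_lineMap, AffineMap.lineMap_apply_module, smul_eq_mul, smul_eq_mul]
    have h1 := h.mem_hull_iff.1 (oppFace_subset_hull S v hx) w
    have := mul_pos hs.1 (hqw w hw)
    have := mul_nonneg (sub_nonneg.2 hs.2.le) h1
    linarith

/-- A simplex face lies in a hyperplane. -/
theorem IsSimplex.exists_hyp {S : Finset (E d)} (h : IsSimplex S) (hd : 1 ≤ d) (v : S) :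
    ∃ (n : E d) (c : ℝ), ‖n‖ = 1 ∧ oppFace S v ⊆ hyp n c := by
  set f := h.basis.coord v with hf
  set L : E d →L[ℝ] ℝ := LinearMap.toContinuousLinearMap f.linear with hL
  set m : E d := (InnerProductSpace.toDual ℝ (E d)).symm L with hm
  have hfx : ∀ x, f x = ⟪m, x⟫ + f 0 := by
    intro x
    rw [hm, InnerProductSpace.toDual_symm_apply, hL]
    have := f.map_vadd 0 x
    simpa using this
  have hm0 : m ≠ 0 := by
    intro hm0
    have h1 : f (v : E d) = 1 := h.basis.coord_apply_eq v
    obtain ⟨w, hw⟩ : ∃ w : S, w ≠ v := by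
      have : 1 < Fintype.card S := by simp [h.1]; omega
      have := Fintype.one_lt_card_iff_nontrivial.1 this
      exact exists_ne v
    have h2 : f (w : E d) = 0 := h.basis.coord_apply_ne hw.symm
    rw [hfx, hm0, inner_zero_left] at h1 h2
    linarith
  have hm1 : ‖m‖ ≠ 0 := norm_ne_zero_iff.2 hm0
  refine ⟨‖m‖⁻¹ • m, ‖m‖⁻¹ * (-f 0), by rw [norm_smul, norm_inv, norm_norm, inv_mul_cancel₀ hm1],
    fun x hx => ?_⟩
  have h0 := h.coord_eq_zero_of_mem_oppFace v hx
  rw [← hf, hfx] at h0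
  rw [mem_hyp, inner_smul_left]
  simp only [map_inv₀, conj_trivial]
  congr 1
  linarith

theorem interior_convexHull_eq_empty {s : Finset (E d)} (hs : s.card < d + 1) :
    interior (convexHull ℝ (s : Set (E d))) = ∅ := by
  by_contra hne
  rw [← Ne, ← nonempty_iff_ne_empty, interior_convexHull_nonempty_iff_affineSpan_eq_top] at hne
  rcases s.eq_empty_or_nonempty with rfl | hsne
  · simp at hne
  have hcard : s.card = (s.card - 1) + 1 := by
    have := hsne.card_pos
    omega
  have h1 := finrank_vectorSpan_image_finset_le ℝ (fun x : E d => x) s hcard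
  rw [Finset.image_id', ← direction_affineSpan, hne, AffineSubspace.direction_top, finrank_top,
    finrank_euclideanSpace_fin] at h1
  omega

end Simplices

theorem half_le_diam_of_ball_subset {d : ℕ} (hd : 1 ≤ d) {S : Set (E d)}
    (hS : Bornology.IsBounded S) {a : E d} {r : ℝ} (hr : 0 < r) (h : Metric.ball a r ⊆ S) :
    r / 2 ≤ Metric.diam S := by
  set u : E d := EuclideanSpace.single ⟨0, hd⟩ (r / 2) with hu
  have hnorm : ‖u‖ = r / 2 := by
    rw [hu, EuclideanSpace.single, PiLp.norm_single, Real.norm_of_nonneg (by positivity)]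
  have h1 : a + u ∈ S := h (by rw [Metric.mem_ball, dist_eq_norm, add_sub_cancel_left, hnorm]; linarith)
  have h2 : a ∈ S := h (Metric.mem_ball_self hr)
  have := Metric.dist_le_diam_of_mem hS h1 h2
  rwa [dist_eq_norm, add_sub_cancel_left, hnorm] at this

/-! ### Cells and faces -/

namespace Mesh

section Geometry

variable {d : ℕ} {Ω : Set (E d)} (M : Mesh Ω)

theorem isPolytope_cell (T : M.Cell) : IsPolytope T.1 := M.partition.polytope T.1 T.2

theorem isOpen_cell (T : M.Cell) : IsOpen T.1 := (M.isPolytope_cell T).isOpen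

theorem isBounded_cell (T : M.Cell) : Bornology.IsBounded T.1 := (M.isPolytope_cell T).isBounded

theorem nonempty_cell (T : M.Cell) : T.1.Nonempty := (M.isPolytope_cell T).1

theorem closure_cell_subset (T : M.Cell) : closure T.1 ⊆ closure Ω := by
  rw [M.partition.cover]
  exact subset_biUnion_of_mem (u := fun P => closure P) T.2

theorem cell_subset (hΩ : IsPolytope Ω) (T : M.Cell) : T.1 ⊆ Ω := by
  exact (interior_maximal (subset_closure.trans (M.closure_cell_subset T))
    (M.isOpen_cell T)).trans hΩ.2.1.subset

theorem nonempty_Cell (hΩ : IsPolytope Ω) : Nonempty M.Cell := by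
  obtain ⟨x, hx⟩ := hΩ.1
  have := subset_closure hx
  rw [M.partition.cover] at this
  obtain ⟨T, hT, -⟩ := mem_iUnion₂.1 this
  exact ⟨⟨T, hT⟩⟩

theorem mem_facesOf {T : M.Cell} {F : M.Face} : F ∈ M.facesOf T ↔ F.1 ⊆ frontier T.1 := by
  simp [facesOf]

theorem mem_bdryFacesOf {T : M.Cell} {F : M.Face} :
    F ∈ M.bdryFacesOf T ↔ F ∈ M.facesOf T ∧ F.1 ⊆ frontier Ω := by
  simp [facesOf, bdryFacesOf]

theorem exists_cell_of_face (F : M.Face) : ∃ T : M.Cell, F ∈ M.facesOf T := by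
  rcases M.face_type F.1 F.2 with ⟨T, hT, _, _, _, h⟩ | ⟨T, hT, h⟩
  · exact ⟨⟨T, hT⟩, M.mem_facesOf.2 (h.trans inter_subset_left)⟩
  · exact ⟨⟨T, hT⟩, M.mem_facesOf.2 (h.trans inter_subset_left)⟩

theorem face_subset_closure {T : M.Cell} {F : M.Face} (hF : F ∈ M.facesOf T) :
    F.1 ⊆ closure T.1 := (M.mem_facesOf.1 hF).trans frontier_subset_closure

theorem isFaceted (T : M.Cell) : IsFaceted T.1 (fun F : {F // F ∈ M.facesOf T} => F.1.1)
    (fun F => M.nrm T F.1) where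
  isOpen := M.isOpen_cell T
  isBounded := M.isBounded_cell T
  isClosed F := M.face_closed F.1.1 F.1.2
  frontier_eq := by
    rw [M.frontier_eq T.1 T.2]
    ext x
    simp only [mem_sUnion, mem_ofPred_eq, mem_iUnion]
    constructor
    · rintro ⟨F, ⟨hF, hFT⟩, hx⟩
      exact ⟨⟨⟨F, hF⟩, M.mem_facesOf.2 hFT⟩, hx⟩
    · rintro ⟨F, hx⟩
      exact ⟨F.1.1, ⟨F.1.2, M.mem_facesOf.1 F.2⟩, hx⟩
  normal F := M.normal_spec T.1 T.2 F.1.1 F.1.2 (M.mem_facesOf.1 F.2)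
  overlap F F' hne := M.face_overlap _ F.1.2 _ F'.1.2
    fun h => hne (Subtype.ext (Subtype.ext h))

variable {M}

theorem norm_nrm {T : M.Cell} {F : M.Face} (hF : F ∈ M.facesOf T) : ‖M.nrm T F‖ = 1 :=
  ((M.isFaceted T).normal ⟨F, hF⟩).norm_eq

theorem exists_face_hyp {T : M.Cell} {F : M.Face} (hF : F ∈ M.facesOf T) :
    ∃ c, F.1 ⊆ hyp (M.nrm T F) c :=
  ((M.isFaceted T).normal ⟨F, hF⟩).hyperplane

variable (M)

theorem isCompact_face (F : M.Face) : IsCompact F.1 := by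
  obtain ⟨T, hT⟩ := M.exists_cell_of_face F
  exact (M.isFaceted T).isCompact_face ⟨F, hT⟩

theorem hausdorff_face_lt_top (F : M.Face) : μHE[d - 1] F.1 < ∞ := by
  obtain ⟨T, hT⟩ := M.exists_cell_of_face F
  obtain ⟨c, hc⟩ := exists_face_hyp hT
  exact hausdorff_lt_top (norm_nrm hT) hc (M.isCompact_face F)

theorem measurableSet_face (F : M.Face) : MeasurableSet F.1 := (M.isCompact_face F).measurableSet

/-- The integration by parts formula on a cell. -/
theorem integral_inner_gradient (hΩ : IsPolytope Ω) (D : Coeffs Ω) (T : M.Cell) {l : ℕ}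
    {g : E d → ℝ} (hg : g ∈ polyFun d l) :
    ∫ x in T.1, ⟪D.β x, gradient g x⟫ =
      ∑ F ∈ M.facesOf T, ∫ x in F.1, ⟪D.β x, M.nrm T F⟫ * g x ∂μHE[d - 1] := by
  obtain ⟨K, hK⟩ := D.β_lip
  have h := (M.isFaceted T).integral_inner_gradient
    ⟨K, hK.mono (M.closure_cell_subset T)⟩
    (ae_restrict_of_ae_restrict_of_subset (M.cell_subset hΩ T) D.β_div) hg
  rw [h, ← Finset.sum_coe_sort (M.facesOf T)]

/-! ### Adjacency of cells -/

/-- At almost every point of a face, the cell is locally one side of the face. -/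
theorem ae_half_ball {T : M.Cell} {F : M.Face} (hF : F ∈ M.facesOf T) :
    ∀ᵐ y ∂((μHE[d - 1] : Measure (E d)).restrict F.1), y ∈ F.1 ∧
      ∃ ε > 0, ∀ z ∈ Metric.ball y ε, (⟪M.nrm T F, z⟫ < ⟪M.nrm T F, y⟫ → z ∈ T.1) ∧
        (⟪M.nrm T F, y⟫ < ⟪M.nrm T F, z⟫ → z ∉ closure T.1) := by
  filter_upwards [(M.isFaceted T).ae_half_ball ⟨F, hF⟩] with y hy using ⟨hy.1, hy.2.2⟩

theorem neBot_ae_face (F : M.Face) : (ae ((μHE[d - 1] : Measure (E d)).restrict F.1)).NeBot := by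
  rw [ae_neBot, Ne, Measure.restrict_eq_zero]
  exact (M.face_pos F.1 F.2).ne'

variable {M}

/-- Two cells on the same side of a face coincide, since cells are disjoint. -/
theorem eq_of_nrm_eq {T₁ T₂ : M.Cell} {F : M.Face} (h₁ : F ∈ M.facesOf T₁) (h₂ : F ∈ M.facesOf T₂)
    (h : M.nrm T₁ F = M.nrm T₂ F) : T₁ = T₂ := by
  have := M.neBot_ae_face F
  obtain ⟨y, ⟨-, ε₁, hε₁, hb₁⟩, ⟨-, ε₂, hε₂, hb₂⟩⟩ := ((M.ae_half_ball h₁).and (M.ae_half_ball h₂)).exists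
  by_contra hne
  have hdis := M.partition.disjoint _ T₁.2 _ T₂.2 fun h => hne (Subtype.ext h)
  have hn := norm_nrm h₁
  obtain ⟨t, ht0, ht⟩ := exists_between (lt_min hε₁ hε₂)
  have hmem : ∀ ε, t < ε → y - t • M.nrm T₁ F ∈ Metric.ball y ε := fun ε hε => by
    rw [Metric.mem_ball, dist_eq_norm]
    simpa [norm_smul, hn, abs_of_pos ht0] using hε
  have hlt : ⟪M.nrm T₁ F, y - t • M.nrm T₁ F⟫ < ⟪M.nrm T₁ F, y⟫ := by
    rw [inner_sub_right, inner_smul_right, real_inner_self_eq_norm_sq, hn]; linarith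
  exact disjoint_left.1 hdis ((hb₁ _ (hmem _ (ht.trans_le (min_le_left _ _)))).1 hlt)
    ((hb₂ _ (hmem _ (ht.trans_le (min_le_right _ _)))).1 (h ▸ hlt))

/-- A face determines its unit normal up to the sign, which tells apart the cells on its two
sides. -/
theorem nrm_eq_neg {T₁ T₂ : M.Cell} {F : M.Face} (h₁ : F ∈ M.facesOf T₁) (h₂ : F ∈ M.facesOf T₂)
    (hne : T₁ ≠ T₂) : M.nrm T₂ F = -M.nrm T₁ F := by
  by_contra h
  obtain ⟨c, hc⟩ := exists_face_hyp h₁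
  obtain ⟨c', hc'⟩ := exists_face_hyp h₂
  exact (M.face_pos F.1 F.2).ne' (hausdorff_eq_zero_of_subset_hyp (norm_nrm h₁) (norm_nrm h₂)
    (fun h' => hne (eq_of_nrm_eq h₁ h₂ h'.symm)) h hc hc')

variable (M)

/-- The fluxes through interfaces cancel: a sum over all faces of all cells of terms which are odd
in the normal reduces to the boundary faces. -/
theorem sum_faces_eq_sum_bdry (f : M.Face → E d → ℝ)
    (hodd : ∀ F n, f F (-n) = -f F n) :
    ∑ T : M.Cell, ∑ F ∈ M.facesOf T, f F (M.nrm T F)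
      = ∑ T : M.Cell, ∑ F ∈ M.bdryFacesOf T, f F (M.nrm T F) := by
  classical
  have key : ∀ P : M.Cell → Finset M.Face, ∑ T : M.Cell, ∑ F ∈ P T, f F (M.nrm T F)
      = ∑ F : M.Face, ∑ T : M.Cell, if F ∈ P T then f F (M.nrm T F) else 0 := by
    intro P
    rw [Finset.sum_comm]
    refine Finset.sum_congr rfl fun T _ => ?_
    rw [← Finset.sum_filter, Finset.filter_mem_eq_inter, Finset.univ_inter]
  rw [key, key]
  refine Finset.sum_congr rfl fun F _ => ?_
  by_cases hF : F.1 ⊆ frontier Ω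
  · refine Finset.sum_congr rfl fun T _ => ?_
    simp [mem_bdryFacesOf, hF]
  · have h0 : ∀ T : M.Cell, F ∉ M.bdryFacesOf T := fun T h => hF (M.mem_bdryFacesOf.1 h).2
    simp only [h0, if_false, Finset.sum_const_zero]
    rcases M.face_type F.1 F.2 with ⟨T₁, hT₁, T₂, hT₂, hne, h⟩ | ⟨T, hT, h⟩
    · have h₁ : F ∈ M.facesOf ⟨T₁, hT₁⟩ := M.mem_facesOf.2 (h.trans inter_subset_left)
      have h₂ : F ∈ M.facesOf ⟨T₂, hT₂⟩ := M.mem_facesOf.2 (h.trans inter_subset_right)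
      have hne' : (⟨T₁, hT₁⟩ : M.Cell) ≠ ⟨T₂, hT₂⟩ := fun h => hne (congrArg Subtype.val h)
      rw [Finset.sum_eq_add (⟨T₁, hT₁⟩ : M.Cell) ⟨T₂, hT₂⟩ hne' ?_ (by simp) (by simp), if_pos h₁,
        if_pos h₂, nrm_eq_neg h₁ h₂ hne', hodd, add_neg_cancel]
      rintro T - ⟨hT1, hT2⟩
      refine if_neg fun hT => hT2 ?_
      refine eq_of_nrm_eq hT h₂ ?_
      rw [nrm_eq_neg h₁ h₂ hne', nrm_eq_neg h₁ hT (Ne.symm hT1)]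
    · exact absurd (h.trans inter_subset_right) hF

/-! ### Sizes of cells and faces -/

theorem hT_pos (hd : 1 ≤ d) (T : M.Cell) : 0 < M.hT T := by
  obtain ⟨x, hx⟩ := M.nonempty_cell T
  obtain ⟨r, hr, hball⟩ := Metric.isOpen_iff.1 (M.isOpen_cell T) x hx
  have := half_le_diam_of_ball_subset hd (M.isBounded_cell T) hr hball
  exact lt_of_lt_of_le (by positivity) this

theorem nonempty_CellsOf (F : M.Face) : Nonempty (M.CellsOf F) := by
  obtain ⟨T, hT⟩ := M.exists_cell_of_face F
  exact ⟨⟨T, M.mem_facesOf.1 hT⟩⟩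

theorem hF_pos (hd : 1 ≤ d) (F : M.Face) : 0 < M.hF F := by
  have := M.nonempty_CellsOf F
  unfold hF
  split_ifs with h1
  · obtain ⟨T, hT⟩ := exists_eq_ciInf_of_finite (f := fun T : M.CellsOf F => M.hT T.1)
    rw [← hT]
    exact M.hT_pos hd _
  · refine lt_of_le_of_ne Metric.diam_nonneg fun h0 => ?_
    obtain ⟨T, hT⟩ := M.exists_cell_of_face F
    obtain ⟨c, hc⟩ := exists_face_hyp hT
    obtain ⟨C, hC, H⟩ := exists_hausdorff_bound d
    have hb : ∀ h : ℝ, 0 < h → (μHE[d - 1] : Measure (E d)).real F.1 ≤ C * h ^ (d - 1) :=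
      fun h hh => H _ (norm_nrm hT) c F.1 hc (M.isCompact_face F) h hh (by rw [← h0]; exact hh.le)
    have hlim : Tendsto (fun h : ℝ => C * h ^ (d - 1)) (𝓝[>] 0) (𝓝 0) := by
      have hcont : Continuous fun h : ℝ => C * h ^ (d - 1) := by fun_prop
      have := hcont.tendsto 0
      rw [zero_pow (by omega), mul_zero] at this
      exact this.mono_left nhdsWithin_le_nhds
    have h1 : (μHE[d - 1] : Measure (E d)).real F.1 ≤ 0 :=
      ge_of_tendsto hlim (by filter_upwards [self_mem_nhdsWithin] with h hh using hb h hh)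
    have h2 : 0 < (μHE[d - 1] : Measure (E d)).real F.1 :=
      ENNReal.toReal_pos (M.face_pos F.1 F.2).ne' (M.hausdorff_face_lt_top F).ne
    linarith

variable {M}

theorem hF_le_hT {T : M.Cell} {F : M.Face} (hF : F ∈ M.facesOf T) : M.hF F ≤ M.hT T := by
  unfold Mesh.hF
  split_ifs with h1
  · exact ciInf_le (f := fun T : M.CellsOf F => M.hT T.1) (Set.finite_range _).bddBelow
      ⟨T, M.mem_facesOf.1 hF⟩
  · rw [hT, ← Metric.diam_closure T.1]
    exact Metric.diam_mono (M.face_subset_closure hF) (M.isBounded_cell T).closure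

variable (M)

theorem diam_face_le (F : M.Face) : Metric.diam F.1 ≤ M.hF F := by
  unfold hF
  split_ifs with h1
  · subst h1
    obtain ⟨T, hT⟩ := M.exists_cell_of_face F
    obtain ⟨c, hc⟩ := exists_face_hyp hT
    have hn := norm_nrm hT
    have hsub : F.1.Subsingleton := by
      intro x hx y hy
      have h1 : ⟪M.nrm T F, x⟫ = c := hc hx
      have h2 : ⟪M.nrm T F, y⟫ = c := hc hy
      rw [PiLp.inner_apply, Fin.sum_univ_one] at h1 h2
      have hn0 : M.nrm T F 0 ≠ 0 := by
        intro h0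
        rw [EuclideanSpace.norm_eq, Fin.sum_univ_one, h0] at hn
        simp at hn
      have h3 : x 0 * M.nrm T F 0 = y 0 * M.nrm T F 0 := by
        simpa [mul_comm] using h1.trans h2.symm
      ext i
      rw [Subsingleton.elim i 0]
      exact mul_right_cancel₀ hn0 h3
    rw [Metric.diam_subsingleton hsub]
    exact Real.iInf_nonneg fun T => Metric.diam_nonneg
  · exact le_rfl

end Geometry

end Mesh

/-! ### Consequences of the matching simplicial submesh -/

namespace Mesh

section Submesh

variable {d : ℕ} {Ω : Set (E d)} {M : Mesh Ω} {𝒮 : Finset (Finset (E d))}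

open Classical in
/-- The simplices of the submesh contained in the cell `T`. -/
noncomputable def simplicesIn (𝒮 : Finset (Finset (E d))) (T : Set (E d)) :
    Finset (Finset (E d)) := {S ∈ 𝒮 | interior (hull S) ⊆ T}

theorem mem_simplicesIn {T : Set (E d)} {S : Finset (E d)} :
    S ∈ simplicesIn 𝒮 T ↔ S ∈ 𝒮 ∧ interior (hull S) ⊆ T := by
  simp [simplicesIn]

theorem IsMatchingSubmesh.hull_subset_closure (h : M.IsMatchingSubmesh 𝒮) {T : Set (E d)}
    {S : Finset (E d)} (hS : S ∈ simplicesIn 𝒮 T) : hull S ⊆ closure T := by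
  rw [mem_simplicesIn] at hS
  rw [← (h.simplex S hS.1).closure_interior]
  exact closure_mono hS.2

theorem IsMatchingSubmesh.exists_simplex (h : M.IsMatchingSubmesh 𝒮) (T : M.Cell) {x : E d}
    (hx : x ∈ T.1) : ∃ S ∈ simplicesIn 𝒮 T.1, x ∈ hull S := by
  have hxΩ := M.closure_cell_subset T (subset_closure hx)
  rw [h.cover] at hxΩ
  obtain ⟨S, hS, hxS⟩ := mem_iUnion₂.1 hxΩ
  obtain ⟨T', hT', hin⟩ := h.in_cell S hS
  have hxT' : x ∈ closure T' := h.hull_subset_closure (mem_simplicesIn.2 ⟨hS, hin⟩) hxS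
  have heq : T' = T.1 := by
    by_contra hne
    have hdis := M.partition.disjoint _ hT' _ T.2 hne
    exact disjoint_left.1 ((hdis.symm.closure_right (M.isOpen_cell T))) hx hxT'
  exact ⟨S, mem_simplicesIn.2 ⟨hS, heq ▸ hin⟩, hxS⟩

theorem IsMatchingSubmesh.closure_subset (h : M.IsMatchingSubmesh 𝒮) (T : M.Cell) :
    closure T.1 ⊆ ⋃ S ∈ simplicesIn 𝒮 T.1, hull S := by
  refine closure_minimal (fun x hx => ?_) ?_
  · obtain ⟨S, hS, hxS⟩ := h.exists_simplex T hx
    exact mem_iUnion₂.2 ⟨S, hS, hxS⟩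
  · exact isClosed_biUnion_finset fun S _ => (isCompact_hull S).isClosed

/-- If a cell is locally one side of a hyperplane at `y`, so are the simplices in it. -/
theorem IsMatchingSubmesh.inner_le (h : M.IsMatchingSubmesh 𝒮) {T : Set (E d)} {S : Finset (E d)}
    (hS : S ∈ simplicesIn 𝒮 T) {y n : E d} (hy : y ∈ hull S)
    (hball : ∃ ε > 0, ∀ z ∈ Metric.ball y ε, (⟪n, z⟫ < ⟪n, y⟫ → z ∈ T) ∧
        (⟪n, y⟫ < ⟪n, z⟫ → z ∉ closure T)) : ∀ p ∈ hull S, ⟪n, p⟫ ≤ ⟪n, y⟫ := by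
  obtain ⟨ε, hε, hb⟩ := hball
  intro p hp
  by_contra hlt
  push Not at hlt
  have hcont : Tendsto (fun s : ℝ => AffineMap.lineMap y p s) (𝓝[>] 0) (𝓝 y) := by
    have : Continuous fun s : ℝ => AffineMap.lineMap y p s := AffineMap.lineMap_continuous
    have := this.tendsto 0
    simp only [AffineMap.lineMap_apply_zero] at this
    exact this.mono_left nhdsWithin_le_nhds
  obtain ⟨s, hsb, hs⟩ := ((hcont.eventually (Metric.ball_mem_nhds y hε)).and
    (Ioo_mem_nhdsGT zero_lt_one)).exists
  refine (hb _ hsb).2 ?_ (h.hull_subset_closure hS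
    ((convex_convexHull ℝ _).lineMap_mem hy hp ⟨hs.1.le, hs.2.le⟩))
  rw [AffineMap.lineMap_apply_module, inner_add_right, inner_smul_right, inner_smul_right]
  nlinarith [hs.1]

/-- A simplex face in a cell which meets a face of this cell in a set of positive measure lies in
the boundary of the cell. Otherwise it contains a point `y` of the cell, and a simplex beyond `y`
contains the whole simplex face as the mesh is matching; so the cell would be on both sides of its
face. -/
theorem IsMatchingSubmesh.oppFace_subset_frontier (h : M.IsMatchingSubmesh 𝒮) (hd : 1 ≤ d)
    {T : M.Cell} {F : M.Face} (hF : F ∈ M.facesOf T) {S : Finset (E d)}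
    (hS : S ∈ simplicesIn 𝒮 T.1) {v : E d} (hv : v ∈ S)
    (hpos : μHE[d - 1] (oppFace S v ∩ F.1) ≠ 0) : oppFace S v ⊆ frontier T.1 := by
  have hSx := h.simplex S (mem_simplicesIn.1 hS).1
  obtain ⟨c, hc⟩ := exists_face_hyp hF
  obtain ⟨n', c', hn', hc'⟩ := hSx.exists_hyp hd ⟨v, hv⟩
  set n := M.nrm T F with hn_def
  have hn : ‖n‖ = 1 := norm_nrm hF
  -- a point where the cell is locally one side of the face
  obtain ⟨y', hy'σ, hy'F, hball⟩ : ∃ y', y' ∈ oppFace S v ∧ y' ∈ F.1 ∧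
      ∃ ε > 0, ∀ z ∈ Metric.ball y' ε, (⟪n, z⟫ < ⟪n, y'⟫ → z ∈ T.1) ∧
        (⟪n, y'⟫ < ⟪n, z⟫ → z ∉ closure T.1) := by
    have hfr : ∃ᵐ y ∂((μHE[d - 1] : Measure (E d)).restrict F.1), y ∈ oppFace S v := by
      rw [frequently_ae_mem_iff, Measure.restrict_apply (isCompact_oppFace S v).measurableSet]
      exact hpos
    obtain ⟨y, hy1, hy2, hy3⟩ := (hfr.and_eventually (M.ae_half_ball hF)).exists
    exact ⟨y, hy1, hy2, hy3⟩
  have hσc : ∀ y ∈ oppFace S v, ⟪n, y⟫ = ⟪n, y'⟫ := by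
    intro y hy
    have h1 : ⟪n', y⟫ = c' := hc' hy
    have h2 : ⟪n', y'⟫ = c' := hc' hy'σ
    by_cases e1 : n' = n
    · rw [← e1, h1, h2]
    by_cases e2 : n' = -n
    · have e3 : n = -n' := by rw [e2, neg_neg]
      rw [e3, inner_neg_left, inner_neg_left, h1, h2]
    · exact absurd (hausdorff_eq_zero_of_subset_hyp hn hn' e1 e2 (inter_subset_right.trans hc)
        (inter_subset_left.trans hc')) hpos
  intro x hx
  rw [frontier, (M.isOpen_cell T).interior_eq]
  refine ⟨h.hull_subset_closure hS (oppFace_subset_hull S v hx), fun hxT => ?_⟩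
  obtain ⟨y, hyT, hyσ, hypos⟩ := hSx.exists_relative_interior hd ⟨v, hv⟩ hx
    ((M.isOpen_cell T).mem_nhds hxT)
  -- the cell contains points beyond `y`, and so does one of the simplices containing `y`
  have hcont : Tendsto (fun s : ℝ => y + s • n) (𝓝[>] 0) (𝓝 y) := by
    have : Continuous fun s : ℝ => y + s • n := by fun_prop
    have := this.tendsto 0
    simp only [zero_smul, add_zero] at this
    exact this.mono_left nhdsWithin_le_nhds
  have hfreq : ∃ S' ∈ simplicesIn 𝒮 T.1, ∃ᶠ s : ℝ in 𝓝[>] 0, y + s • n ∈ hull S' := by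
    by_contra hcon
    push Not at hcon
    have hev : ∀ᶠ s : ℝ in 𝓝[>] 0, ∀ S' ∈ simplicesIn 𝒮 T.1, y + s • n ∉ hull S' :=
      (Finset.eventually_all _).2 hcon
    obtain ⟨s, hs1, hs2⟩ := (hev.and (hcont.eventually ((M.isOpen_cell T).mem_nhds hyT))).exists
    obtain ⟨S', hS', hmem⟩ := h.exists_simplex T hs2
    exact hs1 S' hS' hmem
  obtain ⟨S', hS', hfr⟩ := hfreq
  have hyS' : y ∈ hull S' :=
    (isCompact_hull S').isClosed.mem_of_frequently_of_tendsto hfr hcont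
  have hSS' : (S : Set (E d)) \ {v} ⊆ S' := by
    rintro w ⟨hwS, hwv⟩
    by_contra hwS'
    have hyc : y ∈ convexHull ℝ ((S : Set (E d)) ∩ S') := by
      rw [← h.matching S (mem_simplicesIn.1 hS).1 S' (mem_simplicesIn.1 hS').1]
      exact ⟨oppFace_subset_hull S v hyσ, hyS'⟩
    have hsub : convexHull ℝ ((S : Set (E d)) ∩ S') ⊆ oppFace S w :=
      convexHull_mono fun u hu => ⟨hu.1, fun huw => hwS' (by rw [← mem_singleton_iff.1 huw]; exact hu.2)⟩
    have h0 := hSx.coord_eq_zero_of_mem_oppFace ⟨w, hwS⟩ (hsub hyc)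
    have := hypos ⟨w, hwS⟩ fun heq => hwv (congrArg Subtype.val heq)
    linarith
  have hy'S' : y' ∈ hull S' := convexHull_mono hSS' hy'σ
  obtain ⟨s, hs, hs0⟩ := (hfr.and_eventually self_mem_nhdsWithin).exists
  have hle := h.inner_le hS' hy'S' hball _ hs
  rw [inner_add_right, inner_smul_right, real_inner_self_eq_norm_sq, hn, hσc y hyσ] at hle
  have : (0 : ℝ) < s := hs0
  linarith

/-- Every face of a cell contains a face of a simplex in this cell. -/
theorem IsMatchingSubmesh.exists_oppFace_subset (h : M.IsMatchingSubmesh 𝒮) (hd : 1 ≤ d)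
    {T : M.Cell} {F : M.Face} (hF : F ∈ M.facesOf T) :
    ∃ S ∈ simplicesIn 𝒮 T.1, ∃ v ∈ S, oppFace S v ⊆ F.1 ∧ μHE[d - 1] (oppFace S v) ≠ 0 := by
  obtain ⟨S, hS, v, hv, hpos⟩ : ∃ S ∈ simplicesIn 𝒮 T.1, ∃ v ∈ S,
      μHE[d - 1] (oppFace S v ∩ F.1) ≠ 0 := by
    by_contra hcon
    push Not at hcon
    refine (M.face_pos F.1 F.2).ne' (measure_mono_null (t := ⋃ S ∈ simplicesIn 𝒮 T.1, ⋃ v ∈ S,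
      (oppFace S v ∩ F.1)) (fun x hx => ?_) ?_)
    · obtain ⟨S, hS, hxS⟩ := mem_iUnion₂.1 (h.closure_subset T (M.face_subset_closure hF hx))
      have hxi : x ∉ interior (hull S) := fun hxi => by
        have hfr := M.mem_facesOf.1 hF hx
        rw [frontier, (M.isOpen_cell T).interior_eq] at hfr
        exact hfr.2 ((mem_simplicesIn.1 hS).2 hxi)
      obtain ⟨v, hv⟩ := (h.simplex S (mem_simplicesIn.1 hS).1).exists_mem_oppFace hxS hxi
      exact mem_iUnion₂.2 ⟨S, hS, mem_iUnion₂.2 ⟨v, v.2, hv, hx⟩⟩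
    · refine (measure_biUnion_null_iff (Finset.countable_toSet _)).2 fun S hS => ?_
      exact (measure_biUnion_null_iff (Finset.countable_toSet _)).2 fun v hv => hcon S hS v hv
  refine ⟨S, hS, v, hv, ?_, fun h0 => hpos (measure_mono_null inter_subset_left h0)⟩
  obtain ⟨F', hF', -, hsub⟩ := h.in_face S (mem_simplicesIn.1 hS).1 v hv T.1 T.2
    (h.oppFace_subset_frontier hd hF hS hv hpos)
  have heq : F' = F.1 := by
    by_contra hne
    refine hpos (measure_mono_null (fun x hx => ?_) (M.face_overlap F' hF' F.1 F.2 hne))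
    exact ⟨hsub hx.1, hx.2⟩
  exact heq ▸ hsub

/-- Each face of a cell contains a face of positive measure of some simplex in the cell, and these
are distinct for distinct faces of the cell. -/
theorem IsMatchingSubmesh.card_facesOf_le (h : M.IsMatchingSubmesh 𝒮) (hd : 1 ≤ d) (T : M.Cell) :
    (M.facesOf T).card ≤ (d + 1) * (simplicesIn 𝒮 T.1).card := by
  classical
  have hex : ∀ F : M.Face, ∃ p : (_ : Finset (E d)) × E d, F ∈ M.facesOf T →
      p.1 ∈ simplicesIn 𝒮 T.1 ∧ p.2 ∈ p.1 ∧ oppFace p.1 p.2 ⊆ F.1 ∧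
        μHE[d - 1] (oppFace p.1 p.2) ≠ 0 := by
    intro F
    by_cases hF : F ∈ M.facesOf T
    · obtain ⟨S, hS, v, hv, h1, h2⟩ := h.exists_oppFace_subset hd hF
      exact ⟨⟨S, v⟩, fun _ => ⟨hS, hv, h1, h2⟩⟩
    · exact ⟨⟨∅, 0⟩, fun h => absurd h hF⟩
  choose f hf using hex
  have hle : (M.facesOf T).card ≤ ((simplicesIn 𝒮 T.1).sigma fun S => S).card := by
    refine Finset.card_le_card_of_injOn f (fun F hF => ?_) fun F hF F' hF' heq => ?_
    · exact Finset.mem_sigma.2 ⟨(hf F hF).1, (hf F hF).2.1⟩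
    · by_contra hne
      refine (hf F hF).2.2.2 (measure_mono_null (fun x hx => ?_)
        (M.face_overlap F.1 F.2 F'.1 F'.2 fun h => hne (Subtype.ext h)))
      exact ⟨(hf F hF).2.2.1 hx, (hf F' hF').2.2.1 (heq ▸ hx)⟩
  rw [Finset.card_sigma, Finset.sum_congr rfl fun S hS =>
    (h.simplex S (mem_simplicesIn.1 hS).1).1, Finset.sum_const, smul_eq_mul, mul_comm] at hle
  exact hle

/-- Two simplices of a matching mesh share a simplex of lower dimension, which has no interior. -/
theorem IsMatchingSubmesh.disjoint_interior (h : M.IsMatchingSubmesh 𝒮) {S S' : Finset (E d)}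
    (hS : S ∈ 𝒮) (hS' : S' ∈ 𝒮) (hne : S ≠ S') :
    Disjoint (interior (hull S)) (interior (hull S')) := by
  classical
  rw [disjoint_iff_inter_eq_empty, ← interior_inter, h.matching S hS S' hS', ← Finset.coe_inter]
  refine interior_convexHull_eq_empty ?_
  rw [← (h.simplex S hS).1]
  refine Finset.card_lt_card (Finset.ssubset_iff_subset_ne.2 ⟨Finset.inter_subset_left, fun heq => ?_⟩)
  have hsub : S ⊆ S' := Finset.inter_eq_left.1 heq
  exact hne (Finset.eq_of_subset_of_card_le hsub
    (by rw [(h.simplex S hS).1, (h.simplex S' hS').1]))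

theorem exists_ball_of_inradius {S : Set (E d)} {r : ℝ} (h : r < inradius S) :
    ∃ a, Metric.ball a r ⊆ S := by
  have hne : {r : ℝ | ∃ x, Metric.ball x r ⊆ S}.Nonempty := ⟨0, 0, by simp⟩
  obtain ⟨r', ⟨a, ha⟩, hr'⟩ := exists_lt_of_lt_csSup hne h
  exact ⟨a, (Metric.ball_subset_ball hr'.le).trans ha⟩

/-- Every simplex in a cell contains a ball of comparable size. -/
theorem exists_ball_subset_interior {ϱ : ℝ} (hϱ : 0 < ϱ) (hd : 1 ≤ d)
    (hreg : ∀ S ∈ 𝒮, ϱ * Metric.diam (hull S) ≤ inradius (hull S))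
    (hcomp : ∀ T ∈ M.cells, ∀ S ∈ 𝒮, interior (hull S) ⊆ T →
      ϱ * Metric.diam T ≤ Metric.diam (hull S))
    (T : M.Cell) {S : Finset (E d)} (hS : S ∈ simplicesIn 𝒮 T.1) :
    ∃ a, Metric.ball a (ϱ ^ 2 / 2 * M.hT T) ⊆ interior (hull S) := by
  have hT := M.hT_pos hd T
  have h1 := hreg S (mem_simplicesIn.1 hS).1
  have h2 := hcomp T.1 T.2 S (mem_simplicesIn.1 hS).1 (mem_simplicesIn.1 hS).2
  have h3 : ϱ ^ 2 * M.hT T ≤ inradius (hull S) := by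
    refine le_trans ?_ h1
    rw [sq, mul_assoc]
    exact mul_le_mul_of_nonneg_left h2 hϱ.le
  have hpos : 0 < ϱ ^ 2 * M.hT T := by positivity
  obtain ⟨a, ha⟩ := exists_ball_of_inradius (r := ϱ ^ 2 / 2 * M.hT T)
    (S := hull S) (by linarith)
  exact ⟨a, interior_maximal ha Metric.isOpen_ball⟩

/-- A shape-regularity statement: a cell contains a ball of comparable size. -/
theorem exists_ball_subset_cell (hd : 1 ≤ d) {ϱ : ℝ} (hϱ : 0 < ϱ) (hM : M.IsAdmissible ϱ)
    (T : M.Cell) : ∃ a, Metric.ball a (ϱ ^ 2 / 2 * M.hT T) ⊆ T.1 ∧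
      closure T.1 ⊆ Metric.closedBall a (M.hT T) := by
  obtain ⟨⟨𝒮, hsub, hreg, hcomp⟩, -⟩ := hM
  obtain ⟨x, hx⟩ := M.nonempty_cell T
  obtain ⟨S, hS, -⟩ := hsub.exists_simplex T hx
  obtain ⟨a, ha⟩ := exists_ball_subset_interior hϱ hd hreg hcomp T hS
  have haT := ha.trans (mem_simplicesIn.1 hS).2
  refine ⟨a, haT, closure_minimal (fun y hy => ?_) Metric.isClosed_closedBall⟩
  have hT := M.hT_pos hd T
  exact Metric.dist_le_diam_of_mem (M.isBounded_cell T) hy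
    (haT (Metric.mem_ball_self (by positivity)))

/-- The number of faces of a cell is bounded in terms of the dimension and the mesh regularity: the
simplices in the cell contain disjoint balls of a size comparable to that of the cell. -/
theorem card_facesOf_le (hd : 1 ≤ d) {ϱ : ℝ} (hϱ : 0 < ϱ) (hM : M.IsAdmissible ϱ) (T : M.Cell) :
    ((M.facesOf T).card : ℝ) ≤ (d + 1) * ((ϱ ^ 2 / 2) ^ d)⁻¹ := by
  obtain ⟨a, -, hcl⟩ := exists_ball_subset_cell hd hϱ hM T
  obtain ⟨⟨𝒮, hsub, hreg, hcomp⟩, -⟩ := hM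
  have hT := M.hT_pos hd T
  have h1 : ((M.facesOf T).card : ℝ) ≤ (d + 1) * ((simplicesIn 𝒮 T.1).card : ℝ) := by
    exact_mod_cast hsub.card_facesOf_le hd T
  refine h1.trans (mul_le_mul_of_nonneg_left ?_ (by positivity))
  set r := ϱ ^ 2 / 2 * M.hT T with hr
  have hr0 : 0 < r := by positivity
  set ω := volume (Metric.ball (0 : E d) 1) with hω
  have hω0 : ω ≠ 0 := (Metric.measure_ball_pos volume 0 one_pos).ne'
  have hωt : ω ≠ ∞ := measure_ball_lt_top.ne
  have hvol : ((simplicesIn 𝒮 T.1).card : ℝ≥0∞) * (ENNReal.ofReal (r ^ d) * ω)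
      ≤ ENNReal.ofReal (M.hT T ^ d) * ω := by
    calc ((simplicesIn 𝒮 T.1).card : ℝ≥0∞) * (ENNReal.ofReal (r ^ d) * ω)
        = ∑ S ∈ simplicesIn 𝒮 T.1, ENNReal.ofReal (r ^ d) * ω := by
          rw [Finset.sum_const, nsmul_eq_mul]
      _ ≤ ∑ S ∈ simplicesIn 𝒮 T.1, volume (interior (hull S)) := by
          refine Finset.sum_le_sum fun S hS => ?_
          obtain ⟨b, hb⟩ := exists_ball_subset_interior hϱ hd hreg hcomp T hS
          refine le_trans (le_of_eq ?_) (measure_mono hb)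
          rw [Measure.addHaar_ball_of_pos _ _ hr0, finrank_euclideanSpace_fin]
      _ = volume (⋃ S ∈ simplicesIn 𝒮 T.1, interior (hull S)) := by
          refine (measure_biUnion_finset (fun S hS S' hS' hne => ?_)
            fun S _ => isOpen_interior.measurableSet).symm
          exact hsub.disjoint_interior (mem_simplicesIn.1 hS).1 (mem_simplicesIn.1 hS').1 hne
      _ ≤ volume (Metric.closedBall a (M.hT T)) := by
          refine measure_mono (iUnion₂_subset fun S hS => ?_)
          exact ((mem_simplicesIn.1 hS).2.trans subset_closure).trans hcl
      _ = _ := by rw [Measure.addHaar_closedBall _ _ hT.le, finrank_euclideanSpace_fin]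
  rw [← mul_assoc] at hvol
  have h2 := (ENNReal.mul_le_mul_iff_left hω0 hωt).1 hvol
  have h3 := ENNReal.toReal_mono ENNReal.ofReal_ne_top h2
  rw [ENNReal.toReal_mul, ENNReal.toReal_natCast, ENNReal.toReal_ofReal (by positivity),
    ENNReal.toReal_ofReal (by positivity), hr, mul_pow, ← mul_assoc] at h3
  have h4 := le_of_mul_le_mul_right (h3.trans_eq (one_mul _).symm) (pow_pos hT d)
  rwa [← one_div, le_div_iff₀ (by positivity)]

/-- Bounds on the measure of a face, scaled by the size of the cell. For `d = 1` the surface measure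
is the counting measure, and the second bound rests on the lower bound for `hF` in an admissible
mesh. -/
theorem exists_face_measure_bound (d : ℕ) (hd : 1 ≤ d) {ϱ : ℝ} (hϱ : 0 < ϱ) :
    ∃ C : ℝ, 0 ≤ C ∧ ∀ (Ω : Set (E d)) (M : Mesh Ω), M.IsAdmissible ϱ → ∀ (T : M.Cell),
      ∀ F ∈ M.facesOf T,
      (μHE[d - 1] : Measure (E d)).real F.1 * (M.hT T ^ d)⁻¹ * M.hT T ≤ C ∧
      (μHE[d - 1] : Measure (E d)).real F.1 * (M.hT T ^ d)⁻¹ * M.hT T ^ 2 ≤ C * M.hF F := by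
  obtain ⟨C, hC, H⟩ := exists_hausdorff_bound d
  refine ⟨C * max 1 (ϱ ^ 2)⁻¹, by positivity, fun Ω M hM T F hF => ?_⟩
  obtain ⟨c, hc⟩ := exists_face_hyp hF
  have hT := M.hT_pos hd T
  have hF0 := M.hF_pos hd F
  have hle := hF_le_hT hF
  have hm := H _ (norm_nrm hF) c F.1 hc (M.isCompact_face F) (M.hF F) hF0 (M.diam_face_le F)
  set m := (μHE[d - 1] : Measure (E d)).real F.1
  have h1 : (1 : ℝ) ≤ max 1 (ϱ ^ 2)⁻¹ := le_max_left _ _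
  have hpow : M.hT T ^ d = M.hT T ^ (d - 1) * M.hT T := by
    rw [← pow_succ]; congr 1; omega
  constructor
  · have : m * (M.hT T ^ d)⁻¹ * M.hT T = m / M.hT T ^ (d - 1) := by
      rw [hpow]; field_simp
    rw [this, div_le_iff₀ (by positivity)]
    calc m ≤ C * M.hF F ^ (d - 1) := hm
      _ ≤ C * M.hT T ^ (d - 1) := by gcongr
      _ ≤ C * max 1 (ϱ ^ 2)⁻¹ * M.hT T ^ (d - 1) := by
          gcongr; exact le_mul_of_one_le_right hC h1
  · have : m * (M.hT T ^ d)⁻¹ * M.hT T ^ 2 = m * M.hT T / M.hT T ^ (d - 1) := by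
      rw [hpow]; field_simp
    rw [this, div_le_iff₀ (by positivity)]
    rcases Nat.lt_or_ge 1 d with hd2 | hd1
    · have e : d - 1 = (d - 2) + 1 := by omega
      calc m * M.hT T ≤ C * M.hF F ^ (d - 1) * M.hT T := by gcongr
        _ = C * (M.hF F ^ (d - 2)) * (M.hF F * M.hT T) := by rw [e, pow_succ]; ring
        _ ≤ C * (M.hT T ^ (d - 2)) * (M.hF F * M.hT T) := by gcongr
        _ = C * M.hF F * M.hT T ^ (d - 1) := by rw [e, pow_succ]; ring
        _ ≤ _ := by
          gcongr; exact le_mul_of_one_le_right hC h1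
    · obtain rfl : d = 1 := le_antisymm hd1 hd
      have h2 := hM.2 rfl T F hF
      simp only [Nat.sub_self, pow_zero, mul_one] at hm ⊢
      calc m * M.hT T ≤ C * M.hT T := by gcongr
        _ ≤ C * ((ϱ ^ 2)⁻¹ * M.hF F) := by
          gcongr
          rw [inv_mul_eq_div, le_div_iff₀ (by positivity), mul_comm]
          exact h2
        _ ≤ C * (max 1 (ϱ ^ 2)⁻¹ * M.hF F) := by
          gcongr; exact le_max_right _ _
        _ = _ := by ring

end Submesh

end Mesh

/-! ### Projections and reconstructions -/

section FacePoly

variable {d : ℕ}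

theorem mem_facePoly {l : ℕ} {F : Set (E d)} {f : E d → ℝ} :
    f ∈ facePoly d l F ↔ ∃ p ∈ polyFun d l, F.indicator p = f := by
  simp only [facePoly, Submodule.mem_map]
  rfl

theorem indicator_mem_facePoly {l : ℕ} (F : Set (E d)) {p : E d → ℝ} (hp : p ∈ polyFun d l) :
    F.indicator p ∈ facePoly d l F := mem_facePoly.2 ⟨p, hp, rfl⟩

theorem continuousOn_of_mem_facePoly {l : ℕ} {F : Set (E d)} {f : E d → ℝ}
    (hf : f ∈ facePoly d l F) : ContinuousOn f F := by
  obtain ⟨p, hp, rfl⟩ := mem_facePoly.1 hf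
  exact (continuous_of_mem_polyFun hp).continuousOn.congr fun x hx => indicator_of_mem hx p

end FacePoly

namespace Mesh

section Reconstructions

variable {d : ℕ} {Ω : Set (E d)} (M : Mesh Ω) {k : ℕ}

theorem integrableOn_cell (T : M.Cell) {f : E d → ℝ} (hf : ContinuousOn f (closure T.1)) :
    IntegrableOn f T.1 :=
  integrableOn_of_continuousOn_closure (M.isBounded_cell T) (M.isOpen_cell T).measurableSet
    (M.isBounded_cell T).measure_lt_top.ne hf

theorem integrableOn_face (F : M.Face) {f : E d → ℝ} (hf : ContinuousOn f F.1) :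
    IntegrableOn f F.1 μHE[d - 1] :=
  integrableOn_of_continuousOn_closure (M.isCompact_face F).isBounded (M.measurableSet_face F)
    (M.hausdorff_face_lt_top F).ne (by rwa [(M.isCompact_face F).isClosed.closure_eq])

theorem isL2Space_cell (T : M.Cell) (l : ℕ) :
    IsL2Space (volume.restrict T.1) (polyFun d l) :=
  isL2Space_polyFun (M.isOpen_cell T) (M.nonempty_cell T) (M.isBounded_cell T) l

/-- A polynomial which vanishes on a part of positive measure of a face vanishes on this face. -/
theorem eqOn_zero_of_measure_ne_zero (F : M.Face) {l : ℕ} {p : E d → ℝ} (hp : p ∈ polyFun d l)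
    (h : (μHE[d - 1] : Measure (E d)) (F.1 ∩ {x | p x = 0}) ≠ 0) : ∀ x ∈ F.1, p x = 0 := by
  obtain ⟨T, hT⟩ := M.exists_cell_of_face F
  obtain ⟨c, hc⟩ := exists_face_hyp hT
  intro x hx
  by_contra hpx
  exact h (measure_mono_null (inter_subset_inter_left _ hc)
    (ae_ne_zero_on_hyp (norm_nrm hT) hp (hc hx) hpx))

theorem isL2Space_face (F : M.Face) (l : ℕ) :
    IsL2Space ((μHE[d - 1] : Measure (E d)).restrict F.1) (facePoly d l F.1) where
  integrable f hf g hg := M.integrableOn_face F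
    ((continuousOn_of_mem_facePoly hf).mul (continuousOn_of_mem_facePoly hg))
  definite f hf h := by
    have hi : IntegrableOn (fun x => f x ^ 2) F.1 μHE[d - 1] :=
      M.integrableOn_face F ((continuousOn_of_mem_facePoly hf).pow 2)
    rw [integral_eq_zero_iff_of_nonneg (fun x => sq_nonneg _) hi] at h
    obtain ⟨p, hp, rfl⟩ := mem_facePoly.1 hf
    have h0 : ∀ᵐ x ∂((μHE[d - 1] : Measure (E d)).restrict F.1), x ∈ F.1 ∩ {x | p x = 0} := by
      filter_upwards [h, ae_restrict_mem (M.measurableSet_face F)] with x hx hxF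
      refine ⟨hxF, ?_⟩
      simpa [hxF] using hx
    have hpos : (μHE[d - 1] : Measure (E d)) (F.1 ∩ {x | p x = 0}) ≠ 0 := by
      intro hz
      have := M.neBot_ae_face F
      have hz' : ((μHE[d - 1] : Measure (E d)).restrict F.1) (F.1 ∩ {x | p x = 0}) = 0 :=
        nonpos_iff_eq_zero.1 ((Measure.restrict_apply_le _ _).trans hz.le)
      have h1 : ∀ᵐ x ∂((μHE[d - 1] : Measure (E d)).restrict F.1), x ∉ F.1 ∩ {x | p x = 0} :=
        measure_eq_zero_iff_ae_notMem.1 hz'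
      obtain ⟨x, hx, hx'⟩ := (h0.and h1).exists
      exact hx' hx
    have := M.eqOn_zero_of_measure_ne_zero F hp hpos
    ext x
    by_cases hx : x ∈ F.1
    · simp [hx, this x hx]
    · simp [hx]

theorem cellPart_mem (v : M.Dof k) (T : M.Cell) : M.cellPart v T ∈ polyFun d k := (v.1 T).2

theorem facePart_mem (v : M.Dof k) (F : M.Face) : M.facePart v F ∈ facePoly d k F.1 := (v.2 F).2

@[fun_prop]
theorem continuous_cellPart (v : M.Dof k) (T : M.Cell) : Continuous (M.cellPart v T) :=
  continuous_of_mem_polyFun (M.cellPart_mem v T)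

@[fun_prop]
theorem continuousOn_facePart (v : M.Dof k) (F : M.Face) : ContinuousOn (M.facePart v F) F.1 :=
  continuousOn_of_mem_facePoly (M.facePart_mem v F)

/-! #### The projection on a face -/

theorem faceProj_spec (l : ℕ) (F : M.Face) {f : E d → ℝ} (hf : ContinuousOn f F.1) :
    ∀ w ∈ facePoly d l F.1, ∫ x in F.1, (M.faceProj l F f : E d → ℝ) x * w x ∂μHE[d - 1]
      = ∫ x in F.1, f x * w x ∂μHE[d - 1] :=
  Classical.epsilon_spec ((M.isL2Space_face F l).exists_proj fun _ hw =>
    M.integrableOn_face F (hf.mul (continuousOn_of_mem_facePoly hw)))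

theorem continuousOn_faceProj (l : ℕ) (F : M.Face) (f : E d → ℝ) :
    ContinuousOn (M.faceProj l F f : E d → ℝ) F.1 :=
  continuousOn_of_mem_facePoly (M.faceProj l F f).2

theorem faceProj_add (l : ℕ) (F : M.Face) {f g : E d → ℝ} (hf : ContinuousOn f F.1)
    (hg : ContinuousOn g F.1) :
    M.faceProj l F (fun x => f x + g x) = M.faceProj l F f + M.faceProj l F g := by
  refine (M.isL2Space_face F l).eq_of_forall fun w hw => ?_
  have hwc := continuousOn_of_mem_facePoly hw
  have c1 := M.continuousOn_faceProj l F f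
  have c2 := M.continuousOn_faceProj l F g
  rw [M.faceProj_spec l F (f := fun x => f x + g x) (by fun_prop) w hw]
  simp only [Submodule.coe_add, Pi.add_apply, add_mul]
  rw [integral_add (M.integrableOn_face F (by fun_prop)) (M.integrableOn_face F (by fun_prop)),
    integral_add (M.integrableOn_face F (by fun_prop)) (M.integrableOn_face F (by fun_prop)),
    M.faceProj_spec l F hf w hw, M.faceProj_spec l F hg w hw]

theorem faceProj_smul (l : ℕ) (F : M.Face) (c : ℝ) {f : E d → ℝ} (hf : ContinuousOn f F.1) :
    M.faceProj l F (fun x => c * f x) = c • M.faceProj l F f := by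
  refine (M.isL2Space_face F l).eq_of_forall fun w hw => ?_
  rw [M.faceProj_spec l F (f := fun x => c * f x) (by fun_prop) w hw]
  simp only [Submodule.coe_smul, Pi.smul_apply, smul_eq_mul, mul_assoc]
  rw [integral_const_mul, integral_const_mul, M.faceProj_spec l F hf w hw]

theorem faceProj_of_mem (l : ℕ) (F : M.Face) {f : E d → ℝ} (hf : f ∈ facePoly d l F.1) :
    (M.faceProj l F f : E d → ℝ) = f := by
  have : M.faceProj l F f = ⟨f, hf⟩ := (M.isL2Space_face F l).eq_of_forall
    (M.faceProj_spec l F (continuousOn_of_mem_facePoly hf))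
  rw [this]

theorem faceProj_congr (l : ℕ) (F : M.Face) {f g : E d → ℝ} (hf : ContinuousOn f F.1)
    (hfg : EqOn f g F.1) : M.faceProj l F f = M.faceProj l F g := by
  refine (M.isL2Space_face F l).eq_of_forall fun w hw => ?_
  rw [M.faceProj_spec l F hf w hw, M.faceProj_spec l F (hf.congr hfg.symm) w hw]
  exact setIntegral_congr_fun (M.measurableSet_face F) fun x hx => by rw [hfg hx]

theorem integral_faceProj_sq_le (l : ℕ) (F : M.Face) {f : E d → ℝ} (hf : ContinuousOn f F.1) :
    ∫ x in F.1, (M.faceProj l F f : E d → ℝ) x ^ 2 ∂μHE[d - 1]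
      ≤ ∫ x in F.1, f x ^ 2 ∂μHE[d - 1] :=
  (M.isL2Space_face F l).integral_proj_sq_le
    (fun _ hw => M.integrableOn_face F (hf.mul (continuousOn_of_mem_facePoly hw)))
    (M.integrableOn_face F (hf.pow 2)) (M.faceProj_spec l F hf)

/-! #### The projection on a cell -/

theorem cellProj_spec (l : ℕ) (T : M.Cell) {f : E d → ℝ} (hf : ContinuousOn f (closure T.1)) :
    ∀ w ∈ polyFun d l, ∫ x in T.1, (M.cellProj l T f : E d → ℝ) x * w x
      = ∫ x in T.1, f x * w x :=
  Classical.epsilon_spec ((M.isL2Space_cell T l).exists_proj fun _ hw =>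
    M.integrableOn_cell T (hf.mul (continuous_of_mem_polyFun hw).continuousOn))

theorem integral_sub_cellProj_sq_le (l : ℕ) (T : M.Cell) {f q : E d → ℝ}
    (hf : ContinuousOn f (closure T.1)) (hq : q ∈ polyFun d l) :
    ∫ x in T.1, (f x - (M.cellProj l T f : E d → ℝ) x) ^ 2 ≤ ∫ x in T.1, (f x - q x) ^ 2 :=
  (M.isL2Space_cell T l).integral_sub_proj_sq_le (q := ⟨q, hq⟩)
    (fun _ hw => M.integrableOn_cell T (hf.mul (continuous_of_mem_polyFun hw).continuousOn))
    (M.integrableOn_cell T (hf.pow 2)) (M.cellProj_spec l T hf)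

/-! #### The potential reconstruction -/

/-- The right-hand side of the local Neumann problem which defines the potential
reconstruction. -/
noncomputable def potRhs (T : M.Cell) (v : M.Dof k) (w : E d → ℝ) : ℝ :=
  (∫ x in T.1, ⟪gradient (M.cellPart v T) x, gradient w x⟫) +
    ∑ F ∈ M.facesOf T, ∫ x in F.1,
      (M.facePart v F x - M.cellPart v T x) * ⟪gradient w x, M.nrm T F⟫ ∂μHE[d - 1]

@[fun_prop]
theorem continuous_gradient_cellPart (v : M.Dof k) (T : M.Cell) :
    Continuous (gradient (M.cellPart v T)) :=
  continuous_gradient_of_mem_polyFun (M.cellPart_mem v T)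

theorem potRhs_add_right (T : M.Cell) (v : M.Dof k) {l : ℕ} {w w' : E d → ℝ}
    (hw : w ∈ polyFun d l) (hw' : w' ∈ polyFun d l) :
    M.potRhs T v (w + w') = M.potRhs T v w + M.potRhs T v w' := by
  have c1 := continuous_gradient_of_mem_polyFun hw
  have c2 := continuous_gradient_of_mem_polyFun hw'
  simp only [potRhs, gradient_add_of_mem hw hw', inner_add_right, inner_add_left, mul_add]
  rw [integral_add (M.integrableOn_cell T (by fun_prop)) (M.integrableOn_cell T (by fun_prop)),
    add_add_add_comm, ← Finset.sum_add_distrib]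
  congr 1
  refine Finset.sum_congr rfl fun F _ => ?_
  rw [integral_add (M.integrableOn_face F (by fun_prop)) (M.integrableOn_face F (by fun_prop))]

theorem potRhs_smul_right (T : M.Cell) (v : M.Dof k) {l : ℕ} (c : ℝ) {w : E d → ℝ}
    (hw : w ∈ polyFun d l) : M.potRhs T v (c • w) = c * M.potRhs T v w := by
  simp only [potRhs, gradient_smul_of_mem hw, inner_smul_right, inner_smul_left, conj_trivial,
    mul_left_comm _ c]
  rw [integral_const_mul, mul_add, Finset.mul_sum]
  simp_rw [integral_const_mul]

/-- The form `(∇p, ∇q)_T + (∫_T p) (∫_T q)`. The second term makes it positive definite, so that the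
Neumann problem and the condition on the mean value are solved at once. -/
noncomputable def neumannForm (T : M.Cell) (l : ℕ) : polyFun d l →ₗ[ℝ] polyFun d l →ₗ[ℝ] ℝ :=
  LinearMap.mk₂ ℝ (fun p q =>
    (∫ x in T.1, ⟪gradient (p : E d → ℝ) x, gradient (q : E d → ℝ) x⟫) +
      (∫ x in T.1, (p : E d → ℝ) x) * ∫ x in T.1, (q : E d → ℝ) x)
    (fun p p' q => by
      have c1 := continuous_gradient_of_mem_polyFun p.2
      have c2 := continuous_gradient_of_mem_polyFun p'.2
      have c3 := continuous_gradient_of_mem_polyFun q.2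
      have c4 := continuous_of_mem_polyFun p.2
      have c5 := continuous_of_mem_polyFun p'.2
      simp only [Submodule.coe_add, gradient_add_of_mem p.2 p'.2, inner_add_left, Pi.add_apply]
      rw [integral_add (M.integrableOn_cell T (by fun_prop)) (M.integrableOn_cell T (by fun_prop)),
        integral_add (M.integrableOn_cell T (by fun_prop)) (M.integrableOn_cell T (by fun_prop))]
      ring)
    (fun c p q => by
      simp only [Submodule.coe_smul, gradient_smul_of_mem p.2, inner_smul_left, conj_trivial,
        Pi.smul_apply, smul_eq_mul, integral_const_mul]
      ring)
    (fun p q q' => by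
      have c1 := continuous_gradient_of_mem_polyFun q.2
      have c2 := continuous_gradient_of_mem_polyFun q'.2
      have c3 := continuous_gradient_of_mem_polyFun p.2
      have c4 := continuous_of_mem_polyFun q.2
      have c5 := continuous_of_mem_polyFun q'.2
      simp only [Submodule.coe_add, gradient_add_of_mem q.2 q'.2, inner_add_right, Pi.add_apply]
      rw [integral_add (M.integrableOn_cell T (by fun_prop)) (M.integrableOn_cell T (by fun_prop)),
        integral_add (M.integrableOn_cell T (by fun_prop)) (M.integrableOn_cell T (by fun_prop))]
      ring)
    (fun c p q => by
      simp only [Submodule.coe_smul, gradient_smul_of_mem q.2, inner_smul_right,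
        Pi.smul_apply, smul_eq_mul, integral_const_mul]
      ring)

theorem neumannForm_apply (T : M.Cell) (l : ℕ) (p q : polyFun d l) : M.neumannForm T l p q =
    (∫ x in T.1, ⟪gradient (p : E d → ℝ) x, gradient (q : E d → ℝ) x⟫) +
      (∫ x in T.1, (p : E d → ℝ) x) * ∫ x in T.1, (q : E d → ℝ) x := rfl

theorem volume_real_cell_pos (T : M.Cell) : 0 < volume.real T.1 :=
  ENNReal.toReal_pos ((M.isOpen_cell T).measure_pos volume (M.nonempty_cell T)).ne'
    (M.isBounded_cell T).measure_lt_top.ne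

theorem neumannForm_definite (T : M.Cell) (l : ℕ) (p : polyFun d l)
    (h : M.neumannForm T l p p = 0) : p = 0 := by
  have c1 := continuous_gradient_of_mem_polyFun p.2
  rw [neumannForm_apply] at h
  simp only [real_inner_self_eq_norm_sq] at h
  have h1 : 0 ≤ ∫ x in T.1, ‖gradient (p : E d → ℝ) x‖ ^ 2 := integral_nonneg fun x => sq_nonneg _
  have h2 := mul_self_nonneg (∫ x in T.1, (p : E d → ℝ) x)
  have h3 : ∫ x in T.1, ‖gradient (p : E d → ℝ) x‖ ^ 2 = 0 := by linarith
  have h4 : ∫ x in T.1, (p : E d → ℝ) x = 0 := mul_self_eq_zero.1 (by linarith)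
  have h5 := eqOn_zero_of_setIntegral_sq_eq_zero (M.isOpen_cell T)
    (f := fun x => ‖gradient (p : E d → ℝ) x‖) (by fun_prop) (M.integrableOn_cell T (by fun_prop)) h3
  have h6 : ∀ v x, fderiv ℝ (p : E d → ℝ) x v = 0 := by
    intro v x
    have := eq_zero_of_eqOn_isOpen (fderiv_mem_polyFun p.2 v) (M.isOpen_cell T) (M.nonempty_cell T)
      fun y hy => by
        rw [← inner_gradient, norm_eq_zero.1 (h5 y hy), inner_zero_left]
    exact congrFun this x
  have h7 : ∀ x, (p : E d → ℝ) x = (p : E d → ℝ) 0 := fun x =>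
    is_const_of_fderiv_eq_zero (differentiable_of_mem_polyFun p.2)
      (fun x => ContinuousLinearMap.ext fun v => h6 v x) x 0
  have h8 : (p : E d → ℝ) 0 = 0 := by
    simp_rw [h7] at h4
    rw [setIntegral_const, smul_eq_mul] at h4
    exact (mul_eq_zero.1 h4).resolve_left (M.volume_real_cell_pos T).ne'
  exact Subtype.ext (funext fun x => (h7 x).trans h8)

theorem exists_potRec (T : M.Cell) (v : M.Dof k) : ∃ p : polyFun d (k + 1),
    (∀ w ∈ polyFun d (k + 1),
      ∫ x in T.1, ⟪gradient (p : E d → ℝ) x, gradient w x⟫ = M.potRhs T v w) ∧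
    ∫ x in T.1, (p : E d → ℝ) x = ∫ x in T.1, M.cellPart v T x := by
  obtain ⟨p, hp⟩ := bilin_representation (M.neumannForm T (k + 1)) (M.neumannForm_definite T _)
    { toFun := fun w => M.potRhs T v w
        + (∫ x in T.1, M.cellPart v T x) * ∫ x in T.1, (w : E d → ℝ) x
      map_add' := fun w w' => by
        have c4 := continuous_of_mem_polyFun w.2
        have c5 := continuous_of_mem_polyFun w'.2
        rw [Submodule.coe_add, M.potRhs_add_right T v w.2 w'.2]
        simp only [Pi.add_apply]
        rw [integral_add (M.integrableOn_cell T (by fun_prop))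
          (M.integrableOn_cell T (by fun_prop))]
        ring
      map_smul' := fun c w => by
        rw [Submodule.coe_smul, M.potRhs_smul_right T v c w.2]
        simp only [Pi.smul_apply, smul_eq_mul, integral_const_mul, RingHom.id_apply]
        ring }
  have hp' : ∀ w ∈ polyFun d (k + 1),
      (∫ x in T.1, ⟪gradient (p : E d → ℝ) x, gradient w x⟫) +
        (∫ x in T.1, (p : E d → ℝ) x) * (∫ x in T.1, w x)
      = M.potRhs T v w + (∫ x in T.1, M.cellPart v T x) * ∫ x in T.1, w x :=
    fun w hw => hp ⟨w, hw⟩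
  have hmean : ∫ x in T.1, (p : E d → ℝ) x = ∫ x in T.1, M.cellPart v T x := by
    have h1 := hp' _ (const_mem_polyFun (k + 1) 1)
    simp only [gradient_const', inner_zero_right, integral_zero, zero_add, potRhs, inner_zero_left,
      mul_zero, Finset.sum_const_zero, setIntegral_const, smul_eq_mul, mul_one] at h1
    exact mul_right_cancel₀ (M.volume_real_cell_pos T).ne' h1
  refine ⟨p, fun w hw => ?_, hmean⟩
  have := hp' w hw
  rw [hmean] at this
  linarith

/-- The potential reconstruction, which is chosen by `Classical.epsilon`, has its defining
properties. -/
theorem potRec_spec (T : M.Cell) (v : M.Dof k) :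
    (∀ w ∈ polyFun d (k + 1), ∫ x in T.1, ⟪gradient (M.potRec T v : E d → ℝ) x, gradient w x⟫
      = M.potRhs T v w) ∧
    ∫ x in T.1, (M.potRec T v : E d → ℝ) x = ∫ x in T.1, M.cellPart v T x :=
  Classical.epsilon_spec (M.exists_potRec T v)

@[fun_prop]
theorem continuous_potRec (T : M.Cell) (v : M.Dof k) :
    Continuous (M.potRec T v : E d → ℝ) := continuous_of_mem_polyFun (M.potRec T v).2

@[fun_prop]
theorem continuous_gradient_potRec (T : M.Cell) (v : M.Dof k) :
    Continuous (gradient (M.potRec T v : E d → ℝ)) :=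
  continuous_gradient_of_mem_polyFun (M.potRec T v).2

/-- The projected difference `π_F^k (v_F - P_T v)` which the diffusive stabilization penalizes. -/
noncomputable def stabDiff (T : M.Cell) (F : M.Face) (v : M.Dof k) : facePoly d k F.1 :=
  M.faceProj k F fun y => M.facePart v F y - M.potRecFull T v y

/-! #### The advective derivative -/

variable (D : Coeffs Ω)

theorem continuousOn_β_cell (T : M.Cell) : ContinuousOn D.β (closure T.1) := by
  obtain ⟨K, hK⟩ := D.β_lip
  exact hK.continuousOn.mono (M.closure_cell_subset T)

theorem continuousOn_β_face (F : M.Face) : ContinuousOn D.β F.1 := by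
  obtain ⟨T, hT⟩ := M.exists_cell_of_face F
  exact (M.continuousOn_β_cell D T).mono (M.face_subset_closure hT)

/-- The right-hand side of the problem which defines the discrete advective derivative. -/
noncomputable def advRhs (T : M.Cell) (v : M.Dof k) (w : E d → ℝ) : ℝ :=
  -(∫ x in T.1, M.cellPart v T x * ⟪D.β x, gradient w x⟫) +
    ∑ F ∈ M.facesOf T, ∫ x in F.1,
      ⟪D.β x, M.nrm T F⟫ * M.facePart v F x * w x ∂μHE[d - 1]

theorem advRhs_add_right (T : M.Cell) (v : M.Dof k) {l : ℕ} {w w' : E d → ℝ}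
    (hw : w ∈ polyFun d l) (hw' : w' ∈ polyFun d l) :
    M.advRhs D T v (w + w') = M.advRhs D T v w + M.advRhs D T v w' := by
  have c1 := continuous_gradient_of_mem_polyFun hw
  have c2 := continuous_gradient_of_mem_polyFun hw'
  have c3 := continuous_of_mem_polyFun hw
  have c4 := continuous_of_mem_polyFun hw'
  have c5 := M.continuousOn_β_cell D T
  simp only [advRhs, gradient_add_of_mem hw hw', inner_add_right, mul_add, Pi.add_apply]
  rw [integral_add (M.integrableOn_cell T (by fun_prop)) (M.integrableOn_cell T (by fun_prop)),
    neg_add, add_add_add_comm, ← Finset.sum_add_distrib]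
  congr 1
  refine Finset.sum_congr rfl fun F _ => ?_
  have c6 := M.continuousOn_β_face D F
  rw [integral_add (M.integrableOn_face F (by fun_prop)) (M.integrableOn_face F (by fun_prop))]

theorem advRhs_smul_right (T : M.Cell) (v : M.Dof k) {l : ℕ} (c : ℝ) {w : E d → ℝ}
    (hw : w ∈ polyFun d l) : M.advRhs D T v (c • w) = c * M.advRhs D T v w := by
  simp only [advRhs, gradient_smul_of_mem hw, inner_smul_right, Pi.smul_apply, smul_eq_mul,
    mul_left_comm _ c]
  rw [integral_const_mul, mul_add, Finset.mul_sum, mul_neg]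
  simp_rw [integral_const_mul]

/-- The discrete advective derivative, which is chosen by `Classical.epsilon`, has its defining
property. -/
theorem advRec_spec (T : M.Cell) (v : M.Dof k) : ∀ w ∈ polyFun d k,
    ∫ x in T.1, (M.advRec D.β T v : E d → ℝ) x * w x = M.advRhs D T v w := by
  refine Classical.epsilon_spec (p := fun p : polyFun d k => ∀ w ∈ polyFun d k,
    ∫ x in T.1, (p : E d → ℝ) x * w x = M.advRhs D T v w) ?_
  obtain ⟨p, hp⟩ := (M.isL2Space_cell T k).exists_repr
    { toFun := fun w => M.advRhs D T v w
      map_add' := fun w w' => M.advRhs_add_right D T v w.2 w'.2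
      map_smul' := fun c w => M.advRhs_smul_right D T v c w.2 }
  exact ⟨p, fun w hw => hp ⟨w, hw⟩⟩

end Reconstructions

end Mesh

/-! ### Inverse, trace and Poincaré inequalities on cells -/

namespace Mesh

/-- The local estimates on polynomials of degree at most `l`, all with the same constant `C`: an
inverse inequality, a Poincaré inequality, and trace inequalities for functions and gradients. The
number of faces of a cell is also at most `C`. -/
structure LocalBounds {d : ℕ} {Ω : Set (E d)} (M : Mesh Ω) (l : ℕ) (C : ℝ) : Prop where
  one_le : 1 ≤ C
  card_le (T : M.Cell) : ((M.facesOf T).card : ℝ) ≤ C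
  inverse (T : M.Cell) {q : E d → ℝ} (hq : q ∈ polyFun d l) :
    M.hT T ^ 2 * ∫ x in T.1, ‖gradient q x‖ ^ 2 ≤ C * ∫ x in T.1, q x ^ 2
  poincare (T : M.Cell) {q : E d → ℝ} (hq : q ∈ polyFun d l) :
    ∃ m : ℝ, ∫ x in T.1, (q x - m) ^ 2 ≤ C * M.hT T ^ 2 * ∫ x in T.1, ‖gradient q x‖ ^ 2
  trace {T : M.Cell} {F : M.Face} (hF : F ∈ M.facesOf T) {q : E d → ℝ} (hq : q ∈ polyFun d l) :
    M.hT T * ∫ x in F.1, q x ^ 2 ∂μHE[d - 1] ≤ C * ∫ x in T.1, q x ^ 2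
  trace_hF {T : M.Cell} {F : M.Face} (hF : F ∈ M.facesOf T) {q : E d → ℝ} (hq : q ∈ polyFun d l) :
    M.hT T ^ 2 * ∫ x in F.1, q x ^ 2 ∂μHE[d - 1] ≤ C * M.hF F * ∫ x in T.1, q x ^ 2
  trace_gradient {T : M.Cell} {F : M.Face} (hF : F ∈ M.facesOf T) {q : E d → ℝ}
    (hq : q ∈ polyFun d l) :
    M.hT T * ∫ x in F.1, ‖gradient q x‖ ^ 2 ∂μHE[d - 1] ≤ C * ∫ x in T.1, ‖gradient q x‖ ^ 2

/-- The inverse inequality on a cell, which contains a ball of comparable size around some `a`. The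
third bound is the first one for the partial derivatives, and it yields the fourth by the mean
value inequality. -/
theorem exists_pointwise_bound (d l : ℕ) (hd : 1 ≤ d) {ϱ : ℝ} (hϱ : 0 < ϱ) :
    ∃ C : ℝ, 0 ≤ C ∧ ∀ (Ω : Set (E d)) (M : Mesh Ω), M.IsAdmissible ϱ → ∀ T : M.Cell,
      ∃ a, ∀ q ∈ polyFun d l, ∀ x ∈ closure T.1,
        q x ^ 2 ≤ C * (M.hT T ^ d)⁻¹ * (∫ x in T.1, q x ^ 2) ∧
        M.hT T ^ 2 * ‖gradient q x‖ ^ 2 ≤ C * (M.hT T ^ d)⁻¹ * (∫ x in T.1, q x ^ 2) ∧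
        ‖gradient q x‖ ^ 2 ≤ C * (M.hT T ^ d)⁻¹ * (∫ x in T.1, ‖gradient q x‖ ^ 2) ∧
        (q x - q a) ^ 2 ≤
          M.hT T ^ 2 * (C * (M.hT T ^ d)⁻¹ * ∫ x in T.1, ‖gradient q x‖ ^ 2) := by
  obtain ⟨C, hC, H⟩ := exists_inverse_bound d l (ρ := ϱ ^ 2 / 2) (by positivity)
  refine ⟨C, hC, fun Ω M hM T => ?_⟩
  obtain ⟨a, ha, hcl⟩ := M.exists_ball_subset_cell hd hϱ hM T
  have hT := M.hT_pos hd T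
  have hmono : ∀ f : E d → ℝ, Continuous f → (∀ x, 0 ≤ f x) →
      ∫ x in Metric.ball a (ϱ ^ 2 / 2 * M.hT T), f x ≤ ∫ x in T.1, f x := fun f hf h0 =>
    setIntegral_mono_set (M.integrableOn_cell T hf.continuousOn)
      (Eventually.of_forall h0) (LE.le.eventuallyLE ha)
  have hgrad : ∀ q ∈ polyFun d l, ∀ x ∈ Metric.closedBall a (M.hT T),
      ‖gradient q x‖ ^ 2 ≤ C * (M.hT T ^ d)⁻¹ * (∫ x in T.1, ‖gradient q x‖ ^ 2) := by
    intro q hq x hx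
    have hj : ∀ j, (fun x => fderiv ℝ q x (EuclideanSpace.single j 1)) ∈ polyFun d l := fun j =>
      polyFun_mono (Nat.sub_le l 1) (fderiv_mem_polyFun hq _)
    simp only [norm_gradient_sq]
    have hjc := fun j => continuous_of_mem_polyFun (hj j)
    rw [integral_finsetSum _ fun j _ => M.integrableOn_cell T
      (f := fun x => fderiv ℝ q x (EuclideanSpace.single j 1) ^ 2) (by fun_prop), Finset.mul_sum]
    refine Finset.sum_le_sum fun j _ => ((H a _ hT _ (hj j) x hx).1).trans ?_
    exact mul_le_mul_of_nonneg_left (hmono (fun x => fderiv ℝ q x (EuclideanSpace.single j 1) ^ 2)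
      ((hjc j).pow 2) fun x => sq_nonneg _) (by positivity)
  refine ⟨a, fun q hq x hx => ?_⟩
  have hx' := hcl hx
  have hq2 := hmono (fun x => q x ^ 2) ((continuous_of_mem_polyFun hq).pow 2) fun x => sq_nonneg _
  obtain ⟨h1, h2⟩ := H a _ hT q hq x hx'
  refine ⟨h1.trans (by gcongr), h2.trans (by gcongr), hgrad q hq x hx', ?_⟩
  set B := C * (M.hT T ^ d)⁻¹ * ∫ x in T.1, ‖gradient q x‖ ^ 2 with hB
  have hB0 : 0 ≤ B := by
    have : 0 ≤ ∫ x in T.1, ‖gradient q x‖ ^ 2 := integral_nonneg fun x => sq_nonneg _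
    positivity
  have hmv : ‖q x - q a‖ ≤ √B * ‖x - a‖ :=
    (convex_closedBall a (M.hT T)).norm_image_sub_le_of_norm_fderiv_le
      (fun y _ => differentiable_of_mem_polyFun hq y)
      (fun y hy => by
        have : ‖fderiv ℝ q y‖ = ‖gradient q y‖ := by
          rw [gradient, LinearIsometryEquiv.norm_map]
        rw [this]
        exact Real.le_sqrt_of_sq_le (hgrad q hq y hy))
      (Metric.mem_closedBall_self hT.le) hx'
  have hxa : ‖x - a‖ ≤ M.hT T := by rw [← dist_eq_norm]; exact hx'
  calc (q x - q a) ^ 2 = ‖q x - q a‖ ^ 2 := by rw [Real.norm_eq_abs, sq_abs]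
    _ ≤ (√B * M.hT T) ^ 2 := by gcongr; exact hmv.trans (by gcongr)
    _ = M.hT T ^ 2 * B := by rw [mul_pow, Real.sq_sqrt hB0, mul_comm]

/-- All the local estimates follow from the pointwise bounds by integration over the cell or a
face. -/
theorem exists_localBounds (d l : ℕ) (hd : 1 ≤ d) {ϱ : ℝ} (hϱ : 0 < ϱ) :
    ∃ C : ℝ, ∀ (Ω : Set (E d)) (M : Mesh Ω), M.IsAdmissible ϱ → M.LocalBounds l C := by
  obtain ⟨C₁, hC₁, H⟩ := exists_pointwise_bound d l hd hϱ
  obtain ⟨C₂, hC₂, HF⟩ := exists_face_measure_bound d hd hϱ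
  set N : ℝ := (d + 1) * ((ϱ ^ 2 / 2) ^ d)⁻¹ with hN
  set V : ℝ := volume.real (Metric.ball (0 : E d) 1) with hV
  have hV0 : 0 ≤ V := measureReal_nonneg
  have hN0 : 0 ≤ N := by positivity
  have e1 : (1 : ℝ) ≤ 1 + N + C₁ * V + C₂ * C₁ := by nlinarith [mul_nonneg hC₁ hV0, mul_nonneg hC₂ hC₁]
  have e2 : N ≤ 1 + N + C₁ * V + C₂ * C₁ := by nlinarith [mul_nonneg hC₁ hV0, mul_nonneg hC₂ hC₁]
  have e3 : C₁ * V ≤ 1 + N + C₁ * V + C₂ * C₁ := by nlinarith [mul_nonneg hC₁ hV0, mul_nonneg hC₂ hC₁]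
  have e4 : C₂ * C₁ ≤ 1 + N + C₁ * V + C₂ * C₁ := by nlinarith [mul_nonneg hC₁ hV0, mul_nonneg hC₂ hC₁]
  set C := 1 + N + C₁ * V + C₂ * C₁
  refine ⟨C, fun Ω M hM => ?_⟩
  have hvol : ∀ T : M.Cell, volume.real T.1 * (M.hT T ^ d)⁻¹ ≤ V := by
    intro T
    have hT := M.hT_pos hd T
    obtain ⟨a, -, hcl⟩ := M.exists_ball_subset_cell hd hϱ hM T
    rw [mul_inv_le_iff₀ (by positivity)]
    calc volume.real T.1 ≤ volume.real (Metric.closedBall a (M.hT T)) :=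
          measureReal_mono (subset_closure.trans hcl) measure_closedBall_lt_top.ne
      _ = V * M.hT T ^ d := by
          rw [measureReal_def, Measure.addHaar_closedBall _ _ hT.le, ENNReal.toReal_mul,
            ENNReal.toReal_ofReal (by positivity), finrank_euclideanSpace_fin, mul_comm]
          rfl
  have hcell : ∀ (T : M.Cell) (f : E d → ℝ) (c : ℝ), Continuous f →
      (∀ x ∈ closure T.1, f x ≤ c) → ∫ x in T.1, f x ≤ volume.real T.1 * c := by
    intro T f c hf h
    have := setIntegral_mono_on (M.integrableOn_cell T hf.continuousOn)
      (M.integrableOn_cell T continuousOn_const) (M.isOpen_cell T).measurableSet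
      fun x hx => h x (subset_closure hx)
    simpa [setIntegral_const] using this
  have hface : ∀ (T : M.Cell) (F : M.Face) (f : E d → ℝ) (c : ℝ), F ∈ M.facesOf T →
      Continuous f → (∀ x ∈ closure T.1, f x ≤ c) →
      ∫ x in F.1, f x ∂μHE[d - 1] ≤ (μHE[d - 1] : Measure (E d)).real F.1 * c := by
    intro T F f c hF hf h
    have := setIntegral_mono_on (M.integrableOn_face F hf.continuousOn)
      (M.integrableOn_face F continuousOn_const) (M.measurableSet_face F)
      fun x hx => h x (M.face_subset_closure hF hx)
    simpa [setIntegral_const] using this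
  refine ⟨e1, fun T => (M.card_facesOf_le hd hϱ hM T).trans e2, ?_, ?_, ?_, ?_, ?_⟩
  · intro T q hq
    have hT := M.hT_pos hd T
    obtain ⟨a, ha⟩ := H Ω M hM T
    have c1 := continuous_gradient_of_mem_polyFun hq
    have h0 : 0 ≤ ∫ x in T.1, q x ^ 2 := integral_nonneg fun x => sq_nonneg _
    have := hcell T (fun x => M.hT T ^ 2 * ‖gradient q x‖ ^ 2) _ (by fun_prop)
      fun x hx => (ha q hq x hx).2.1
    rw [integral_const_mul] at this
    calc _ ≤ _ := this
      _ = C₁ * (volume.real T.1 * (M.hT T ^ d)⁻¹) * ∫ x in T.1, q x ^ 2 := by ring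
      _ ≤ C₁ * V * ∫ x in T.1, q x ^ 2 := by gcongr; exact hvol T
      _ ≤ _ := by gcongr
  · intro T q hq
    have hT := M.hT_pos hd T
    obtain ⟨a, ha⟩ := H Ω M hM T
    have c1 := continuous_of_mem_polyFun hq
    have h0 : 0 ≤ ∫ x in T.1, ‖gradient q x‖ ^ 2 := integral_nonneg fun x => sq_nonneg _
    refine ⟨q a, ?_⟩
    have := hcell T (fun x => (q x - q a) ^ 2) _ (by fun_prop)
      fun x hx => (ha q hq x hx).2.2.2
    calc _ ≤ _ := this
      _ = C₁ * (volume.real T.1 * (M.hT T ^ d)⁻¹) * M.hT T ^ 2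
          * ∫ x in T.1, ‖gradient q x‖ ^ 2 := by ring
      _ ≤ C₁ * V * M.hT T ^ 2 * ∫ x in T.1, ‖gradient q x‖ ^ 2 := by gcongr; exact hvol T
      _ ≤ _ := by gcongr
  · intro T F hF q hq
    have hT := M.hT_pos hd T
    obtain ⟨a, ha⟩ := H Ω M hM T
    have c1 := continuous_of_mem_polyFun hq
    have h0 : 0 ≤ ∫ x in T.1, q x ^ 2 := integral_nonneg fun x => sq_nonneg _
    have := hface T F (fun x => q x ^ 2) _ hF (by fun_prop) fun x hx => (ha q hq x hx).1
    calc _ ≤ M.hT T * _ := mul_le_mul_of_nonneg_left this hT.le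
      _ = ((μHE[d - 1] : Measure (E d)).real F.1 * (M.hT T ^ d)⁻¹ * M.hT T) * C₁
          * ∫ x in T.1, q x ^ 2 := by ring
      _ ≤ C₂ * C₁ * ∫ x in T.1, q x ^ 2 := by gcongr; exact (HF Ω M hM T F hF).1
      _ ≤ _ := by gcongr
  · intro T F hF q hq
    have hT := M.hT_pos hd T
    have hF0 := M.hF_pos hd F
    obtain ⟨a, ha⟩ := H Ω M hM T
    have c1 := continuous_of_mem_polyFun hq
    have h0 : 0 ≤ ∫ x in T.1, q x ^ 2 := integral_nonneg fun x => sq_nonneg _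
    have := hface T F (fun x => q x ^ 2) _ hF (by fun_prop) fun x hx => (ha q hq x hx).1
    calc _ ≤ M.hT T ^ 2 * _ := mul_le_mul_of_nonneg_left this (by positivity)
      _ = ((μHE[d - 1] : Measure (E d)).real F.1 * (M.hT T ^ d)⁻¹ * M.hT T ^ 2) * C₁
          * ∫ x in T.1, q x ^ 2 := by ring
      _ ≤ C₂ * M.hF F * C₁ * ∫ x in T.1, q x ^ 2 :=
          mul_le_mul_of_nonneg_right (mul_le_mul_of_nonneg_right (HF Ω M hM T F hF).2 hC₁) h0
      _ = C₂ * C₁ * M.hF F * ∫ x in T.1, q x ^ 2 := by ring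
      _ ≤ _ := by gcongr
  · intro T F hF q hq
    have hT := M.hT_pos hd T
    obtain ⟨a, ha⟩ := H Ω M hM T
    have c1 := continuous_gradient_of_mem_polyFun hq
    have h0 : 0 ≤ ∫ x in T.1, ‖gradient q x‖ ^ 2 := integral_nonneg fun x => sq_nonneg _
    have := hface T F (fun x => ‖gradient q x‖ ^ 2) _ hF (by fun_prop)
      fun x hx => (ha q hq x hx).2.2.1
    calc _ ≤ M.hT T * _ := mul_le_mul_of_nonneg_left this hT.le
      _ = ((μHE[d - 1] : Measure (E d)).real F.1 * (M.hT T ^ d)⁻¹ * M.hT T) * C₁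
          * ∫ x in T.1, ‖gradient q x‖ ^ 2 := by ring
      _ ≤ C₂ * C₁ * ∫ x in T.1, ‖gradient q x‖ ^ 2 := by gcongr; exact (HF Ω M hM T F hF).1
      _ ≤ _ := by gcongr

end Mesh

/-! ### Equivalence of the diffusive energies -/

/-- Integration of a weighted Young inequality. Nothing is required of `u`: if it is not
integrable, then its integral is zero by convention. -/
theorem abs_setIntegral_le_of_young_ae {d : ℕ} {m : Measure (E d)} {s : Set (E d)}
    {u f g : E d → ℝ} {a b : ℝ} (hf : IntegrableOn f s m)
    (hg : IntegrableOn g s m) (h : ∀ᵐ x ∂(m.restrict s), |u x| ≤ a * f x + b * g x) :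
    |∫ x in s, u x ∂m| ≤ a * (∫ x in s, f x ∂m) + b * ∫ x in s, g x ∂m := by
  rw [← integral_const_mul, ← integral_const_mul,
    ← integral_add (hf.const_mul a) (hg.const_mul b)]
  exact (norm_integral_le_integral_norm _).trans
    (integral_mono_of_nonneg (Eventually.of_forall fun x => norm_nonneg (u x))
      ((hf.const_mul a).add (hg.const_mul b)) h)

theorem abs_setIntegral_le_of_young {d : ℕ} {m : Measure (E d)} {s : Set (E d)}
    (hs : MeasurableSet s) {u f g : E d → ℝ} {a b : ℝ} (hf : IntegrableOn f s m)
    (hg : IntegrableOn g s m) (h : ∀ x ∈ s, |u x| ≤ a * f x + b * g x) :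
    |∫ x in s, u x ∂m| ≤ a * (∫ x in s, f x ∂m) + b * ∫ x in s, g x ∂m :=
  abs_setIntegral_le_of_young_ae hf hg ((ae_restrict_mem hs).mono h)

theorem abs_mul_le_young {t : ℝ} (ht : 0 < t) (x y : ℝ) :
    |x * y| ≤ t * x ^ 2 + (4 * t)⁻¹ * y ^ 2 := by
  have h : t * x ^ 2 + (4 * t)⁻¹ * y ^ 2 - |x| * |y| = t * (|x| - (2 * t)⁻¹ * |y|) ^ 2 := by
    rw [← sq_abs x, ← sq_abs y]
    field_simp
    ring
  rw [abs_mul]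
  linarith [mul_nonneg ht.le (sq_nonneg (|x| - (2 * t)⁻¹ * |y|))]

namespace Mesh

variable {d : ℕ} {Ω : Set (E d)} {M : Mesh Ω} {k : ℕ}

variable (M) in
/-- The squared norm of the difference `v_F - v_T` in `L²(F)`. -/
noncomputable def jumpSq (T : M.Cell) (F : M.Face) (v : M.Dof k) : ℝ :=
  ∫ x in F.1, (M.facePart v F x - M.cellPart v T x) ^ 2 ∂μHE[d - 1]

variable (M) in
/-- The diffusive energy of a cell in terms of the reconstruction, for a unit diffusion. -/
noncomputable def potEnergy (T : M.Cell) (v : M.Dof k) : ℝ :=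
  (∫ x in T.1, ‖gradient (M.potRec T v : E d → ℝ) x‖ ^ 2) +
    ∑ F ∈ M.facesOf T, (M.hF F)⁻¹ * ∫ x in F.1, (M.stabDiff T F v : E d → ℝ) x ^ 2 ∂μHE[d - 1]

variable (M) in
/-- The discrete `H¹`-energy of a cell in terms of the degrees of freedom. -/
noncomputable def dofEnergy (T : M.Cell) (v : M.Dof k) : ℝ :=
  (∫ x in T.1, ‖gradient (M.cellPart v T) x‖ ^ 2) +
    ∑ F ∈ M.facesOf T, (M.hF F)⁻¹ * M.jumpSq T F v

theorem jumpSq_nonneg (T : M.Cell) (F : M.Face) (v : M.Dof k) : 0 ≤ M.jumpSq T F v :=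
  integral_nonneg fun _ => sq_nonneg _

theorem integral_norm_gradient_sq_nonneg (s : Set (E d)) (q : E d → ℝ) :
    0 ≤ ∫ x in s, ‖gradient q x‖ ^ 2 := integral_nonneg fun _ => sq_nonneg _

/-- Since `v_F - v_T` is a polynomial on the face, only the reconstruction is projected. -/
theorem stabDiff_eqOn (T : M.Cell) (F : M.Face) (v : M.Dof k) : ∀ x ∈ F.1,
    (M.stabDiff T F v : E d → ℝ) x = (M.facePart v F x - M.cellPart v T x) -
      (M.faceProj k F ((M.potRec T v : E d → ℝ) - M.cellProj k T (M.potRec T v)) : E d → ℝ) x := by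
  intro x hx
  have c1 : Continuous (M.cellProj k T (M.potRec T v) : E d → ℝ) :=
    continuous_of_mem_polyFun (M.cellProj k T (M.potRec T v)).2
  set r : E d → ℝ := (M.potRec T v : E d → ℝ) - M.cellProj k T (M.potRec T v) with hr
  have hrc : Continuous r := (M.continuous_potRec T v).sub c1
  have h1 : M.stabDiff T F v = M.faceProj k F (fun y =>
      (M.facePart v F y - M.cellPart v T y) + (-1) * r y) := by
    unfold stabDiff
    congr 1
    ext y
    simp only [potRecFull, hr, Pi.sub_apply]
    ring
  have h2 : M.faceProj k F (fun y => M.facePart v F y - M.cellPart v T y)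
      = M.faceProj k F (M.facePart v F - F.1.indicator (M.cellPart v T)) :=
    M.faceProj_congr k F (by fun_prop) fun y hy => by simp [hy]
  rw [h1, M.faceProj_add k F (by fun_prop) (by fun_prop), M.faceProj_smul k F _ (by fun_prop), h2,
    Submodule.coe_add, Pi.add_apply, M.faceProj_of_mem k F
      (Submodule.sub_mem _ (M.facePart_mem v F) (indicator_mem_facePoly F.1 (M.cellPart_mem v T)))]
  simp [hx]
  ring

namespace LocalBounds

variable {C : ℝ}

theorem mono {l m : ℕ} (H : M.LocalBounds m C) (h : l ≤ m) : M.LocalBounds l C where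
  one_le := H.one_le
  card_le := H.card_le
  inverse T _ hq := H.inverse T (polyFun_mono h hq)
  poincare T _ hq := H.poincare T (polyFun_mono h hq)
  trace hF _ hq := H.trace hF (polyFun_mono h hq)
  trace_hF hF _ hq := H.trace_hF hF (polyFun_mono h hq)
  trace_gradient hF _ hq := H.trace_gradient hF (polyFun_mono h hq)

/-- The approximation property of the projection on a cell, in the norm of a face: the trace
inequality reduces it to the Poincaré inequality. -/
theorem approx (H : M.LocalBounds (k + 1) C) (hd : 1 ≤ d) {T : M.Cell} {F : M.Face}
    (hF : F ∈ M.facesOf T) {q : E d → ℝ} (hq : q ∈ polyFun d (k + 1)) :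
    (M.hF F)⁻¹ * ∫ x in F.1, (q x - (M.cellProj k T q : E d → ℝ) x) ^ 2 ∂μHE[d - 1]
      ≤ C ^ 2 * ∫ x in T.1, ‖gradient q x‖ ^ 2 := by
  have hT := M.hT_pos hd T
  have hF0 := M.hF_pos hd F
  have hC := H.one_le
  obtain ⟨m, hm⟩ := H.poincare T hq
  have h1 := M.integral_sub_cellProj_sq_le k T (continuous_of_mem_polyFun hq).continuousOn
    (const_mem_polyFun k m)
  have h2 := H.trace_hF hF (Submodule.sub_mem _ hq
    (polyFun_mono (Nat.le_succ k) (M.cellProj k T q).2))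
  simp only [Pi.sub_apply] at h2
  rw [inv_mul_le_iff₀ hF0]
  refine le_of_mul_le_mul_left (h2.trans ?_) (pow_pos hT 2)
  calc _ ≤ C * M.hF F * (C * M.hT T ^ 2 * ∫ x in T.1, ‖gradient q x‖ ^ 2) := by
        gcongr; exact h1.trans hm
    _ = _ := by ring

/-- The boundary terms of the Neumann problem for the reconstruction, by Young's inequality and the
trace inequality for gradients. -/
theorem flux_le (H : M.LocalBounds (k + 1) C) (hd : 1 ≤ d) (T : M.Cell) (v : M.Dof k)
    {q : E d → ℝ} (hq : q ∈ polyFun d (k + 1)) :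
    |∑ F ∈ M.facesOf T, ∫ x in F.1,
      (M.facePart v F x - M.cellPart v T x) * ⟪gradient q x, M.nrm T F⟫ ∂μHE[d - 1]|
    ≤ C ^ 2 * (∑ F ∈ M.facesOf T, (M.hF F)⁻¹ * M.jumpSq T F v) +
      1 / 4 * ∫ x in T.1, ‖gradient q x‖ ^ 2 := by
  have hC := H.one_le
  have hC0 : 0 < C := by linarith
  have c1 := continuous_gradient_of_mem_polyFun hq
  set I := ∫ x in T.1, ‖gradient q x‖ ^ 2
  have hI : 0 ≤ I := integral_norm_gradient_sq_nonneg _ _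
  have hface : ∀ F ∈ M.facesOf T, |∫ x in F.1,
      (M.facePart v F x - M.cellPart v T x) * ⟪gradient q x, M.nrm T F⟫ ∂μHE[d - 1]|
      ≤ C ^ 2 * ((M.hF F)⁻¹ * M.jumpSq T F v) + (4 * C)⁻¹ * I := by
    intro F hF
    have hF0 := M.hF_pos hd F
    have ht : 0 < C ^ 2 * (M.hF F)⁻¹ := by positivity
    have h0 : 0 ≤ ∫ x in F.1, ‖gradient q x‖ ^ 2 ∂μHE[d - 1] :=
      integral_nonneg fun x => sq_nonneg _
    have h1 := abs_setIntegral_le_of_young (m := μHE[d - 1]) (M.measurableSet_face F)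
      (u := fun x => (M.facePart v F x - M.cellPart v T x) * ⟪gradient q x, M.nrm T F⟫)
      (f := fun x => (M.facePart v F x - M.cellPart v T x) ^ 2)
      (g := fun x => ‖gradient q x‖ ^ 2) (a := C ^ 2 * (M.hF F)⁻¹)
      (b := (4 * (C ^ 2 * (M.hF F)⁻¹))⁻¹)
      (M.integrableOn_face F (by fun_prop)) (M.integrableOn_face F (by fun_prop))
      fun x _ => (abs_mul_le_young ht _ _).trans (by
        refine add_le_add_right (mul_le_mul_of_nonneg_left ?_ (by positivity)) _
        rw [sq_le_sq, abs_norm]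
        simpa [norm_nrm hF] using abs_real_inner_le_norm (gradient q x) (M.nrm T F))
    have h2 : M.hF F * ∫ x in F.1, ‖gradient q x‖ ^ 2 ∂μHE[d - 1] ≤ C * I :=
      (mul_le_mul_of_nonneg_right (hF_le_hT hF) h0).trans (H.trace_gradient hF hq)
    refine h1.trans ?_
    have h3 : (4 * (C ^ 2 * (M.hF F)⁻¹))⁻¹ * ∫ x in F.1, ‖gradient q x‖ ^ 2 ∂μHE[d - 1]
        = (4 * C ^ 2)⁻¹ * (M.hF F * ∫ x in F.1, ‖gradient q x‖ ^ 2 ∂μHE[d - 1]) := by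
      field_simp
    rw [h3, mul_assoc]
    gcongr ?_ + ?_
    · rfl
    · calc _ ≤ (4 * C ^ 2)⁻¹ * (C * I) := by gcongr
        _ = _ := by field_simp
  refine (Finset.abs_sum_le_sum_abs _ _).trans ((Finset.sum_le_sum hface).trans ?_)
  rw [Finset.sum_add_distrib, ← Finset.mul_sum, Finset.sum_const, nsmul_eq_mul]
  refine add_le_add_right ?_ _
  calc ((M.facesOf T).card : ℝ) * ((4 * C)⁻¹ * I) ≤ C * ((4 * C)⁻¹ * I) := by
        gcongr; exact H.card_le T
    _ = 1 / 4 * I := by field_simp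

theorem integral_sq_le_of_sub {m : Measure (E d)} {s : Set (E d)} (hs : MeasurableSet s)
    {f g h : E d → ℝ} (hg : IntegrableOn (fun x => g x ^ 2) s m)
    (hh : IntegrableOn (fun x => h x ^ 2) s m) (H : ∀ x ∈ s, f x = g x + h x ∨ f x = g x - h x) :
    ∫ x in s, f x ^ 2 ∂m ≤ 2 * (∫ x in s, g x ^ 2 ∂m) + 2 * ∫ x in s, h x ^ 2 ∂m := by
  refine (le_abs_self _).trans (abs_setIntegral_le_of_young hs hg hh fun x hx => ?_)
  rw [abs_of_nonneg (sq_nonneg _)]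
  rcases H x hx with h' | h' <;> rw [h'] <;> nlinarith [sq_nonneg (g x - h x), sq_nonneg (g x + h x)]

/-- The discrete `H¹`-energy and the energy of the reconstruction are equivalent. The Neumann problem
compares the gradients up to the jumps, and the jumps differ from the stabilized differences by a
term which the approximation property of the projections controls. -/
theorem energy_equiv (H : M.LocalBounds (k + 1) C) (hd : 1 ≤ d) (T : M.Cell) (v : M.Dof k) :
    M.dofEnergy T v ≤ 8 * C ^ 5 * M.potEnergy T v ∧
      M.potEnergy T v ≤ 8 * C ^ 5 * M.dofEnergy T v := by
  have hC := H.one_le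
  have hC0 : 0 < C := by linarith
  set p : E d → ℝ := (M.potRec T v : E d → ℝ) with hp
  have hpm : p ∈ polyFun d (k + 1) := (M.potRec T v).2
  have c1 : Continuous (M.cellProj k T p : E d → ℝ) :=
    continuous_of_mem_polyFun (M.cellProj k T p).2
  have c2 : Continuous p := continuous_of_mem_polyFun hpm
  have c3 := continuous_gradient_of_mem_polyFun hpm
  have hvm : M.cellPart v T ∈ polyFun d (k + 1) :=
    polyFun_mono (Nat.le_succ k) (M.cellPart_mem v T)
  -- `P`, `I`: the bulk parts of the two energies; `J`, `S`: their face parts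
  set P := ∫ x in T.1, ‖gradient p x‖ ^ 2 with hP
  set I := ∫ x in T.1, ‖gradient (M.cellPart v T) x‖ ^ 2 with hI
  set J := ∑ F ∈ M.facesOf T, (M.hF F)⁻¹ * M.jumpSq T F v with hJ
  set S := ∑ F ∈ M.facesOf T, (M.hF F)⁻¹ *
    ∫ x in F.1, (M.stabDiff T F v : E d → ℝ) x ^ 2 ∂μHE[d - 1] with hS
  have hP0 : 0 ≤ P := integral_norm_gradient_sq_nonneg _ _
  have hI0 : 0 ≤ I := integral_norm_gradient_sq_nonneg _ _
  have hJ0 : 0 ≤ J := Finset.sum_nonneg fun F _ =>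
    mul_nonneg (inv_nonneg.2 (M.hF_pos hd F).le) (jumpSq_nonneg T F v)
  have hS0 : 0 ≤ S := Finset.sum_nonneg fun F _ =>
    mul_nonneg (inv_nonneg.2 (M.hF_pos hd F).le) (integral_nonneg fun _ => sq_nonneg _)
  have hpot : M.potEnergy T v = P + S := rfl
  have hdof : M.dofEnergy T v = I + J := rfl
  have hcross : |∫ x in T.1, ⟪gradient p x, gradient (M.cellPart v T) x⟫| ≤ P + 1 / 4 * I := by
    have := abs_setIntegral_le_of_young (m := volume) (M.isOpen_cell T).measurableSet
      (u := fun x => ⟪gradient p x, gradient (M.cellPart v T) x⟫)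
      (f := fun x => ‖gradient p x‖ ^ 2) (g := fun x => ‖gradient (M.cellPart v T) x‖ ^ 2)
      (a := 1) (b := 1 / 4) (M.integrableOn_cell T (by fun_prop))
      (M.integrableOn_cell T (by fun_prop)) fun x _ => by
        have h1 := abs_real_inner_le_norm (gradient p x) (gradient (M.cellPart v T) x)
        have h2 := abs_mul_le_young one_pos ‖gradient p x‖ ‖gradient (M.cellPart v T) x‖
        rw [abs_mul, abs_norm, abs_norm] at h2
        linarith
    linarith
  have hcross' : |∫ x in T.1, ⟪gradient (M.cellPart v T) x, gradient p x⟫| ≤ I + 1 / 4 * P := by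
    have := abs_setIntegral_le_of_young (m := volume) (M.isOpen_cell T).measurableSet
      (u := fun x => ⟪gradient (M.cellPart v T) x, gradient p x⟫)
      (f := fun x => ‖gradient (M.cellPart v T) x‖ ^ 2) (g := fun x => ‖gradient p x‖ ^ 2)
      (a := 1) (b := 1 / 4) (M.integrableOn_cell T (by fun_prop))
      (M.integrableOn_cell T (by fun_prop)) fun x _ => by
        have h1 := abs_real_inner_le_norm (gradient (M.cellPart v T) x) (gradient p x)
        have h2 := abs_mul_le_young one_pos ‖gradient (M.cellPart v T) x‖ ‖gradient p x‖
        rw [abs_mul, abs_norm, abs_norm] at h2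
        linarith
    linarith
  have hself : ∀ q : E d → ℝ, ∫ x in T.1, ⟪gradient q x, gradient q x⟫
      = ∫ x in T.1, ‖gradient q x‖ ^ 2 := fun q => by simp only [real_inner_self_eq_norm_sq]
  -- testing the Neumann problem with `v_T`, respectively with the reconstruction
  have h1 := (M.potRec_spec T v).1 _ hvm
  have h2 := (M.potRec_spec T v).1 _ hpm
  rw [potRhs, hself] at h1
  rw [potRhs] at h2
  change ∫ x in T.1, ⟪gradient p x, gradient p x⟫ = _ at h2
  rw [hself] at h2
  have f1 := H.flux_le hd T v hvm
  have f2 := H.flux_le hd T v hpm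
  rw [abs_le] at hcross hcross' f1 f2
  -- comparison of the bulk parts up to the jumps
  have hIP : I ≤ 2 * P + 2 * (C ^ 2 * J) := by linarith [hcross.2, f1.1]
  have hPI : P ≤ 2 * I + 2 * (C ^ 2 * J) := by linarith [hcross'.2, f2.2]
  have hproj : ∑ F ∈ M.facesOf T, (M.hF F)⁻¹ * ∫ x in F.1,
      (M.faceProj k F (p - M.cellProj k T p) : E d → ℝ) x ^ 2 ∂μHE[d - 1] ≤ C ^ 3 * P := by
    calc _ ≤ ∑ F ∈ M.facesOf T, C ^ 2 * P := by
          refine Finset.sum_le_sum fun F hF => (mul_le_mul_of_nonneg_left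
            (M.integral_faceProj_sq_le k F (by fun_prop)) (inv_nonneg.2 (M.hF_pos hd F).le)).trans ?_
          exact H.approx hd hF hpm
      _ = ((M.facesOf T).card : ℝ) * (C ^ 2 * P) := by rw [Finset.sum_const, nsmul_eq_mul]
      _ ≤ C * (C ^ 2 * P) := by gcongr; exact H.card_le T
      _ = C ^ 3 * P := by ring
  have cp : ∀ F : M.Face, ContinuousOn (M.faceProj k F (p - M.cellProj k T p) : E d → ℝ) F.1 :=
    fun F => M.continuousOn_faceProj k F _
  have cs : ∀ F : M.Face, ContinuousOn (M.stabDiff T F v : E d → ℝ) F.1 :=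
    fun F => continuousOn_of_mem_facePoly (M.stabDiff T F v).2
  -- comparison of the face parts up to the gradient of the reconstruction
  have hJS : J ≤ 2 * S + 2 * (C ^ 3 * P) := by
    have : J ≤ 2 * S + 2 * ∑ F ∈ M.facesOf T, (M.hF F)⁻¹ * ∫ x in F.1,
        (M.faceProj k F (p - M.cellProj k T p) : E d → ℝ) x ^ 2 ∂μHE[d - 1] := by
      rw [hJ, hS, Finset.mul_sum, Finset.mul_sum, ← Finset.sum_add_distrib]
      refine Finset.sum_le_sum fun F _ => ?_
      have c4 := cp F
      have c5 := cs F
      have := mul_le_mul_of_nonneg_left (integral_sq_le_of_sub (m := μHE[d - 1])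
        (M.measurableSet_face F)
        (f := fun x => M.facePart v F x - M.cellPart v T x) (g := (M.stabDiff T F v : E d → ℝ))
        (h := (M.faceProj k F (p - M.cellProj k T p) : E d → ℝ))
        (M.integrableOn_face F (by fun_prop)) (M.integrableOn_face F (by fun_prop))
        fun x hx => Or.inl (by rw [stabDiff_eqOn T F v x hx, sub_add_cancel]))
        (inv_nonneg.2 (M.hF_pos hd F).le)
      rw [jumpSq]
      linarith
    linarith
  have hSJ : S ≤ 2 * J + 2 * (C ^ 3 * P) := by
    have : S ≤ 2 * J + 2 * ∑ F ∈ M.facesOf T, (M.hF F)⁻¹ * ∫ x in F.1,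
        (M.faceProj k F (p - M.cellProj k T p) : E d → ℝ) x ^ 2 ∂μHE[d - 1] := by
      rw [hJ, hS, Finset.mul_sum, Finset.mul_sum, ← Finset.sum_add_distrib]
      refine Finset.sum_le_sum fun F _ => ?_
      have c4 := cp F
      have := mul_le_mul_of_nonneg_left (integral_sq_le_of_sub (m := μHE[d - 1])
        (M.measurableSet_face F)
        (f := (M.stabDiff T F v : E d → ℝ)) (g := fun x => M.facePart v F x - M.cellPart v T x)
        (h := (M.faceProj k F (p - M.cellProj k T p) : E d → ℝ))
        (M.integrableOn_face F (by fun_prop)) (M.integrableOn_face F (by fun_prop))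
        fun x hx => Or.inr (stabDiff_eqOn T F v x hx))
        (inv_nonneg.2 (M.hF_pos hd F).le)
      rw [jumpSq]
      linarith
    linarith
  have k2 : 1 ≤ C ^ 2 := one_le_pow₀ hC
  have k3 : 1 ≤ C ^ 3 := one_le_pow₀ hC
  have k25 : C ^ 2 ≤ C ^ 5 := pow_le_pow_right₀ hC (by norm_num)
  have k35 : C ^ 3 ≤ C ^ 5 := pow_le_pow_right₀ hC (by norm_num)
  have k05 : 1 ≤ C ^ 5 := one_le_pow₀ hC
  have k5 : C ^ 5 = C ^ 2 * C ^ 3 := by ring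
  rw [hpot, hdof]
  constructor
  · have a1 : I + J ≤ 2 * P + (2 * C ^ 2 + 1) * (2 * S + 2 * (C ^ 3 * P)) := by
      have := mul_le_mul_of_nonneg_left hJS (by positivity : 0 ≤ 2 * C ^ 2 + 1)
      linarith
    have a2 : 2 * P + (2 * C ^ 2 + 1) * (2 * S + 2 * (C ^ 3 * P))
        = (2 + 4 * C ^ 5 + 2 * C ^ 3) * P + (4 * C ^ 2 + 2) * S := by rw [k5]; ring
    have a3 : (2 + 4 * C ^ 5 + 2 * C ^ 3) * P ≤ 8 * C ^ 5 * P := by gcongr; linarith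
    have a4 : (4 * C ^ 2 + 2) * S ≤ 8 * C ^ 5 * S := by gcongr; linarith
    linarith
  · have a1 : P + S ≤ (1 + 2 * C ^ 3) * (2 * I + 2 * (C ^ 2 * J)) + 2 * J := by
      have := mul_le_mul_of_nonneg_left hPI (by positivity : 0 ≤ 1 + 2 * C ^ 3)
      linarith
    have a2 : (1 + 2 * C ^ 3) * (2 * I + 2 * (C ^ 2 * J)) + 2 * J
        = (2 + 4 * C ^ 3) * I + (2 * C ^ 2 + 4 * C ^ 5 + 2) * J := by rw [k5]; ring
    have a3 : (2 + 4 * C ^ 3) * I ≤ 8 * C ^ 5 * I := by gcongr; linarith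
    have a4 : (2 * C ^ 2 + 4 * C ^ 5 + 2) * J ≤ 8 * C ^ 5 * J := by gcongr; linarith
    linarith

end LocalBounds

end Mesh

/-! ### Bounds on the coefficients -/

/-- The consequences of the design conditions on `|A|` which enter the estimates: up to the constant
`a`, the coefficient `|A|_TF` is at most `|β ⋅ n_TF|`, and at least `|β ⋅ n_TF| - ν_F / h_F`. -/
structure UpwindBounds (A : ℝ → ℝ) (a : ℝ) : Prop where
  one_le : 1 ≤ a
  continuous : Continuous A
  nonneg {ν h : ℝ} (hν : 0 ≤ ν) (hh : 0 < h) (b : ℝ) : 0 ≤ pecletCoef A abs ν h b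
  le_abs {ν h : ℝ} (hν : 0 ≤ ν) (hh : 0 < h) (b : ℝ) : pecletCoef A abs ν h b ≤ a * |b|
  abs_le {ν h : ℝ} (hν : 0 ≤ ν) (hh : 0 < h) (b : ℝ) :
    |b| ≤ a * (pecletCoef A abs ν h b + ν / h)

/-- With a Lipschitz constant `K` of `|A|` and the constant `a` of its growth, `max 1 (max K a⁻¹)`
serves. For an argument of modulus at most `1`, it is the term `ν / h` which bounds `|b|`. -/
theorem exists_upwindBounds {A : ℝ → ℝ} (hA1 : CondA1 A) (hA2 : CondA2 A) :
    ∃ a, UpwindBounds A a := by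
  obtain ⟨⟨K, hK⟩, hA0, hA⟩ := hA1
  obtain ⟨a, ha, hA2⟩ := hA2
  have hA_le : ∀ s, A s ≤ K * |s| := by
    intro s
    have := hK.dist_le_mul s 0
    rw [Real.dist_eq, Real.dist_eq, hA0, sub_zero, sub_zero, abs_of_nonneg (hA s).1] at this
    exact this
  have e1 : (1 : ℝ) ≤ max 1 (max (K : ℝ) a⁻¹) := le_max_left _ _
  have e2 : (K : ℝ) ≤ max 1 (max (K : ℝ) a⁻¹) := (le_max_left _ _).trans (le_max_right _ _)
  have e3 : a⁻¹ ≤ max 1 (max (K : ℝ) a⁻¹) := (le_max_right _ _).trans (le_max_right _ _)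
  refine ⟨max 1 (max (K : ℝ) a⁻¹), e1, hK.continuous, ?_, ?_, ?_⟩
  all_goals set m := max 1 (max (K : ℝ) a⁻¹)
  · intro ν h hν hh b
    unfold pecletCoef
    split_ifs with h0
    · exact abs_nonneg b
    · exact mul_nonneg (by positivity) (hA _).1
  · intro ν h hν hh b
    unfold pecletCoef
    split_ifs with h0
    · nlinarith [abs_nonneg b]
    · have hν' : 0 < ν := lt_of_le_of_ne hν (Ne.symm h0)
      calc ν / h * A (h * b / ν) ≤ ν / h * (K * |h * b / ν|) := by gcongr; exact hA_le _
        _ = K * |b| := by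
          rw [abs_div, abs_mul, abs_of_pos hh, abs_of_pos hν']
          field_simp
        _ ≤ m * |b| := by gcongr
  · intro ν h hν hh b
    unfold pecletCoef
    split_ifs with h0
    · rw [h0, zero_div, add_zero]
      nlinarith [abs_nonneg b]
    · have hν' : 0 < ν := lt_of_le_of_ne hν (Ne.symm h0)
      have hs : |b| = ν / h * |h * b / ν| := by
        rw [abs_div, abs_mul, abs_of_pos hh, abs_of_pos hν']
        field_simp
      have hq : 0 < ν / h := by positivity
      have hA0 := (hA (h * b / ν)).1
      rcases le_total 1 |h * b / ν| with h1 | h1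
      · have h2 : |h * b / ν| ≤ a⁻¹ * A (h * b / ν) := by
          rw [le_inv_mul_iff₀ ha]
          exact hA2 _ h1
        calc |b| = ν / h * |h * b / ν| := hs
          _ ≤ ν / h * (m * A (h * b / ν)) := by
            gcongr
            exact h2.trans (by gcongr)
          _ ≤ m * (ν / h * A (h * b / ν) + ν / h) := by
            have : 0 ≤ m * (ν / h) := by positivity
            linarith
      · calc |b| = ν / h * |h * b / ν| := hs
          _ ≤ ν / h * 1 := by gcongr
          _ ≤ m * (ν / h * A (h * b / ν) + ν / h) := by
            have : 0 ≤ m * (ν / h * A (h * b / ν)) := by positivity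
            nlinarith

theorem pecletCoef_plusPart (A : ℝ → ℝ) {ν h b : ℝ} (hh : h ≠ 0) :
    pecletCoef (plusPart A) (plusPart abs) ν h b = (pecletCoef A abs ν h b + b) / 2 := by
  unfold pecletCoef plusPart
  split_ifs with h0
  · rfl
  · field_simp

theorem pecletCoef_minusPart (A : ℝ → ℝ) {ν h b : ℝ} (hh : h ≠ 0) :
    pecletCoef (minusPart A) (minusPart abs) ν h b = (pecletCoef A abs ν h b - b) / 2 := by
  unfold pecletCoef minusPart
  split_ifs with h0
  · rfl
  · field_simp

namespace Mesh

variable {d : ℕ} {Ω : Set (E d)} {M : Mesh Ω} {k : ℕ} {A : ℝ → ℝ} {a : ℝ}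

section Coefficients

variable (D : Coeffs Ω)

theorem ae_cell (hΩ : IsPolytope Ω) {p : E d → Prop} (h : ∀ᵐ x ∂(volume.restrict Ω), p x)
    (T : M.Cell) : ∀ᵐ x ∂(volume.restrict T.1), p x :=
  ae_restrict_of_ae_restrict_of_subset (M.cell_subset hΩ T) h

theorem neBot_ae_cell (T : M.Cell) : (ae (volume.restrict T.1)).NeBot := by
  rw [ae_neBot, Ne, Measure.restrict_eq_zero]
  exact ((M.isOpen_cell T).measure_pos volume (M.nonempty_cell T)).ne'

theorem νT_nonneg (hΩ : IsPolytope Ω) (T : M.Cell) : 0 ≤ M.νT D T := by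
  rw [νT, setAverage_eq, smul_eq_mul]
  refine mul_nonneg (inv_nonneg.2 measureReal_nonneg) (integral_nonneg_of_ae ?_)
  filter_upwards [ae_cell hΩ D.ν_ge T] with x hx using D.νmin_nonneg.trans hx

theorem νF_nonneg (hΩ : IsPolytope Ω) (F : M.Face) : 0 ≤ M.νF D F := by
  have := M.nonempty_CellsOf F
  exact le_ciInf fun T => νT_nonneg D hΩ T.1

theorem νF_le_νT {T : M.Cell} {F : M.Face} (hF : F ∈ M.facesOf T) : M.νF D F ≤ M.νT D T :=
  ciInf_le (f := fun T : M.CellsOf F => M.νT D T.1) (Set.finite_range _).bddBelow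
    ⟨T, M.mem_facesOf.1 hF⟩

theorem βc_nonneg (T : M.Cell) : 0 ≤ M.βc D T := ENNReal.toReal_nonneg

/-- The essential supremum of the continuous field bounds it at every point of the closed cell. -/
theorem norm_β_le (T : M.Cell) : ∀ x ∈ closure T.1, ‖D.β x‖ ≤ M.βc D T := by
  have hc := M.continuousOn_β_cell D T
  obtain ⟨B, hB⟩ := (M.isBounded_cell T).isCompact_closure.exists_bound_of_continuousOn hc
  have hfin : eLpNormEssSup D.β (volume.restrict T.1) < ∞ :=
    eLpNormEssSup_lt_top_of_ae_bound (C := B) (by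
      filter_upwards [ae_restrict_mem (M.isOpen_cell T).measurableSet] with x hx
        using hB x (subset_closure hx))
  have hae : (fun x => max (‖D.β x‖ - M.βc D T) 0) =ᵐ[volume.restrict T.1] fun _ => (0 : ℝ) := by
    filter_upwards [ae_le_eLpNormEssSup (f := D.β) (μ := volume.restrict T.1)] with x hx
    refine max_eq_right (sub_nonpos.2 ?_)
    rw [βc, eLpNorm_exponent_top, ← toReal_enorm]
    exact ENNReal.toReal_mono hfin.ne hx
  have hcont : ContinuousOn (fun x => max (‖D.β x‖ - M.βc D T) 0) (closure T.1) := by fun_prop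
  have h1 := Measure.eqOn_open_of_ae_eq hae (M.isOpen_cell T) (hcont.mono subset_closure)
    continuousOn_const
  intro x hx
  have h2 := h1.of_subset_closure hcont continuousOn_const subset_closure Subset.rfl hx
  have := le_max_left (‖D.β x‖ - M.βc D T) 0
  simp only at h2
  linarith

variable (M) in
/-- The normal component `β ⋅ n_TF`. -/
noncomputable def bn (T : M.Cell) (F : M.Face) (x : E d) : ℝ := ⟪D.β x, M.nrm T F⟫

@[fun_prop]
theorem continuousOn_bn (T : M.Cell) (F : M.Face) : ContinuousOn (M.bn D T F) F.1 := by
  have := M.continuousOn_β_face D F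
  unfold bn
  fun_prop

theorem abs_bn_le {T : M.Cell} {F : M.Face} (hF : F ∈ M.facesOf T) {x : E d} (hx : x ∈ F.1) :
    |M.bn D T F x| ≤ M.βc D T := by
  have h1 := abs_real_inner_le_norm (D.β x) (M.nrm T F)
  rw [norm_nrm hF, mul_one] at h1
  exact h1.trans (norm_β_le D T x (M.face_subset_closure hF hx))

theorem ae_abs_μ_le (hΩ : IsPolytope Ω) (T : M.Cell) :
    ∀ᵐ x ∂(volume.restrict T.1), |D.μ x| ≤ (M.τc D T)⁻¹ := by
  have hfin : eLpNormEssSup D.μ (volume.restrict T.1) < ∞ := by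
    have := (D.μ_bdd.mono_measure (Measure.restrict_mono_set volume (M.cell_subset hΩ T))).2
    rwa [eLpNorm_exponent_top] at this
  filter_upwards [ae_le_eLpNormEssSup (f := D.μ) (μ := volume.restrict T.1)] with x hx
  rw [τc, inv_inv, eLpNorm_exponent_top]
  refine le_trans ?_ (le_max_left _ _)
  rw [← Real.norm_eq_abs, ← toReal_enorm]
  exact ENNReal.toReal_mono hfin.ne hx

theorem μ₀_le (hΩ : IsPolytope Ω) (T : M.Cell) : D.μ₀ ≤ (M.τc D T)⁻¹ := by
  have := neBot_ae_cell T
  obtain ⟨x, h1, h2⟩ := ((ae_abs_μ_le D hΩ T).and (ae_cell hΩ D.μ_ge T)).exists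
  exact h2.trans ((le_abs_self _).trans h1)

theorem τc_inv_pos (hΩ : IsPolytope Ω) (T : M.Cell) : 0 < (M.τc D T)⁻¹ :=
  D.μ₀_pos.trans_le (μ₀_le D hΩ T)

theorem integrableOn_μ_mul (hΩ : IsPolytope Ω) (T : M.Cell) {f : E d → ℝ}
    (hf : ContinuousOn f (closure T.1)) : IntegrableOn (fun x => D.μ x * f x) T.1 :=
  (M.integrableOn_cell T hf).bdd_mul
    (D.μ_bdd.1.mono_measure (Measure.restrict_mono_set volume (M.cell_subset hΩ T)))
    (ae_abs_μ_le D hΩ T)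

/-- The factor `ζ` turns `τ_c⁻¹` into a lower bound for the reaction coefficient. -/
theorem ζ_bounds (hΩ : IsPolytope Ω) : 0 < M.ζ D ∧ M.ζ D ≤ 1 / 2 ∧
    ∀ T : M.Cell, M.ζ D * (M.τc D T)⁻¹ ≤ D.μ₀ := by
  have hne := M.nonempty_Cell hΩ
  have hle : ∀ T : M.Cell, M.ζ D ≤ min (1 / 2) (M.τc D T * D.μ₀) := fun T =>
    ciInf_le (f := fun T : M.Cell => min (1 / 2) (M.τc D T * D.μ₀)) (Set.finite_range _).bddBelow T
  refine ⟨?_, (hle hne.some).trans (min_le_left _ _), fun T => ?_⟩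
  · obtain ⟨T, hT⟩ := exists_eq_ciInf_of_finite
      (f := fun T : M.Cell => min (1 / 2) (M.τc D T * D.μ₀))
    rw [ζ, ← hT]
    exact lt_min (by norm_num) (mul_pos (inv_pos.1 (τc_inv_pos D hΩ T)) D.μ₀_pos)
  · have h1 := τc_inv_pos D hΩ T
    rw [mul_inv_le_iff₀ (inv_pos.1 h1), mul_comm]
    exact (hle T).trans (min_le_right _ _)

end Coefficients

variable (D : Coeffs Ω)

theorem faceCoef_plusPart (hd : 1 ≤ d) (T : M.Cell) (F : M.Face) (x : E d) :
    M.faceCoef D (plusPart A) (plusPart abs) T F x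
      = (M.faceCoef D A abs T F x + M.bn D T F x) / 2 :=
  pecletCoef_plusPart A (M.hF_pos hd F).ne'

theorem faceCoef_minusPart (hd : 1 ≤ d) (T : M.Cell) (F : M.Face) (x : E d) :
    M.faceCoef D (minusPart A) (minusPart abs) T F x
      = (M.faceCoef D A abs T F x - M.bn D T F x) / 2 :=
  pecletCoef_minusPart A (M.hF_pos hd F).ne'

theorem continuousOn_faceCoef (hA : UpwindBounds A a) (T : M.Cell) (F : M.Face) :
    ContinuousOn (M.faceCoef D A abs T F) F.1 := by
  have h1 := continuousOn_bn D T F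
  have h2 := hA.continuous
  have : M.faceCoef D A abs T F = fun x => pecletCoef A abs (M.νF D F) (M.hF F) (M.bn D T F x) := rfl
  rw [this]
  unfold pecletCoef
  split_ifs
  · exact h1.abs
  · fun_prop

end Mesh

/-! ### Local estimates of the advective derivative -/

namespace Mesh

variable {d : ℕ} {Ω : Set (E d)} {M : Mesh Ω} {k : ℕ} {A : ℝ → ℝ} {a C : ℝ} (D : Coeffs Ω)

theorem aνT_eq (T : M.Cell) (w v : M.Dof k) : M.aνT D T w v = M.νT D T *
    ((∫ x in T.1, ⟪gradient (M.potRec T w : E d → ℝ) x, gradient (M.potRec T v : E d → ℝ) x⟫) +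
      ∑ F ∈ M.facesOf T, (M.hF F)⁻¹ * ∫ x in F.1,
        (M.stabDiff T F w : E d → ℝ) x * (M.stabDiff T F v : E d → ℝ) x ∂μHE[d - 1]) := by
  rw [aνT, integral_const_mul, mul_add, Finset.mul_sum]
  congr 1
  refine Finset.sum_congr rfl fun F _ => ?_
  rw [div_eq_mul_inv, mul_assoc]
  rfl

theorem aνT_self (T : M.Cell) (v : M.Dof k) : M.aνT D T v v = M.νT D T * M.potEnergy T v := by
  rw [aνT_eq, potEnergy]
  simp only [real_inner_self_eq_norm_sq, ← sq]

theorem potEnergy_nonneg (hd : 1 ≤ d) (T : M.Cell) (v : M.Dof k) : 0 ≤ M.potEnergy T v :=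
  add_nonneg (integral_norm_gradient_sq_nonneg _ _) (Finset.sum_nonneg fun F _ =>
    mul_nonneg (inv_nonneg.2 (M.hF_pos hd F).le) (integral_nonneg fun _ => sq_nonneg _))

theorem aνT_self_nonneg (hd : 1 ≤ d) (hΩ : IsPolytope Ω) (T : M.Cell) (v : M.Dof k) :
    0 ≤ M.aνT D T v v := by
  rw [aνT_self]
  exact mul_nonneg (νT_nonneg D hΩ T) (potEnergy_nonneg hd T v)

/-- Young's inequality for the form `a_{ν,T}`. -/
theorem abs_aνT_le (hd : 1 ≤ d) (hΩ : IsPolytope Ω) (T : M.Cell) (w v : M.Dof k) {t : ℝ}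
    (ht : 0 < t) : |M.aνT D T w v| ≤ t * M.aνT D T w w + (4 * t)⁻¹ * M.aνT D T v v := by
  have hν := νT_nonneg D hΩ T
  have hcell : |∫ x in T.1,
      ⟪gradient (M.potRec T w : E d → ℝ) x, gradient (M.potRec T v : E d → ℝ) x⟫| ≤
      t * (∫ x in T.1, ‖gradient (M.potRec T w : E d → ℝ) x‖ ^ 2) +
        (4 * t)⁻¹ * ∫ x in T.1, ‖gradient (M.potRec T v : E d → ℝ) x‖ ^ 2 := by
    refine abs_setIntegral_le_of_young (M.isOpen_cell T).measurableSet
      (M.integrableOn_cell T (by fun_prop)) (M.integrableOn_cell T (by fun_prop)) fun x _ => ?_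
    refine (abs_real_inner_le_norm _ _).trans ((le_abs_self _).trans (abs_mul_le_young ht _ _))
  have hface : ∀ F ∈ M.facesOf T, |(M.hF F)⁻¹ * ∫ x in F.1,
        (M.stabDiff T F w : E d → ℝ) x * (M.stabDiff T F v : E d → ℝ) x ∂μHE[d - 1]| ≤
      t * ((M.hF F)⁻¹ * ∫ x in F.1, (M.stabDiff T F w : E d → ℝ) x ^ 2 ∂μHE[d - 1]) +
      (4 * t)⁻¹ * ((M.hF F)⁻¹ * ∫ x in F.1, (M.stabDiff T F v : E d → ℝ) x ^ 2 ∂μHE[d - 1]) := by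
    intro F _
    have h0 := inv_nonneg.2 (M.hF_pos hd F).le
    have c1 := continuousOn_of_mem_facePoly (M.stabDiff T F w).2
    have c2 := continuousOn_of_mem_facePoly (M.stabDiff T F v).2
    have := mul_le_mul_of_nonneg_left (abs_setIntegral_le_of_young (m := μHE[d - 1])
      (M.measurableSet_face F) (u := fun x => (M.stabDiff T F w : E d → ℝ) x *
        (M.stabDiff T F v : E d → ℝ) x) (f := fun x => (M.stabDiff T F w : E d → ℝ) x ^ 2)
      (g := fun x => (M.stabDiff T F v : E d → ℝ) x ^ 2)
      (M.integrableOn_face F (by fun_prop)) (M.integrableOn_face F (by fun_prop))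
      fun x _ => abs_mul_le_young ht _ _) h0
    rw [abs_mul, abs_of_nonneg h0]
    linarith
  rw [aνT_self, aνT_self, aνT_eq, abs_mul, abs_of_nonneg hν]
  have := mul_le_mul_of_nonneg_left ((abs_add_le _ _).trans (add_le_add hcell
    ((Finset.abs_sum_le_sum_abs _ _).trans (Finset.sum_le_sum hface)))) hν
  rw [Finset.sum_add_distrib, ← Finset.mul_sum, ← Finset.mul_sum] at this
  unfold potEnergy
  linarith

variable (M) in
/-- The squared norm of `v_F - v_T` in `L²(F)` with weight `|A|_TF`. -/
noncomputable def upwindSq (A : ℝ → ℝ) (T : M.Cell) (F : M.Face) (v : M.Dof k) : ℝ :=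
  ∫ x in F.1, M.faceCoef D A abs T F x * (M.facePart v F x - M.cellPart v T x) ^ 2 ∂μHE[d - 1]

variable (M) in
/-- The sum of the squared norms of `v_F - v_T` in `L²(F)` with weight `|β ⋅ n_TF|`. -/
noncomputable def fluxSq (T : M.Cell) (v : M.Dof k) : ℝ :=
  ∑ F ∈ M.facesOf T, ∫ x in F.1,
    |M.bn D T F x| * (M.facePart v F x - M.cellPart v T x) ^ 2 ∂μHE[d - 1]

variable (M) in
/-- The contribution of a cell to the square of the `♭`-norm. -/
noncomputable def cellEnergy (A : ℝ → ℝ) (T : M.Cell) (v : M.Dof k) : ℝ :=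
  M.aνT D T v v + 1 / 2 * (∑ F ∈ M.facesOf T, M.upwindSq D A T F v) +
    (M.τc D T)⁻¹ * ∫ x in T.1, M.cellPart v T x ^ 2

open Classical in
variable (M) in
/-- The contribution of a cell to the additional term of the `♯`-norm. -/
noncomputable def advEnergy (T : M.Cell) (v : M.Dof k) : ℝ :=
  if M.βc D T = 0 then 0 else
    M.hT T * (M.βc D T)⁻¹ * ∫ x in T.1, (M.advRec D.β T v : E d → ℝ) x ^ 2

variable (M) in
/-- The sum of the diffusive, reactive and advective frequencies of a cell. -/
noncomputable def frequency (T : M.Cell) : ℝ :=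
  M.νT D T / M.hT T ^ 2 + (M.τc D T)⁻¹ + M.βc D T / M.hT T

theorem upwindSq_nonneg (hA : UpwindBounds A a) (hd : 1 ≤ d) (hΩ : IsPolytope Ω) (T : M.Cell)
    (F : M.Face) (v : M.Dof k) : 0 ≤ M.upwindSq D A T F v :=
  integral_nonneg fun _ => mul_nonneg (hA.nonneg (νF_nonneg D hΩ F) (M.hF_pos hd F) _)
    (sq_nonneg _)

theorem integral_cellPart_sq_nonneg (T : M.Cell) (v : M.Dof k) :
    0 ≤ ∫ x in T.1, M.cellPart v T x ^ 2 := integral_nonneg fun _ => sq_nonneg _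

theorem integral_advRec_sq_nonneg (T : M.Cell) (v : M.Dof k) :
    0 ≤ ∫ x in T.1, (M.advRec D.β T v : E d → ℝ) x ^ 2 := integral_nonneg fun _ => sq_nonneg _

theorem advEnergy_nonneg (hd : 1 ≤ d) (T : M.Cell) (v : M.Dof k) : 0 ≤ M.advEnergy D T v := by
  unfold advEnergy
  have := βc_nonneg D T
  have := M.hT_pos hd T
  have := integral_advRec_sq_nonneg D T v
  split_ifs <;> positivity

theorem cellEnergy_terms (hA : UpwindBounds A a) (hd : 1 ≤ d) (hΩ : IsPolytope Ω) (T : M.Cell)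
    (v : M.Dof k) : 0 ≤ M.aνT D T v v ∧ 0 ≤ ∑ F ∈ M.facesOf T, M.upwindSq D A T F v ∧
      0 ≤ (M.τc D T)⁻¹ * ∫ x in T.1, M.cellPart v T x ^ 2 :=
  ⟨aνT_self_nonneg D hd hΩ T v, Finset.sum_nonneg fun F _ => upwindSq_nonneg D hA hd hΩ T F v,
    mul_nonneg (τc_inv_pos D hΩ T).le (integral_cellPart_sq_nonneg T v)⟩

theorem fluxSq_nonneg (T : M.Cell) (v : M.Dof k) : 0 ≤ M.fluxSq D T v :=
  Finset.sum_nonneg fun _ _ => integral_nonneg fun _ => mul_nonneg (abs_nonneg _) (sq_nonneg _)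

/-- The discrete advective derivative after integration by parts. -/
theorem integral_advRec_mul (hΩ : IsPolytope Ω) (T : M.Cell) (v : M.Dof k) {z : E d → ℝ}
    (hz : z ∈ polyFun d k) : ∫ x in T.1, (M.advRec D.β T v : E d → ℝ) x * z x =
      (∫ x in T.1, ⟪D.β x, gradient (M.cellPart v T) x⟫ * z x) +
        ∑ F ∈ M.facesOf T, ∫ x in F.1,
          M.bn D T F x * (M.facePart v F x - M.cellPart v T x) * z x ∂μHE[d - 1] := by
  have hv := M.cellPart_mem v T
  have c1 := continuous_of_mem_polyFun hz
  have c2 := continuous_gradient_of_mem_polyFun hz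
  have c3 := M.continuousOn_β_cell D T
  have hg : ∀ x, ⟪D.β x, gradient (fun y => M.cellPart v T y * z y) x⟫
      = M.cellPart v T x * ⟪D.β x, gradient z x⟫ +
        ⟪D.β x, gradient (M.cellPart v T) x⟫ * z x := by
    intro x
    simp only [real_inner_comm _ (D.β x), inner_gradient]
    rw [fderiv_fun_mul (differentiable_of_mem_polyFun hv x) (differentiable_of_mem_polyFun hz x)]
    simp
    ring
  have h1 := M.integral_inner_gradient hΩ D T (mul_mem_polyFun hv hz)
  simp only [hg] at h1
  rw [integral_add (M.integrableOn_cell T (by fun_prop)) (M.integrableOn_cell T (by fun_prop))]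
    at h1
  rw [M.advRec_spec D T v z hz, advRhs]
  have h2 : ∑ F ∈ M.facesOf T, ∫ x in F.1,
      M.bn D T F x * (M.facePart v F x - M.cellPart v T x) * z x ∂μHE[d - 1] =
      (∑ F ∈ M.facesOf T, ∫ x in F.1, ⟪D.β x, M.nrm T F⟫ * M.facePart v F x * z x ∂μHE[d - 1]) -
      ∑ F ∈ M.facesOf T, ∫ x in F.1,
        ⟪D.β x, M.nrm T F⟫ * (M.cellPart v T x * z x) ∂μHE[d - 1] := by
    rw [← Finset.sum_sub_distrib]
    refine Finset.sum_congr rfl fun F _ => ?_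
    have c4 := M.continuousOn_β_face D F
    rw [← integral_sub (M.integrableOn_face F (by fun_prop)) (M.integrableOn_face F (by fun_prop))]
    simp only [bn]
    congr 1
    ext x
    ring
  rw [h2, ← h1]
  ring

/-- Where the stabilization is too weak to control `|β ⋅ n_TF|`, the diffusive energy does. -/
theorem fluxSq_le (H : M.LocalBounds (k + 1) C) (hA : UpwindBounds A a) (hd : 1 ≤ d)
    (hΩ : IsPolytope Ω) (T : M.Cell) (v : M.Dof k) :
    M.fluxSq D T v ≤ 8 * a * C ^ 5 * M.cellEnergy D A T v := by
  have hC := H.one_le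
  have ha := hA.one_le
  obtain ⟨t1, t2, t3⟩ := cellEnergy_terms D hA hd hΩ T v
  have hface : ∀ F ∈ M.facesOf T, ∫ x in F.1,
      |M.bn D T F x| * (M.facePart v F x - M.cellPart v T x) ^ 2 ∂μHE[d - 1] ≤
      a * M.upwindSq D A T F v + a * (M.νT D T * ((M.hF F)⁻¹ * M.jumpSq T F v)) := by
    intro F hF
    have hF0 := M.hF_pos hd F
    have hν := νF_nonneg D hΩ F
    have c1 := continuousOn_faceCoef D hA T F
    have h1 := (le_abs_self _).trans (abs_setIntegral_le_of_young (m := μHE[d - 1])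
      (M.measurableSet_face F)
      (u := fun x => |M.bn D T F x| * (M.facePart v F x - M.cellPart v T x) ^ 2)
      (f := fun x => M.faceCoef D A abs T F x * (M.facePart v F x - M.cellPart v T x) ^ 2)
      (g := fun x => (M.facePart v F x - M.cellPart v T x) ^ 2) (a := a)
      (b := a * (M.νF D F / M.hF F))
      (M.integrableOn_face F (by fun_prop)) (M.integrableOn_face F (by fun_prop)) fun x _ => by
        rw [abs_of_nonneg (mul_nonneg (abs_nonneg _) (sq_nonneg _))]
        have := mul_le_mul_of_nonneg_right (hA.abs_le hν hF0 (M.bn D T F x))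
          (sq_nonneg (M.facePart v F x - M.cellPart v T x))
        refine this.trans_eq ?_
        simp only [faceCoef, bn]
        ring)
    refine h1.trans (add_le_add_right ?_ _)
    rw [mul_assoc, div_eq_mul_inv, mul_assoc]
    have : 0 ≤ (M.hF F)⁻¹ * M.jumpSq T F v :=
      mul_nonneg (inv_nonneg.2 hF0.le) (jumpSq_nonneg T F v)
    have h2 := mul_le_mul_of_nonneg_right (νF_le_νT D hF) this
    exact mul_le_mul_of_nonneg_left h2 (by linarith)
  have hsum := Finset.sum_le_sum hface
  rw [Finset.sum_add_distrib, ← Finset.mul_sum, ← Finset.mul_sum, ← Finset.mul_sum] at hsum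
  have hν := νT_nonneg D hΩ T
  have h1 : M.νT D T * (∑ F ∈ M.facesOf T, (M.hF F)⁻¹ * M.jumpSq T F v)
      ≤ 8 * C ^ 5 * M.aνT D T v v := by
    have h2 := (H.energy_equiv hd T v).1
    have h3 : ∑ F ∈ M.facesOf T, (M.hF F)⁻¹ * M.jumpSq T F v ≤ M.dofEnergy T v :=
      le_add_of_nonneg_left (integral_norm_gradient_sq_nonneg _ _)
    rw [aνT_self]
    calc _ ≤ M.νT D T * (8 * C ^ 5 * M.potEnergy T v) := by gcongr; exact h3.trans h2
      _ = _ := by ring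
  have k5 : 1 ≤ C ^ 5 := one_le_pow₀ hC
  calc M.fluxSq D T v ≤ a * (∑ F ∈ M.facesOf T, M.upwindSq D A T F v) +
        a * (8 * C ^ 5 * M.aνT D T v v) := hsum.trans (by gcongr)
    _ ≤ a * (8 * C ^ 5 * (1 / 2 * ∑ F ∈ M.facesOf T, M.upwindSq D A T F v)) +
        a * (8 * C ^ 5 * M.aνT D T v v) := by
      gcongr
      nlinarith
    _ ≤ a * (8 * C ^ 5 * (1 / 2 * ∑ F ∈ M.facesOf T, M.upwindSq D A T F v)) +
        a * (8 * C ^ 5 * M.aνT D T v v) +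
        a * (8 * C ^ 5 * ((M.τc D T)⁻¹ * ∫ x in T.1, M.cellPart v T x ^ 2)) :=
      le_add_of_nonneg_right (by positivity)
    _ = 8 * a * C ^ 5 * M.cellEnergy D A T v := by rw [cellEnergy]; ring

/-- A weighted bound on a flux through the boundary of a cell whose density is controlled by
`|β ⋅ n_TF|`. -/
theorem abs_flux_le (H : M.LocalBounds (k + 1) C) (hd : 1 ≤ d) (T : M.Cell) (v : M.Dof k)
    {z : E d → ℝ} (hz : z ∈ polyFun d k) {c : M.Face → E d → ℝ} {κ : ℝ} (hκ : 0 ≤ κ)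
    (hc : ∀ F ∈ M.facesOf T, ∀ x ∈ F.1, |c F x| ≤ κ * |M.bn D T F x|) {t : ℝ} (ht : 0 < t) :
    |∑ F ∈ M.facesOf T, ∫ x in F.1,
      c F x * (M.facePart v F x - M.cellPart v T x) * z x ∂μHE[d - 1]| ≤
    κ * (t * M.fluxSq D T v + (4 * t)⁻¹ * (C ^ 2 * (M.βc D T / M.hT T) * ∫ x in T.1, z x ^ 2)) := by
  have hC := H.one_le
  have hT := M.hT_pos hd T
  have hβ := βc_nonneg D T
  have c1 := continuous_of_mem_polyFun hz
  set I := ∫ x in T.1, z x ^ 2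
  have hI : 0 ≤ I := integral_nonneg fun _ => sq_nonneg _
  have hface : ∀ F ∈ M.facesOf T, |∫ x in F.1,
      c F x * (M.facePart v F x - M.cellPart v T x) * z x ∂μHE[d - 1]| ≤
      κ * t * (∫ x in F.1, |M.bn D T F x| *
        (M.facePart v F x - M.cellPart v T x) ^ 2 ∂μHE[d - 1]) +
      κ * (4 * t)⁻¹ * (M.βc D T / M.hT T * (C * I)) := by
    intro F hF
    have h1 := abs_setIntegral_le_of_young (m := μHE[d - 1])
      (M.measurableSet_face F)
      (u := fun x => c F x * (M.facePart v F x - M.cellPart v T x) * z x)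
      (f := fun x => |M.bn D T F x| * (M.facePart v F x - M.cellPart v T x) ^ 2)
      (g := fun x => z x ^ 2) (a := κ * t) (b := κ * (4 * t)⁻¹ * M.βc D T)
      (M.integrableOn_face F (by fun_prop)) (M.integrableOn_face F (by fun_prop)) fun x hx => by
        have e1 := abs_mul_le_young ht (M.facePart v F x - M.cellPart v T x) (z x)
        have e2 := abs_bn_le D hF hx
        rw [mul_assoc, abs_mul]
        calc _ ≤ κ * |M.bn D T F x| * (t * (M.facePart v F x - M.cellPart v T x) ^ 2 +
              (4 * t)⁻¹ * z x ^ 2) := mul_le_mul (hc F hF x hx) e1 (abs_nonneg _) (by positivity)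
          _ = κ * t * (|M.bn D T F x| * (M.facePart v F x - M.cellPart v T x) ^ 2) +
              κ * (4 * t)⁻¹ * |M.bn D T F x| * z x ^ 2 := by ring
          _ ≤ _ := by gcongr
    refine h1.trans (add_le_add_right ?_ _)
    have h2 := H.trace hF (polyFun_mono (Nat.le_succ k) hz)
    have h3 : ∫ x in F.1, z x ^ 2 ∂μHE[d - 1] ≤ (M.hT T)⁻¹ * (C * I) := by
      rwa [le_inv_mul_iff₀ hT]
    calc _ ≤ κ * (4 * t)⁻¹ * M.βc D T * ((M.hT T)⁻¹ * (C * I)) := by gcongr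
      _ = _ := by ring
  refine (Finset.abs_sum_le_sum_abs _ _).trans ((Finset.sum_le_sum hface).trans ?_)
  rw [Finset.sum_add_distrib, ← Finset.mul_sum, Finset.sum_const, nsmul_eq_mul]
  have h4 : ((M.facesOf T).card : ℝ) * (κ * (4 * t)⁻¹ * (M.βc D T / M.hT T * (C * I)))
      ≤ C * (κ * (4 * t)⁻¹ * (M.βc D T / M.hT T * (C * I))) := by
    gcongr
    exact H.card_le T
  unfold fluxSq
  linarith

/-- The advective derivative is controlled by the gradient in the cell and the jumps: it is tested
with itself after integration by parts. -/
theorem advEnergy_le (H : M.LocalBounds (k + 1) C) (hd : 1 ≤ d) (hΩ : IsPolytope Ω) (T : M.Cell)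
    (v : M.Dof k) : M.advEnergy D T v ≤
      2 * (M.hT T * M.βc D T * ∫ x in T.1, ‖gradient (M.cellPart v T) x‖ ^ 2) +
        2 * C ^ 2 * M.fluxSq D T v := by
  have hC := H.one_le
  have hT := M.hT_pos hd T
  have hβ := βc_nonneg D T
  have hfl := fluxSq_nonneg D T v
  have hI := integral_norm_gradient_sq_nonneg T.1 (M.cellPart v T)
  unfold advEnergy
  split_ifs with h0
  · positivity
  have hβ0 : 0 < M.βc D T := lt_of_le_of_ne hβ (Ne.symm h0)
  set G : E d → ℝ := (M.advRec D.β T v : E d → ℝ) with hG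
  have hGm : G ∈ polyFun d k := (M.advRec D.β T v).2
  have c1 := continuous_of_mem_polyFun hGm
  have h1 : ∫ x in T.1, G x * G x = _ := integral_advRec_mul D hΩ T v hGm
  have h2 := abs_flux_le D H hd T v hGm zero_le_one (c := fun F => M.bn D T F)
    (fun F _ x _ => (one_mul _).ge) (t := C ^ 2 * (M.βc D T / M.hT T)) (by positivity)
  have h3 := abs_setIntegral_le_of_young (m := volume) (M.isOpen_cell T).measurableSet
    (u := fun x => ⟪D.β x, gradient (M.cellPart v T) x⟫ * G x)
    (f := fun x => ‖gradient (M.cellPart v T) x‖ ^ 2) (g := fun x => G x ^ 2)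
    (a := M.βc D T ^ 2) (b := 1 / 4)
    (M.integrableOn_cell T (by fun_prop)) (M.integrableOn_cell T (by fun_prop)) fun x hx => by
      have e1 := abs_real_inner_le_norm (D.β x) (gradient (M.cellPart v T) x)
      have e2 := norm_β_le D T x (subset_closure hx)
      have e3 := abs_mul_le_young one_pos (M.βc D T * ‖gradient (M.cellPart v T) x‖) (G x)
      rw [abs_mul]
      calc _ ≤ M.βc D T * ‖gradient (M.cellPart v T) x‖ * |G x| := by
            gcongr
            exact e1.trans (by gcongr)
        _ = |M.βc D T * ‖gradient (M.cellPart v T) x‖ * G x| := by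
            rw [abs_mul, abs_mul, abs_norm, abs_of_nonneg hβ]
        _ ≤ _ := by linarith
  simp only [← sq] at h1
  set I := ∫ x in T.1, ‖gradient (M.cellPart v T) x‖ ^ 2
  set S := ∫ x in T.1, G x ^ 2
  have h4 : (4 * (C ^ 2 * (M.βc D T / M.hT T)))⁻¹ * (C ^ 2 * (M.βc D T / M.hT T) * S)
      = 1 / 4 * S := by field_simp
  rw [h4, one_mul] at h2
  rw [abs_le] at h2 h3
  have h5 : S ≤ 2 * (M.βc D T ^ 2 * I) + 2 * (C ^ 2 * (M.βc D T / M.hT T) * M.fluxSq D T v) := by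
    linarith [h2.2, h3.2]
  calc M.hT T * (M.βc D T)⁻¹ * S ≤ M.hT T * (M.βc D T)⁻¹ *
        (2 * (M.βc D T ^ 2 * I) + 2 * (C ^ 2 * (M.βc D T / M.hT T) * M.fluxSq D T v)) := by gcongr
    _ = _ := by field_simp

end Mesh

/-! ### Local estimates for the inf-sup condition -/

namespace Mesh

variable {d : ℕ} {Ω : Set (E d)} {M : Mesh Ω} {k : ℕ} {A : ℝ → ℝ} {a C : ℝ} (D : Coeffs Ω)

/-- For degrees of freedom which vanish on the faces, all contributions to the `♯`-norm are
controlled by the values in the cells. -/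
theorem cellEnergy_add_advEnergy_le (H : M.LocalBounds (k + 1) C) (hA : UpwindBounds A a)
    (hd : 1 ≤ d) (hΩ : IsPolytope Ω) (T : M.Cell) {v : M.Dof k}
    (hv : ∀ F, M.facePart v F = 0) :
    M.cellEnergy D A T v + M.advEnergy D T v ≤
      16 * a * C ^ 7 * (M.frequency D T * ∫ x in T.1, M.cellPart v T x ^ 2) := by
  have hC := H.one_le
  have ha := hA.one_le
  have hT := M.hT_pos hd T
  have hβ := βc_nonneg D T
  have hν := νT_nonneg D hΩ T
  have hτ := τc_inv_pos D hΩ T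
  have hvm := polyFun_mono (Nat.le_succ k) (M.cellPart_mem v T)
  have hjump : ∀ F x, (M.facePart v F x - M.cellPart v T x) ^ 2 = M.cellPart v T x ^ 2 :=
    fun F x => by rw [hv F, Pi.zero_apply, zero_sub, neg_sq]
  set V := ∫ x in T.1, M.cellPart v T x ^ 2 with hV
  have hV0 : 0 ≤ V := integral_cellPart_sq_nonneg T v
  set I := ∫ x in T.1, ‖gradient (M.cellPart v T) x‖ ^ 2 with hI
  have hI0 : 0 ≤ I := integral_norm_gradient_sq_nonneg _ _
  have hIV : I ≤ C * V / M.hT T ^ 2 := by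
    rw [le_div_iff₀ (by positivity), mul_comm]
    exact H.inverse T hvm
  have hdof : M.dofEnergy T v ≤ 2 * C ^ 2 * V / M.hT T ^ 2 := by
    have h1 : ∀ F ∈ M.facesOf T, (M.hF F)⁻¹ * M.jumpSq T F v ≤ C * V / M.hT T ^ 2 := by
      intro F hF
      have hF0 := M.hF_pos hd F
      rw [le_div_iff₀ (by positivity), inv_mul_eq_div, div_mul_eq_mul_div, div_le_iff₀ hF0]
      have := H.trace_hF hF hvm
      simp only [jumpSq, hjump]
      linarith
    have h2 := Finset.sum_le_sum h1
    rw [Finset.sum_const, nsmul_eq_mul] at h2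
    have h3 : ((M.facesOf T).card : ℝ) * (C * V / M.hT T ^ 2) ≤ C * (C * V / M.hT T ^ 2) := by
      gcongr
      exact H.card_le T
    have h4 : C * V / M.hT T ^ 2 ≤ C * (C * V / M.hT T ^ 2) :=
      le_mul_of_one_le_left (by positivity) hC
    calc M.dofEnergy T v ≤ C * (C * V / M.hT T ^ 2) + C * (C * V / M.hT T ^ 2) :=
          add_le_add (hIV.trans h4) (h2.trans h3)
      _ = _ := by ring
  have hpot : M.aνT D T v v ≤ 16 * C ^ 7 * (M.νT D T / M.hT T ^ 2 * V) := by
    rw [aνT_self]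
    calc _ ≤ M.νT D T * (8 * C ^ 5 * (2 * C ^ 2 * V / M.hT T ^ 2)) := by
          gcongr
          exact (H.energy_equiv hd T v).2.trans (by gcongr)
      _ = _ := by ring
  have hflux : M.fluxSq D T v ≤ C ^ 2 * (M.βc D T / M.hT T * V) := by
    have h1 : ∀ F ∈ M.facesOf T, ∫ x in F.1, |M.bn D T F x| *
        (M.facePart v F x - M.cellPart v T x) ^ 2 ∂μHE[d - 1] ≤ C * (M.βc D T / M.hT T * V) := by
      intro F hF
      simp only [hjump]
      calc _ ≤ ∫ x in F.1, M.βc D T * M.cellPart v T x ^ 2 ∂μHE[d - 1] :=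
            setIntegral_mono_on (M.integrableOn_face F (by fun_prop))
              (M.integrableOn_face F (by fun_prop)) (M.measurableSet_face F) fun x hx => by
                gcongr
                exact abs_bn_le D hF hx
        _ = M.βc D T * ∫ x in F.1, M.cellPart v T x ^ 2 ∂μHE[d - 1] := integral_const_mul _ _
        _ ≤ M.βc D T * ((M.hT T)⁻¹ * (C * V)) := by
            gcongr
            rw [le_inv_mul_iff₀ hT]
            exact H.trace hF hvm
        _ = _ := by ring
    have h2 := Finset.sum_le_sum h1
    rw [Finset.sum_const, nsmul_eq_mul] at h2
    calc _ ≤ _ := h2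
      _ ≤ C * (C * (M.βc D T / M.hT T * V)) := by gcongr; exact H.card_le T
      _ = _ := by ring
  have hup : ∑ F ∈ M.facesOf T, M.upwindSq D A T F v ≤ a * M.fluxSq D T v := by
    rw [fluxSq, Finset.mul_sum]
    refine Finset.sum_le_sum fun F _ => ?_
    have c1 := continuousOn_faceCoef D hA T F
    rw [← integral_const_mul]
    refine setIntegral_mono_on (M.integrableOn_face F (by fun_prop))
      (M.integrableOn_face F (by fun_prop)) (M.measurableSet_face F) fun x _ => ?_
    rw [← mul_assoc]
    gcongr
    exact hA.le_abs (νF_nonneg D hΩ F) (M.hF_pos hd F) _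
  have hadv : M.advEnergy D T v ≤ 4 * C ^ 4 * (M.βc D T / M.hT T * V) := by
    have h1 := advEnergy_le D H hd hΩ T v
    have h2 : M.hT T * M.βc D T * I ≤ C * (M.βc D T / M.hT T * V) := by
      calc _ ≤ M.hT T * M.βc D T * (C * V / M.hT T ^ 2) := by gcongr
        _ = _ := by field_simp
    have h3 : 2 * C ^ 2 * M.fluxSq D T v ≤ 2 * C ^ 2 * (C ^ 2 * (M.βc D T / M.hT T * V)) := by
      gcongr
    have h4 : C * (M.βc D T / M.hT T * V) ≤ C ^ 4 * (M.βc D T / M.hT T * V) := by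
      gcongr
      exact le_self_pow₀ hC (by norm_num)
    calc _ ≤ _ := h1
      _ ≤ 2 * (C ^ 4 * (M.βc D T / M.hT T * V)) + 2 * C ^ 2 * (C ^ 2 * (M.βc D T / M.hT T * V)) := by
        linarith
      _ = _ := by ring
  have q1 : 0 ≤ M.νT D T / M.hT T ^ 2 * V := by positivity
  have q2 : 0 ≤ (M.τc D T)⁻¹ * V := by positivity
  have q3 : 0 ≤ M.βc D T / M.hT T * V := by positivity
  have k7 : 1 ≤ C ^ 7 := one_le_pow₀ hC
  have k27 : C ^ 2 ≤ C ^ 7 := pow_le_pow_right₀ hC (by norm_num)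
  have k47 : C ^ 4 ≤ C ^ 7 := pow_le_pow_right₀ hC (by norm_num)
  have ka : C ^ 7 ≤ a * C ^ 7 := le_mul_of_one_le_left (by positivity) ha
  have r1 : 16 * C ^ 7 * (M.νT D T / M.hT T ^ 2 * V) ≤
      16 * a * C ^ 7 * (M.νT D T / M.hT T ^ 2 * V) := by gcongr; linarith
  have r2 : (M.τc D T)⁻¹ * V ≤ 16 * a * C ^ 7 * ((M.τc D T)⁻¹ * V) :=
    le_mul_of_one_le_left q2 (by linarith)
  have r3 : 1 / 2 * (a * (C ^ 2 * (M.βc D T / M.hT T * V))) + 4 * C ^ 4 * (M.βc D T / M.hT T * V) ≤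
      16 * a * C ^ 7 * (M.βc D T / M.hT T * V) := by
    have e1 : a * C ^ 2 ≤ a * C ^ 7 := by gcongr
    have : 1 / 2 * (a * C ^ 2) + 4 * C ^ 4 ≤ 16 * a * C ^ 7 := by linarith
    calc _ = (1 / 2 * (a * C ^ 2) + 4 * C ^ 4) * (M.βc D T / M.hT T * V) := by ring
      _ ≤ _ := by gcongr
  have hup' : ∑ F ∈ M.facesOf T, M.upwindSq D A T F v ≤ a * (C ^ 2 * (M.βc D T / M.hT T * V)) :=
    hup.trans (by gcongr)
  rw [cellEnergy, frequency]
  calc _ ≤ 16 * C ^ 7 * (M.νT D T / M.hT T ^ 2 * V) +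
        1 / 2 * (a * (C ^ 2 * (M.βc D T / M.hT T * V))) + (M.τc D T)⁻¹ * V +
        4 * C ^ 4 * (M.βc D T / M.hT T * V) := by gcongr
    _ ≤ _ := by linarith

variable (M) in
/-- The cells in which advection dominates both diffusion and reaction, that is, in which
`β_c / h_T` exceeds `ν_T / h_T ^ 2` and `τ_c⁻¹`. -/
def IsAdvective (T : M.Cell) : Prop :=
  M.νT D T < M.hT T * M.βc D T ∧ M.hT T * (M.τc D T)⁻¹ < M.βc D T

/-- In a cell where diffusion or reaction dominates, the `♭`-norm already controls the advective
derivative: the gradient is bounded by the diffusive energy in the first case, and by the inverse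
inequality and the reactive term in the second. -/
theorem advEnergy_le_cellEnergy (H : M.LocalBounds (k + 1) C) (hA : UpwindBounds A a)
    (hd : 1 ≤ d) (hΩ : IsPolytope Ω) {T : M.Cell} (hT' : ¬ M.IsAdvective D T) (v : M.Dof k) :
    M.advEnergy D T v ≤ 32 * a * C ^ 7 * M.cellEnergy D A T v := by
  have hC := H.one_le
  have ha := hA.one_le
  have hT := M.hT_pos hd T
  have hβ := βc_nonneg D T
  obtain ⟨t1, t2, t3⟩ := cellEnergy_terms D hA hd hΩ T v
  have hvm := polyFun_mono (Nat.le_succ k) (M.cellPart_mem v T)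
  have h1 := advEnergy_le D H hd hΩ T v
  have h2 := fluxSq_le D H hA hd hΩ T v
  set I := ∫ x in T.1, ‖gradient (M.cellPart v T) x‖ ^ 2 with hI
  have hI0 : 0 ≤ I := integral_norm_gradient_sq_nonneg _ _
  set V := ∫ x in T.1, M.cellPart v T x ^ 2 with hV
  have hV0 : 0 ≤ V := integral_cellPart_sq_nonneg T v
  have k5 : C ≤ 8 * C ^ 5 := by
    have : C ≤ C ^ 5 := le_self_pow₀ hC (by norm_num)
    have : 0 ≤ C ^ 5 := by positivity
    linarith
  have hE0 : 0 ≤ M.cellEnergy D A T v := by rw [cellEnergy]; linarith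
  have h3 : M.hT T * M.βc D T * I ≤ 8 * C ^ 5 * M.cellEnergy D A T v := by
    by_cases hν : M.νT D T < M.hT T * M.βc D T
    · have hτ : M.βc D T ≤ M.hT T * (M.τc D T)⁻¹ := not_lt.1 fun h => hT' ⟨hν, h⟩
      have e1 : M.hT T ^ 2 * I ≤ C * V := H.inverse T hvm
      calc M.hT T * M.βc D T * I ≤ M.hT T * (M.hT T * (M.τc D T)⁻¹) * I := by gcongr
        _ = (M.τc D T)⁻¹ * (M.hT T ^ 2 * I) := by ring
        _ ≤ (M.τc D T)⁻¹ * (C * V) := by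
          gcongr
          exact (τc_inv_pos D hΩ T).le
        _ = C * ((M.τc D T)⁻¹ * V) := by ring
        _ ≤ C * M.cellEnergy D A T v := by
          gcongr
          rw [cellEnergy]
          linarith
        _ ≤ _ := by gcongr
    · have e1 : I ≤ M.dofEnergy T v := le_add_of_nonneg_right (Finset.sum_nonneg fun F _ =>
        mul_nonneg (inv_nonneg.2 (M.hF_pos hd F).le) (jumpSq_nonneg T F v))
      have hν0 := νT_nonneg D hΩ T
      calc M.hT T * M.βc D T * I ≤ M.νT D T * (8 * C ^ 5 * M.potEnergy T v) := by
            gcongr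
            · exact not_lt.1 hν
            · exact e1.trans (H.energy_equiv hd T v).1
        _ = 8 * C ^ 5 * M.aνT D T v v := by rw [aνT_self]; ring
        _ ≤ _ := by
          gcongr
          rw [cellEnergy]
          linarith
  calc _ ≤ 2 * (8 * C ^ 5 * M.cellEnergy D A T v) +
        2 * C ^ 2 * (8 * a * C ^ 5 * M.cellEnergy D A T v) := h1.trans (by gcongr)
    _ = (16 * C ^ 5 + 16 * (a * C ^ 7)) * M.cellEnergy D A T v := by ring
    _ ≤ (32 * a * C ^ 7) * M.cellEnergy D A T v := by
      gcongr
      have : C ^ 5 ≤ C ^ 7 := pow_le_pow_right₀ hC (by norm_num)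
      have : C ^ 7 ≤ a * C ^ 7 := le_mul_of_one_le_left (by positivity) ha
      linarith

theorem faceCoef_plusPart_abs_le (hA : UpwindBounds A a) (hd : 1 ≤ d) (hΩ : IsPolytope Ω)
    (T : M.Cell) (F : M.Face) (x : E d) :
    |M.faceCoef D (plusPart A) (plusPart abs) T F x| ≤ a * |M.bn D T F x| := by
  have ha := hA.one_le
  have h0 : 0 ≤ M.faceCoef D A abs T F x := hA.nonneg (νF_nonneg D hΩ F) (M.hF_pos hd F) _
  have h1 : M.faceCoef D A abs T F x ≤ a * |M.bn D T F x| :=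
    hA.le_abs (νF_nonneg D hΩ F) (M.hF_pos hd F) _
  have h2 : |M.bn D T F x| ≤ a * |M.bn D T F x| := le_mul_of_one_le_left (abs_nonneg _) ha
  rw [faceCoef_plusPart D hd, abs_div, abs_of_pos (zero_lt_two' ℝ), div_le_iff₀ two_pos]
  have := abs_add_le (M.faceCoef D A abs T F x) (M.bn D T F x)
  rw [abs_of_nonneg h0] at this
  linarith

theorem abs_integral_μ_le (hΩ : IsPolytope Ω) (T : M.Cell) (w v : M.Dof k) {t : ℝ} (ht : 0 < t) :
    |∫ x in T.1, D.μ x * M.cellPart w T x * M.cellPart v T x| ≤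
      t * ((M.τc D T)⁻¹ * ∫ x in T.1, M.cellPart w T x ^ 2) +
        (4 * t)⁻¹ * ((M.τc D T)⁻¹ * ∫ x in T.1, M.cellPart v T x ^ 2) := by
  have := abs_setIntegral_le_of_young_ae (m := volume) (s := T.1)
    (u := fun x => D.μ x * M.cellPart w T x * M.cellPart v T x)
    (f := fun x => M.cellPart w T x ^ 2) (g := fun x => M.cellPart v T x ^ 2)
    (a := t * (M.τc D T)⁻¹) (b := (4 * t)⁻¹ * (M.τc D T)⁻¹)
    (M.integrableOn_cell T (by fun_prop)) (M.integrableOn_cell T (by fun_prop)) (by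
      filter_upwards [ae_abs_μ_le D hΩ T] with x hx
      rw [mul_assoc, abs_mul]
      calc _ ≤ (M.τc D T)⁻¹ * (t * M.cellPart w T x ^ 2 + (4 * t)⁻¹ * M.cellPart v T x ^ 2) :=
            mul_le_mul hx (abs_mul_le_young ht _ _) (abs_nonneg _) (τc_inv_pos D hΩ T).le
        _ = _ := by ring)
  linarith

/-- The terms of `a_h` other than the advective derivative, for a test function which vanishes on
the faces, are controlled by the `♭`-norm of `w` and the values of the test function in the cells. -/
theorem abs_remainder_le (H : M.LocalBounds (k + 1) C) (hA : UpwindBounds A a)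
    (hd : 1 ≤ d) (hΩ : IsPolytope Ω) (T : M.Cell) (w : M.Dof k) {v : M.Dof k}
    (hv : ∀ F, M.facePart v F = 0) {t : ℝ} (ht : 0 < t) :
    |M.aνT D T w v + (∫ x in T.1, D.μ x * M.cellPart w T x * M.cellPart v T x) -
      ∑ F ∈ M.facesOf T, ∫ x in F.1, M.faceCoef D (plusPart A) (plusPart abs) T F x *
        (M.facePart w F x - M.cellPart w T x) * M.cellPart v T x ∂μHE[d - 1]| ≤
    16 * a ^ 2 * C ^ 7 * (t * M.cellEnergy D A T w +
      t⁻¹ * (M.frequency D T * ∫ x in T.1, M.cellPart v T x ^ 2)) := by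
  have hC := H.one_le
  have ha := hA.one_le
  have hT := M.hT_pos hd T
  have hβ := βc_nonneg D T
  have hν := νT_nonneg D hΩ T
  have hτ := τc_inv_pos D hΩ T
  have b1 := abs_aνT_le D hd hΩ T w v ht
  have b2 := abs_integral_μ_le D hΩ T w v ht
  have b3 := abs_flux_le D H hd T w (M.cellPart_mem v T) (by linarith : 0 ≤ a)
    (fun F _ x _ => faceCoef_plusPart_abs_le D hA hd hΩ T F x) ht
  have b4 := cellEnergy_add_advEnergy_le D H hA hd hΩ T hv
  have b5 := fluxSq_le D H hA hd hΩ T w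
  obtain ⟨s1, s2, s3⟩ := cellEnergy_terms D hA hd hΩ T v
  obtain ⟨t1, t2, t3⟩ := cellEnergy_terms D hA hd hΩ T w
  have b6 := advEnergy_nonneg D hd T v
  set V := ∫ x in T.1, M.cellPart v T x ^ 2 with hV
  have hV0 : 0 ≤ V := integral_cellPart_sq_nonneg T v
  have e1 : 0 ≤ M.νT D T / M.hT T ^ 2 * V := by positivity
  have e2 : 0 ≤ (M.τc D T)⁻¹ * V := by positivity
  have e3 : 0 ≤ M.βc D T / M.hT T * V := by positivity
  have hfV : M.frequency D T * V = M.νT D T / M.hT T ^ 2 * V + (M.τc D T)⁻¹ * V +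
      M.βc D T / M.hT T * V := by rw [frequency]; ring
  have hEw : 0 ≤ M.cellEnergy D A T w := by rw [cellEnergy]; linarith
  have hvv : M.aνT D T v v ≤ 16 * a * C ^ 7 * (M.frequency D T * V) := by
    rw [cellEnergy] at b4
    linarith
  set Λ := M.frequency D T * V
  have hΛ : 0 ≤ Λ := by linarith
  set E := M.cellEnergy D A T w
  have k7 : 1 ≤ C ^ 7 := one_le_pow₀ hC
  have k57 : C ^ 5 ≤ C ^ 7 := pow_le_pow_right₀ hC (by norm_num)
  have k27 : C ^ 2 ≤ C ^ 7 := pow_le_pow_right₀ hC (by norm_num)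
  have ka : a ≤ a ^ 2 := le_self_pow₀ ha (by norm_num)
  have ka1 : 1 ≤ a ^ 2 := ha.trans ka
  have hinv : (4 * t)⁻¹ = 1 / 4 * t⁻¹ := by rw [mul_inv]; ring
  have hti : 0 < t⁻¹ := inv_pos.2 ht
  -- the diffusive and reactive contributions of `w`
  have c1 : t * M.aνT D T w w + t * ((M.τc D T)⁻¹ * ∫ x in T.1, M.cellPart w T x ^ 2) ≤ t * E := by
    rw [← mul_add]
    gcongr
    simp only [E, cellEnergy]
    linarith
  have c2 : a * (t * M.fluxSq D T w) ≤ t * (8 * a ^ 2 * C ^ 5 * E) := by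
    calc _ ≤ a * (t * (8 * a * C ^ 5 * E)) := by gcongr
      _ = _ := by ring
  have c3 : (4 * t)⁻¹ * M.aνT D T v v ≤ t⁻¹ * (4 * a ^ 2 * C ^ 7 * Λ) := by
    rw [hinv]
    calc _ ≤ 1 / 4 * t⁻¹ * (16 * a * C ^ 7 * Λ) := by gcongr
      _ = t⁻¹ * (4 * a * C ^ 7 * Λ) := by ring
      _ ≤ _ := by gcongr
  have c4 : (4 * t)⁻¹ * ((M.τc D T)⁻¹ * V) ≤ t⁻¹ * Λ := by
    rw [hinv]
    calc _ ≤ 1 / 4 * t⁻¹ * Λ := by gcongr; linarith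
      _ ≤ _ := by nlinarith [mul_nonneg hti.le hΛ]
  have c5 : a * ((4 * t)⁻¹ * (C ^ 2 * (M.βc D T / M.hT T) * V)) ≤ t⁻¹ * (a ^ 2 * C ^ 7 * Λ) := by
    rw [hinv]
    calc _ = 1 / 4 * t⁻¹ * (a * C ^ 2 * (M.βc D T / M.hT T * V)) := by ring
      _ ≤ 1 / 4 * t⁻¹ * (a ^ 2 * C ^ 7 * Λ) := by gcongr; linarith
      _ ≤ _ := by
        have : 0 ≤ t⁻¹ * (a ^ 2 * C ^ 7 * Λ) := by positivity
        linarith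
  have hfin1 : t * E + t * (8 * a ^ 2 * C ^ 5 * E) ≤ 16 * a ^ 2 * C ^ 7 * (t * E) := by
    have : 1 + 8 * a ^ 2 * C ^ 5 ≤ 16 * a ^ 2 * C ^ 7 := by
      have e1 : a ^ 2 * C ^ 5 ≤ a ^ 2 * C ^ 7 := by gcongr
      have e2 : 1 ≤ a ^ 2 * C ^ 7 := one_le_mul_of_one_le_of_one_le ka1 k7
      linarith
    calc _ = (1 + 8 * a ^ 2 * C ^ 5) * (t * E) := by ring
      _ ≤ _ := by gcongr
  have hfin2 : t⁻¹ * (4 * a ^ 2 * C ^ 7 * Λ) + t⁻¹ * Λ + t⁻¹ * (a ^ 2 * C ^ 7 * Λ) ≤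
      16 * a ^ 2 * C ^ 7 * (t⁻¹ * Λ) := by
    have e2 : 1 ≤ a ^ 2 * C ^ 7 := one_le_mul_of_one_le_of_one_le ka1 k7
    have : 5 * (a ^ 2 * C ^ 7) + 1 ≤ 16 * a ^ 2 * C ^ 7 := by linarith
    calc _ = (5 * (a ^ 2 * C ^ 7) + 1) * (t⁻¹ * Λ) := by ring
      _ ≤ _ := by gcongr
  refine (abs_sub _ _).trans ((add_le_add_left (abs_add_le _ _) _).trans ?_)
  linarith

end Mesh

/-! ### Coercivity -/

/-- Optimizing the weight in a family of Young inequalities. -/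
theorem sq_le_mul_of_young {x P Q : ℝ} (hP : 0 ≤ P) (hQ : 0 ≤ Q)
    (h : ∀ t : ℝ, 0 < t → |x| ≤ t * P + (4 * t)⁻¹ * Q) : x ^ 2 ≤ P * Q := by
  have h1 : ∀ t : ℝ, 0 ≤ 4 * P * (t * t) + -(4 * |x|) * t + Q := by
    intro t
    rcases le_or_gt t 0 with ht | ht
    · nlinarith [mul_nonneg hP (mul_self_nonneg t), mul_nonneg (abs_nonneg x) (neg_nonneg.2 ht)]
    · have h2 := mul_le_mul_of_nonneg_left (h t ht) (by positivity : 0 ≤ 4 * t)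
      have h3 : 4 * t * (t * P + (4 * t)⁻¹ * Q) = 4 * P * (t * t) + Q := by field_simp
      linarith
  have := discrim_le_zero h1
  rw [discrim, neg_sq, mul_pow, sq_abs] at this
  linarith

theorem abs_le_young_of_sq_le {x P Q t : ℝ} (hP : 0 ≤ P) (hQ : 0 ≤ Q) (h : x ^ 2 ≤ P * Q)
    (ht : 0 < t) : |x| ≤ t * P + (4 * t)⁻¹ * Q := by
  refine abs_le_of_sq_le_sq (h.trans ?_) (by positivity)
  have : (t * P + (4 * t)⁻¹ * Q) ^ 2 - P * Q = (t * P - (4 * t)⁻¹ * Q) ^ 2 := by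
    field_simp
    ring
  linarith [sq_nonneg (t * P - (4 * t)⁻¹ * Q)]

/-- The Cauchy–Schwarz inequality. -/
theorem sq_setIntegral_mul_le {d : ℕ} {m : Measure (E d)} {s : Set (E d)} (hs : MeasurableSet s)
    {f g : E d → ℝ} (hf : IntegrableOn (fun x => f x ^ 2) s m)
    (hg : IntegrableOn (fun x => g x ^ 2) s m) :
    (∫ x in s, f x * g x ∂m) ^ 2 ≤ (∫ x in s, f x ^ 2 ∂m) * ∫ x in s, g x ^ 2 ∂m :=
  sq_le_mul_of_young (integral_nonneg fun _ => sq_nonneg _) (integral_nonneg fun _ => sq_nonneg _)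
    fun _ ht => abs_setIntegral_le_of_young hs hf hg fun _ _ => abs_mul_le_young ht _ _

namespace Mesh

variable {d : ℕ} {Ω : Set (E d)} {M : Mesh Ω} {k : ℕ} {A : ℝ → ℝ} {a C : ℝ}

/-- The constant `C_tr`, defined as an infimum, satisfies the trace inequality. The set over which
the infimum is taken is nonempty by the trace inequality in `LocalBounds`. -/
theorem traceConst_spec (H : M.LocalBounds k C) (hd : 1 ≤ d) {T : M.Cell} {F : M.Face}
    (hF : F ∈ M.facesOf T) {q : E d → ℝ} (hq : q ∈ polyFun d k) :
    ∫ x in F.1, q x ^ 2 ∂μHE[d - 1] ≤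
      M.traceConst k ^ 2 * (M.hF F)⁻¹ * ∫ x in T.1, q x ^ 2 := by
  have hC := H.one_le
  set 𝒞 := {C : ℝ | 0 ≤ C ∧ ∀ T : M.Cell, ∀ F ∈ M.facesOf T, ∀ v ∈ polyFun d k,
    √(∫ x in F.1, v x ^ 2 ∂μHE[d - 1]) ≤ C * (√(M.hF F))⁻¹ * √(∫ x in T.1, v x ^ 2)} with h𝒞
  have hne : 𝒞.Nonempty := by
    refine ⟨√C, Real.sqrt_nonneg _, fun T F hF v hv => ?_⟩
    have hF0 := M.hF_pos hd F
    rw [← Real.sqrt_inv, ← Real.sqrt_mul (by positivity), ← Real.sqrt_mul (by positivity)]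
    refine Real.sqrt_le_sqrt ?_
    rw [mul_right_comm, ← div_eq_mul_inv, le_div_iff₀ hF0, mul_comm]
    exact (mul_le_mul_of_nonneg_right (hF_le_hT hF) (integral_nonneg fun _ => sq_nonneg _)).trans
      (H.trace hF hv)
  have hF0 := M.hF_pos hd F
  have h0 : 0 ≤ M.traceConst k := le_csInf hne fun c hc => hc.1
  set X := ∫ x in F.1, q x ^ 2 ∂μHE[d - 1]
  set Y := ∫ x in T.1, q x ^ 2
  have hX : 0 ≤ X := integral_nonneg fun _ => sq_nonneg _
  have hY : 0 ≤ Y := integral_nonneg fun _ => sq_nonneg _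
  -- the infimum in the definition of the constant is attained
  have h1 : √X ≤ M.traceConst k * ((√(M.hF F))⁻¹ * √Y) := by
    rcases (by positivity : 0 ≤ (√(M.hF F))⁻¹ * √Y).eq_or_lt with hz | hz
    · obtain ⟨c, hc⟩ := hne
      have := hc.2 T F hF q hq
      rw [mul_assoc, ← hz, mul_zero] at this
      rwa [← hz, mul_zero]
    · rw [← div_le_iff₀ hz]
      refine le_csInf hne fun c hc => ?_
      rw [div_le_iff₀ hz, ← mul_assoc]
      exact hc.2 T F hF q hq
  calc X = √X ^ 2 := (Real.sq_sqrt hX).symm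
    _ ≤ (M.traceConst k * ((√(M.hF F))⁻¹ * √Y)) ^ 2 := by gcongr
    _ = M.traceConst k ^ 2 * (M.hF F)⁻¹ * Y := by
      rw [mul_pow, mul_pow, inv_pow, Real.sq_sqrt hF0.le, Real.sq_sqrt hY, mul_assoc]

variable (D : Coeffs Ω)

/-- The boundary flux of the reconstruction. Its normal derivative is a polynomial of degree at
most `k`, so that the trace inequality with the constant `C_tr` applies. -/
theorem sq_bdryFlux_le (H : M.LocalBounds k C) (hd : 1 ≤ d) {T : M.Cell} {F : M.Face}
    (hF : F ∈ M.facesOf T) (w v : M.Dof k) :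
    (∫ x in F.1, ⟪gradient (M.potRec T w : E d → ℝ) x, M.nrm T F⟫ *
        M.facePart v F x ∂μHE[d - 1]) ^ 2 ≤
      (M.traceConst k ^ 2 * (M.hF F)⁻¹ * ∫ x in F.1, M.facePart v F x ^ 2 ∂μHE[d - 1]) *
        ∫ x in T.1, ‖gradient (M.potRec T w : E d → ℝ) x‖ ^ 2 := by
  have hF0 := M.hF_pos hd F
  have hm : (fun x => ⟪gradient (M.potRec T w : E d → ℝ) x, M.nrm T F⟫) ∈ polyFun d k := by
    simp only [inner_gradient]
    exact fderiv_mem_polyFun (M.potRec T w).2 _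
  have h1 := traceConst_spec H hd hF hm
  have h2 : ∫ x in T.1, ⟪gradient (M.potRec T w : E d → ℝ) x, M.nrm T F⟫ ^ 2 ≤
      ∫ x in T.1, ‖gradient (M.potRec T w : E d → ℝ) x‖ ^ 2 := by
    refine integral_mono (M.integrableOn_cell T (by fun_prop)) (M.integrableOn_cell T (by fun_prop))
      fun x => ?_
    simp only
    rw [sq_le_sq, abs_norm]
    simpa [norm_nrm hF] using
      abs_real_inner_le_norm (gradient (M.potRec T w : E d → ℝ) x) (M.nrm T F)
  have hv0 : 0 ≤ ∫ x in F.1, M.facePart v F x ^ 2 ∂μHE[d - 1] := integral_nonneg fun _ => sq_nonneg _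
  have h3 := sq_setIntegral_mul_le (m := μHE[d - 1]) (M.measurableSet_face F)
    (f := fun x => ⟪gradient (M.potRec T w : E d → ℝ) x, M.nrm T F⟫) (g := M.facePart v F)
    (M.integrableOn_face F (by fun_prop)) (M.integrableOn_face F (by fun_prop))
  calc _ ≤ _ := h3
    _ ≤ (M.traceConst k ^ 2 * (M.hF F)⁻¹ *
        ∫ x in T.1, ‖gradient (M.potRec T w : E d → ℝ) x‖ ^ 2) *
        ∫ x in F.1, M.facePart v F x ^ 2 ∂μHE[d - 1] := by
      gcongr
      exact h1.trans (by gcongr)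
    _ = _ := by ring

variable (M) in
/-- The contribution of the boundary faces to the square of the `♭`-norm. -/
noncomputable def bdryEnergy (A : ℝ → ℝ) (v : M.Dof k) : ℝ :=
  ∑ T : M.Cell, ∑ F ∈ M.bdryFacesOf T,
    (M.νF D F / M.hF F * (∫ x in F.1, M.facePart v F x ^ 2 ∂μHE[d - 1]) +
      1 / 2 * ∫ x in F.1, M.faceCoef D A abs T F x * M.facePart v F x ^ 2 ∂μHE[d - 1])

theorem cellEnergy_nonneg (hA : UpwindBounds A a) (hd : 1 ≤ d) (hΩ : IsPolytope Ω) (T : M.Cell)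
    (v : M.Dof k) : 0 ≤ M.cellEnergy D A T v := by
  obtain ⟨t1, t2, t3⟩ := cellEnergy_terms D hA hd hΩ T v
  rw [cellEnergy]
  linarith

theorem bdryEnergy_terms (hA : UpwindBounds A a) (hd : 1 ≤ d) (hΩ : IsPolytope Ω) (T : M.Cell)
    (F : M.Face) (v : M.Dof k) :
    0 ≤ M.νF D F / M.hF F * (∫ x in F.1, M.facePart v F x ^ 2 ∂μHE[d - 1]) ∧
    0 ≤ ∫ x in F.1, M.faceCoef D A abs T F x * M.facePart v F x ^ 2 ∂μHE[d - 1] :=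
  ⟨mul_nonneg (div_nonneg (νF_nonneg D hΩ F) (M.hF_pos hd F).le)
    (integral_nonneg fun _ => sq_nonneg _),
    integral_nonneg fun _ => mul_nonneg (hA.nonneg (νF_nonneg D hΩ F) (M.hF_pos hd F) _)
      (sq_nonneg _)⟩

theorem bdryEnergy_nonneg (hA : UpwindBounds A a) (hd : 1 ≤ d) (hΩ : IsPolytope Ω)
    (v : M.Dof k) : 0 ≤ M.bdryEnergy D A v :=
  Finset.sum_nonneg fun T _ => Finset.sum_nonneg fun F _ => by
    obtain ⟨h1, h2⟩ := bdryEnergy_terms D hA hd hΩ T F v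
    linarith

theorem flatNorm_sq (hA : UpwindBounds A a) (hd : 1 ≤ d) (hΩ : IsPolytope Ω) (v : M.Dof k) :
    M.flatNorm D A v ^ 2 = (∑ T : M.Cell, M.cellEnergy D A T v) + M.bdryEnergy D A v := by
  have h : M.normνSq D v + M.normβμSq D A v
      = (∑ T : M.Cell, M.cellEnergy D A T v) + M.bdryEnergy D A v := by
    simp only [normνSq, normβμSq, cellEnergy, bdryEnergy, upwindSq, Finset.sum_add_distrib,
      Finset.mul_sum]
    ring
  rw [flatNorm, Real.sq_sqrt, h]
  rw [h]
  exact add_nonneg (Finset.sum_nonneg fun T _ => cellEnergy_nonneg D hA hd hΩ T v)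
    (bdryEnergy_nonneg D hA hd hΩ v)

theorem sharpNorm_sq (hd : 1 ≤ d) (v : M.Dof k) :
    M.sharpNorm D A v ^ 2 = M.flatNorm D A v ^ 2 + ∑ T : M.Cell, M.advEnergy D T v := by
  classical
  have h : ∑ T : M.Cell with M.βc D T ≠ 0,
      M.hT T * (M.βc D T)⁻¹ * ∫ x in T.1, (M.advRec D.β T v : E d → ℝ) x ^ 2
      = ∑ T : M.Cell, M.advEnergy D T v := by
    rw [Finset.sum_filter]
    refine Finset.sum_congr rfl fun T _ => ?_
    rw [advEnergy]
    by_cases h : M.βc D T = 0 <;> simp [h]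
  rw [sharpNorm, Real.sq_sqrt]
  · congr 1
  · refine add_nonneg (sq_nonneg _) (Finset.sum_nonneg fun T _ => ?_)
    have := βc_nonneg D T
    have := M.hT_pos hd T
    have := integral_advRec_sq_nonneg D T v
    positivity

/-- The energy identity of the advective terms in a cell. -/
theorem advective_identity (hA : UpwindBounds A a) (hd : 1 ≤ d) (hΩ : IsPolytope Ω) (T : M.Cell)
    (v : M.Dof k) :
    -(∫ x in T.1, M.cellPart v T x * (M.advRec D.β T v : E d → ℝ) x) + M.sMinusT D A T v v =
      1 / 2 * (∑ F ∈ M.facesOf T, M.upwindSq D A T F v) -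
        1 / 2 * ∑ F ∈ M.facesOf T,
          ∫ x in F.1, M.bn D T F x * M.facePart v F x ^ 2 ∂μHE[d - 1] := by
  -- adding the two forms of the advective derivative cancels the volume terms
  have h1 := integral_advRec_mul D hΩ T v (M.cellPart_mem v T)
  have h2 := M.advRec_spec D T v _ (M.cellPart_mem v T)
  have h3 : ∫ x in T.1, M.cellPart v T x * (M.advRec D.β T v : E d → ℝ) x =
      ∫ x in T.1, (M.advRec D.β T v : E d → ℝ) x * M.cellPart v T x := by simp only [mul_comm]
  have h4 : ∫ x in T.1, M.cellPart v T x * ⟪D.β x, gradient (M.cellPart v T) x⟫ =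
      ∫ x in T.1, ⟪D.β x, gradient (M.cellPart v T) x⟫ * M.cellPart v T x := by
    simp only [mul_comm]
  rw [advRhs, h4] at h2
  have h5 : 2 * M.sMinusT D A T v v =
      (∑ F ∈ M.facesOf T, M.upwindSq D A T F v) -
      (∑ F ∈ M.facesOf T, ∫ x in F.1, M.bn D T F x * M.facePart v F x ^ 2 ∂μHE[d - 1]) +
      (∑ F ∈ M.facesOf T, ∫ x in F.1,
        M.bn D T F x * (M.facePart v F x - M.cellPart v T x) * M.cellPart v T x ∂μHE[d - 1]) +
      ∑ F ∈ M.facesOf T, ∫ x in F.1,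
        ⟪D.β x, M.nrm T F⟫ * M.facePart v F x * M.cellPart v T x ∂μHE[d - 1] := by
    rw [sMinusT, Finset.mul_sum, ← Finset.sum_sub_distrib, ← Finset.sum_add_distrib,
      ← Finset.sum_add_distrib]
    refine Finset.sum_congr rfl fun F _ => ?_
    have c1 := continuousOn_faceCoef D hA T F
    have c2 := M.continuousOn_β_face D F
    rw [upwindSq, ← integral_const_mul,
      ← integral_sub (M.integrableOn_face F (by fun_prop)) (M.integrableOn_face F (by fun_prop)),
      ← integral_add (M.integrableOn_face F (by fun_prop)) (M.integrableOn_face F (by fun_prop)),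
      ← integral_add (M.integrableOn_face F (by fun_prop)) (M.integrableOn_face F (by fun_prop))]
    congr 1
    ext x
    rw [faceCoef_minusPart D hd, bn]
    ring
  linarith

theorem integral_μ_ge (hΩ : IsPolytope Ω) (T : M.Cell) (v : M.Dof k) :
    M.ζ D * ((M.τc D T)⁻¹ * ∫ x in T.1, M.cellPart v T x ^ 2) ≤
      ∫ x in T.1, D.μ x * M.cellPart v T x * M.cellPart v T x := by
  have h0 := integral_cellPart_sq_nonneg T v
  calc _ = M.ζ D * (M.τc D T)⁻¹ * ∫ x in T.1, M.cellPart v T x ^ 2 := by ring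
    _ ≤ D.μ₀ * ∫ x in T.1, M.cellPart v T x ^ 2 := by
      gcongr
      exact (ζ_bounds D hΩ).2.2 T
    _ = ∫ x in T.1, D.μ₀ * M.cellPart v T x ^ 2 := (integral_const_mul _ _).symm
    _ ≤ ∫ x in T.1, D.μ x * M.cellPart v T x ^ 2 := by
      refine integral_mono_ae (M.integrableOn_cell T (by fun_prop))
        (integrableOn_μ_mul D hΩ T (by fun_prop)) ?_
      filter_upwards [ae_cell hΩ D.μ_ge T] with x hx
      gcongr
    _ = _ := by
      congr 1
      ext x
      ring

/-- The penalty absorbs the boundary flux: coercivity of the diffusion form. A cell has at most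
`N_∂` boundary faces, so that each of them may use the part `1 / (2 N_∂)` of its energy. -/
theorem aν_ge (H : M.LocalBounds k C) (hd : 1 ≤ d) (hΩ : IsPolytope Ω) {ς : ℝ}
    (hς : 1 + M.traceConst k ^ 2 * (M.maxFaces : ℝ) / 2 ≤ ς) (v : M.Dof k) :
    1 / 2 * (∑ T : M.Cell, M.aνT D T v v) + (∑ T : M.Cell, ∑ F ∈ M.bdryFacesOf T,
      M.νF D F / M.hF F * ∫ x in F.1, M.facePart v F x ^ 2 ∂μHE[d - 1]) ≤ M.aν D ς v v := by
  rw [aν, Finset.mul_sum, ← Finset.sum_add_distrib, ← Finset.sum_add_distrib]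
  refine Finset.sum_le_sum fun T _ => ?_
  set N : ℝ := (M.maxFaces : ℝ) with hN
  set Q := ∫ x in T.1, ‖gradient (M.potRec T v : E d → ℝ) x‖ ^ 2 with hQ
  have hQ0 : 0 ≤ Q := integral_norm_gradient_sq_nonneg _ _
  have hν := νT_nonneg D hΩ T
  have hcard : ((M.bdryFacesOf T).card : ℝ) ≤ N := by
    have h1 : (M.bdryFacesOf T).card ≤ (M.facesOf T).card :=
      Finset.card_le_card fun F hF => ((M.mem_bdryFacesOf).1 hF).1
    have h2 : (M.facesOf T).card ≤ M.maxFaces :=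
      Finset.le_sup (f := fun T : M.Cell => (M.facesOf T).card) (Finset.mem_univ T)
    exact Nat.cast_le.2 (h1.trans h2)
  have hface : ∀ F ∈ M.bdryFacesOf T,
      M.νF D F / M.hF F * (∫ x in F.1, M.facePart v F x ^ 2 ∂μHE[d - 1]) -
        (2 * N)⁻¹ * (M.νT D T * Q) ≤
      -(∫ x in F.1, M.νF D F * ⟪gradient (M.potRec T v : E d → ℝ) x, M.nrm T F⟫ *
        M.facePart v F x ∂μHE[d - 1]) +
      ς * M.νF D F / M.hF F *
        ∫ x in F.1, M.facePart v F x * M.facePart v F x ∂μHE[d - 1] := by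
    intro F hF
    have hFT := (M.mem_bdryFacesOf.1 hF).1
    have hF0 := M.hF_pos hd F
    have hνF := νF_nonneg D hΩ F
    have hN1 : 1 ≤ N := by
      have h1 : (1 : ℝ) ≤ (M.bdryFacesOf T).card := by
        exact_mod_cast Finset.card_pos.2 ⟨F, hF⟩
      exact h1.trans hcard
    have hN0 : 0 < N := by linarith
    set V := ∫ x in F.1, M.facePart v F x ^ 2 ∂μHE[d - 1] with hV
    have hV0 : 0 ≤ V := integral_nonneg fun _ => sq_nonneg _
    have h1 := sq_bdryFlux_le H hd hFT v v
    have h2 := abs_le_young_of_sq_le (by positivity) hQ0 h1 (half_pos hN0)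
    have h3 : (4 * (N / 2))⁻¹ = (2 * N)⁻¹ := by congr 1; ring
    rw [h3] at h2
    have h4 := mul_le_mul_of_nonneg_left ((le_abs_self _).trans h2) hνF
    simp only [mul_assoc (M.νF D F), integral_const_mul, ← sq]
    have h5 : M.νF D F * ((2 * N)⁻¹ * Q) ≤ M.νT D T * ((2 * N)⁻¹ * Q) := by
      gcongr
      exact νF_le_νT D hFT
    have h6 := mul_le_mul_of_nonneg_right hς (by positivity : 0 ≤ M.νF D F / M.hF F * V)
    have h7 : M.νF D F * (N / 2 * (M.traceConst k ^ 2 * (M.hF F)⁻¹ * V)) =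
        M.traceConst k ^ 2 * N / 2 * (M.νF D F / M.hF F * V) := by ring
    have h8 : ς * M.νF D F / M.hF F * V = ς * (M.νF D F / M.hF F * V) := by ring
    rw [h8]
    linarith
  have hsum := Finset.sum_le_sum hface
  rw [Finset.sum_sub_distrib, Finset.sum_const, nsmul_eq_mul] at hsum
  have h9 : ((M.bdryFacesOf T).card : ℝ) * ((2 * N)⁻¹ * (M.νT D T * Q)) ≤
      1 / 2 * (M.νT D T * Q) := by
    rcases (Nat.cast_nonneg M.maxFaces : (0 : ℝ) ≤ N).eq_or_lt with h0 | h0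
    · have : ((M.bdryFacesOf T).card : ℝ) = 0 := le_antisymm (hcard.trans h0.symm.le) (by positivity)
      rw [this, zero_mul]
      positivity
    · have hN' : N ≠ 0 := h0.ne'
      calc _ ≤ N * ((2 * N)⁻¹ * (M.νT D T * Q)) := by gcongr
        _ = _ := by field_simp
  have h10 : M.νT D T * Q ≤ M.aνT D T v v := by
    rw [aνT_self]
    refine mul_le_mul_of_nonneg_left (le_add_of_nonneg_right (Finset.sum_nonneg fun F _ => ?_)) hν
    exact mul_nonneg (inv_nonneg.2 (M.hF_pos hd F).le) (integral_nonneg fun _ => sq_nonneg _)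
  linarith

/-- Coercivity of `a_h` in the `♭`-norm. The boundary terms of the advective identities cancel across
interfaces, and on boundary faces they combine with the terms in `A^+` to the weight `|A| / 2`. -/
theorem coercive (H : M.LocalBounds k C) (hA : UpwindBounds A a) (hd : 1 ≤ d) (hΩ : IsPolytope Ω)
    {ς : ℝ} (hς : 1 + M.traceConst k ^ 2 * (M.maxFaces : ℝ) / 2 ≤ ς) (v : M.Dof k) :
    M.ζ D * M.flatNorm D A v ^ 2 ≤ M.ah D A ς v v := by
  obtain ⟨hζ0, hζ, -⟩ := ζ_bounds (M := M) D hΩ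
  have h1 := aν_ge D H hd hΩ hς v
  have hbn := M.sum_faces_eq_sum_bdry
    (fun F n => ∫ x in F.1, ⟪D.β x, n⟫ * M.facePart v F x ^ 2 ∂μHE[d - 1])
    (fun F n => by simp only [inner_neg_right, neg_mul, integral_neg])
  have h2 : M.aβμ D A v v = (∑ T : M.Cell, (1 / 2 * (∑ F ∈ M.facesOf T, M.upwindSq D A T F v) +
      ∫ x in T.1, D.μ x * M.cellPart v T x * M.cellPart v T x)) +
      ∑ T : M.Cell, ∑ F ∈ M.bdryFacesOf T,
        1 / 2 * ∫ x in F.1, M.faceCoef D A abs T F x * M.facePart v F x ^ 2 ∂μHE[d - 1] := by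
    have e1 : ∀ T : M.Cell, M.aβμT D A T v v = (1 / 2 * (∑ F ∈ M.facesOf T, M.upwindSq D A T F v) +
        ∫ x in T.1, D.μ x * M.cellPart v T x * M.cellPart v T x) -
        1 / 2 * ∑ F ∈ M.facesOf T,
          ∫ x in F.1, ⟪D.β x, M.nrm T F⟫ * M.facePart v F x ^ 2 ∂μHE[d - 1] := by
      intro T
      have := advective_identity D hA hd hΩ T v
      simp only [bn] at this
      rw [aβμT]
      linarith
    have e2 : ∀ T : M.Cell, ∀ F : M.Face, ∫ x in F.1,
        M.faceCoef D (plusPart A) (plusPart abs) T F x * M.facePart v F x *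
          M.facePart v F x ∂μHE[d - 1] =
        1 / 2 * (∫ x in F.1, M.faceCoef D A abs T F x * M.facePart v F x ^ 2 ∂μHE[d - 1]) +
        1 / 2 * ∫ x in F.1, ⟪D.β x, M.nrm T F⟫ * M.facePart v F x ^ 2 ∂μHE[d - 1] := by
      intro T F
      have c1 := continuousOn_faceCoef D hA T F
      have c2 := M.continuousOn_β_face D F
      rw [← integral_const_mul, ← integral_const_mul,
        ← integral_add (M.integrableOn_face F (by fun_prop)) (M.integrableOn_face F (by fun_prop))]
      congr 1
      ext x
      rw [faceCoef_plusPart D hd, bn]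
      ring
    simp only [aβμ, e1, e2, Finset.sum_sub_distrib, Finset.sum_add_distrib, ← Finset.mul_sum, hbn]
    ring
  rw [flatNorm_sq D hA hd hΩ, ah, h2]
  have h3 : M.ζ D * (∑ T : M.Cell, M.cellEnergy D A T v) ≤
      1 / 2 * (∑ T : M.Cell, M.aνT D T v v) +
      ∑ T : M.Cell, (1 / 2 * (∑ F ∈ M.facesOf T, M.upwindSq D A T F v) +
      ∫ x in T.1, D.μ x * M.cellPart v T x * M.cellPart v T x) := by
    rw [Finset.mul_sum, Finset.mul_sum, ← Finset.sum_add_distrib]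
    refine Finset.sum_le_sum fun T _ => ?_
    obtain ⟨t1, t2, t3⟩ := cellEnergy_terms D hA hd hΩ T v
    have := integral_μ_ge D hΩ T v
    have s1 := mul_le_mul_of_nonneg_right hζ t1
    have s2 := mul_le_mul_of_nonneg_right hζ t2
    rw [cellEnergy]
    linarith
  have h4 : M.ζ D * M.bdryEnergy D A v ≤
      (∑ T : M.Cell, ∑ F ∈ M.bdryFacesOf T,
        M.νF D F / M.hF F * ∫ x in F.1, M.facePart v F x ^ 2 ∂μHE[d - 1]) +
      ∑ T : M.Cell, ∑ F ∈ M.bdryFacesOf T,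
        1 / 2 * ∫ x in F.1, M.faceCoef D A abs T F x * M.facePart v F x ^ 2 ∂μHE[d - 1] := by
    rw [bdryEnergy]
    simp only [Finset.mul_sum, ← Finset.sum_add_distrib]
    refine Finset.sum_le_sum fun T _ => Finset.sum_le_sum fun F _ => ?_
    obtain ⟨t1, t2⟩ := bdryEnergy_terms D hA hd hΩ T F v
    have s1 := mul_le_mul_of_nonneg_right hζ t1
    have s2 := mul_le_mul_of_nonneg_right hζ t2
    linarith
  linarith

end Mesh

/-! ### Boundedness -/

/-- A form is bounded with respect to the function `N`, which is a seminorm in the applications. -/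
def IsBoundedForm {V : Type*} (N : V → ℝ) (f : V → V → ℝ) : Prop :=
  ∃ K : ℝ, 0 ≤ K ∧ ∀ w v, |f w v| ≤ K * (N w * N v)

namespace IsBoundedForm

variable {V : Type*} {N : V → ℝ} {f g : V → V → ℝ}

theorem of_sq_le (hN : ∀ v, 0 ≤ N v) {c : ℝ} (hc : 0 ≤ c)
    (h : ∀ w v, f w v ^ 2 ≤ c * N w ^ 2 * N v ^ 2) : IsBoundedForm N f := by
  refine ⟨√c, Real.sqrt_nonneg c, fun w v => ?_⟩
  have := hN w
  have := hN v
  refine abs_le_of_sq_le_sq ((h w v).trans_eq ?_) (by positivity)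
  rw [mul_pow, Real.sq_sqrt hc]
  ring

theorem add (hf : IsBoundedForm N f) (hg : IsBoundedForm N g) :
    IsBoundedForm N fun w v => f w v + g w v := by
  obtain ⟨K, hK, hf⟩ := hf
  obtain ⟨L, hL, hg⟩ := hg
  refine ⟨K + L, by positivity, fun w v => ?_⟩
  have := abs_add_le (f w v) (g w v)
  linarith [hf w v, hg w v]

theorem neg (hf : IsBoundedForm N f) : IsBoundedForm N fun w v => -f w v := by
  obtain ⟨K, hK, hf⟩ := hf
  exact ⟨K, hK, fun w v => by rw [abs_neg]; exact hf w v⟩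

theorem sum {ι : Type*} {s : Finset ι} {F : ι → V → V → ℝ} (h : ∀ i ∈ s, IsBoundedForm N (F i)) :
    IsBoundedForm N fun w v => ∑ i ∈ s, F i w v := by
  classical
  induction s using Finset.induction_on with
  | empty => exact ⟨0, le_rfl, fun w v => by simp⟩
  | insert i s hi ih =>
    simp only [Finset.sum_insert hi]
    exact (h i (Finset.mem_insert_self i s)).add
      (ih fun j hj => h j (Finset.mem_insert_of_mem hj))

end IsBoundedForm

namespace Mesh

variable {d : ℕ} {Ω : Set (E d)} {M : Mesh Ω} {k : ℕ} {A : ℝ → ℝ} {a C : ℝ} (D : Coeffs Ω)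

theorem sharpNorm_nonneg (v : M.Dof k) : 0 ≤ M.sharpNorm D A v := Real.sqrt_nonneg _

theorem cell_le_sharpNorm_sq (hA : UpwindBounds A a) (hd : 1 ≤ d) (hΩ : IsPolytope Ω)
    (T : M.Cell) (v : M.Dof k) :
    M.cellEnergy D A T v + M.advEnergy D T v ≤ M.sharpNorm D A v ^ 2 := by
  rw [sharpNorm_sq D hd, flatNorm_sq D hA hd hΩ]
  have h1 := Finset.single_le_sum (f := fun T : M.Cell => M.cellEnergy D A T v)
    (fun T _ => cellEnergy_nonneg D hA hd hΩ T v) (Finset.mem_univ T)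
  have h2 := Finset.single_le_sum (f := fun T : M.Cell => M.advEnergy D T v)
    (fun T _ => advEnergy_nonneg D hd T v) (Finset.mem_univ T)
  have h3 := bdryEnergy_nonneg D hA hd hΩ v
  linarith

theorem bdry_le_sharpNorm_sq (hA : UpwindBounds A a) (hd : 1 ≤ d) (hΩ : IsPolytope Ω)
    {T : M.Cell} {F : M.Face} (hF : F ∈ M.bdryFacesOf T) (v : M.Dof k) :
    M.νF D F / M.hF F * (∫ x in F.1, M.facePart v F x ^ 2 ∂μHE[d - 1]) +
      1 / 2 * (∫ x in F.1, M.faceCoef D A abs T F x * M.facePart v F x ^ 2 ∂μHE[d - 1]) ≤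
    M.sharpNorm D A v ^ 2 := by
  rw [sharpNorm_sq D hd, flatNorm_sq D hA hd hΩ]
  have h0 : ∀ (T : M.Cell) (F : M.Face), 0 ≤
      M.νF D F / M.hF F * (∫ x in F.1, M.facePart v F x ^ 2 ∂μHE[d - 1]) +
      1 / 2 * (∫ x in F.1, M.faceCoef D A abs T F x * M.facePart v F x ^ 2 ∂μHE[d - 1]) := by
    intro T F
    obtain ⟨h1, h2⟩ := bdryEnergy_terms D hA hd hΩ T F v
    linarith
  have h1 : M.νF D F / M.hF F * (∫ x in F.1, M.facePart v F x ^ 2 ∂μHE[d - 1]) +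
      1 / 2 * (∫ x in F.1, M.faceCoef D A abs T F x * M.facePart v F x ^ 2 ∂μHE[d - 1]) ≤
      M.bdryEnergy D A v :=
    (Finset.single_le_sum (fun F _ => h0 T F) hF).trans
      (Finset.single_le_sum (f := fun T : M.Cell => ∑ F ∈ M.bdryFacesOf T,
        (M.νF D F / M.hF F * (∫ x in F.1, M.facePart v F x ^ 2 ∂μHE[d - 1]) +
      1 / 2 * (∫ x in F.1, M.faceCoef D A abs T F x * M.facePart v F x ^ 2 ∂μHE[d - 1])))
        (fun T _ => Finset.sum_nonneg fun F _ => h0 T F) (Finset.mem_univ T))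
  have h2 := Finset.sum_nonneg fun T (_ : T ∈ Finset.univ) => cellEnergy_nonneg D hA hd hΩ T v
  have h3 := Finset.sum_nonneg fun T (_ : T ∈ Finset.univ) => advEnergy_nonneg D hd T v
  linarith

/-- A Cauchy–Schwarz inequality on a face for weights bounded by `|β ⋅ n_TF|`. The weight
`|A|_TF + ν_F / h_F` bounds `|β ⋅ n_TF|` and is controlled by the norms. -/
theorem sq_weighted_face_le (hA : UpwindBounds A a) (hd : 1 ≤ d) (hΩ : IsPolytope Ω)
    (T : M.Cell) (F : M.Face) {c f g : E d → ℝ} (hc : ∀ x, |c x| ≤ a * |M.bn D T F x|)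
    (hf : ContinuousOn f F.1) (hg : ContinuousOn g F.1) :
    (∫ x in F.1, c x * f x * g x ∂μHE[d - 1]) ^ 2 ≤
      a ^ 4 * ((∫ x in F.1, M.faceCoef D A abs T F x * f x ^ 2 ∂μHE[d - 1]) +
        M.νF D F / M.hF F * ∫ x in F.1, f x ^ 2 ∂μHE[d - 1]) *
      ((∫ x in F.1, M.faceCoef D A abs T F x * g x ^ 2 ∂μHE[d - 1]) +
        M.νF D F / M.hF F * ∫ x in F.1, g x ^ 2 ∂μHE[d - 1]) := by
  have ha := hA.one_le
  have hν := νF_nonneg D hΩ F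
  have hF0 := M.hF_pos hd F
  have c1 := continuousOn_faceCoef D hA T F
  have hω : ∀ x, 0 ≤ M.faceCoef D A abs T F x + M.νF D F / M.hF F := fun x =>
    add_nonneg (hA.nonneg hν hF0 _) (by positivity)
  have hsplit : ∀ φ : E d → ℝ, ContinuousOn φ F.1 →
      ∫ x in F.1, (M.faceCoef D A abs T F x + M.νF D F / M.hF F) * φ x ^ 2 ∂μHE[d - 1] =
      (∫ x in F.1, M.faceCoef D A abs T F x * φ x ^ 2 ∂μHE[d - 1]) +
        M.νF D F / M.hF F * ∫ x in F.1, φ x ^ 2 ∂μHE[d - 1] := by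
    intro φ hφ
    rw [← integral_const_mul,
      ← integral_add (M.integrableOn_face F (by fun_prop)) (M.integrableOn_face F (by fun_prop))]
    simp only [add_mul]
  rw [← hsplit f hf, ← hsplit g hg]
  set P := ∫ x in F.1, (M.faceCoef D A abs T F x + M.νF D F / M.hF F) * f x ^ 2 ∂μHE[d - 1] with hP
  set Q := ∫ x in F.1, (M.faceCoef D A abs T F x + M.νF D F / M.hF F) * g x ^ 2 ∂μHE[d - 1] with hQ
  have hP0 : 0 ≤ P := integral_nonneg fun x => mul_nonneg (hω x) (sq_nonneg _)
  have hQ0 : 0 ≤ Q := integral_nonneg fun x => mul_nonneg (hω x) (sq_nonneg _)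
  have := sq_le_mul_of_young (x := ∫ x in F.1, c x * f x * g x ∂μHE[d - 1])
    (P := a ^ 2 * P) (Q := a ^ 2 * Q) (by positivity) (by positivity) fun t ht => by
      refine (abs_setIntegral_le_of_young (m := μHE[d - 1]) (M.measurableSet_face F)
        (f := fun x => (M.faceCoef D A abs T F x + M.νF D F / M.hF F) * f x ^ 2)
        (g := fun x => (M.faceCoef D A abs T F x + M.νF D F / M.hF F) * g x ^ 2)
        (a := t * a ^ 2) (b := (4 * t)⁻¹ * a ^ 2)
        (M.integrableOn_face F (by fun_prop)) (M.integrableOn_face F (by fun_prop))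
        fun x _ => ?_).trans_eq (by ring)
      have h1 : |c x| ≤ a ^ 2 * (M.faceCoef D A abs T F x + M.νF D F / M.hF F) := by
        have h2 : |M.bn D T F x| ≤ a * (M.faceCoef D A abs T F x + M.νF D F / M.hF F) :=
          hA.abs_le hν hF0 _
        calc |c x| ≤ a * |M.bn D T F x| := hc x
          _ ≤ a * (a * (M.faceCoef D A abs T F x + M.νF D F / M.hF F)) := by gcongr
          _ = _ := by ring
      rw [mul_assoc, abs_mul]
      calc _ ≤ a ^ 2 * (M.faceCoef D A abs T F x + M.νF D F / M.hF F) *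
            (t * f x ^ 2 + (4 * t)⁻¹ * g x ^ 2) :=
            mul_le_mul h1 (abs_mul_le_young ht _ _) (abs_nonneg _)
              (mul_nonneg (by positivity) (hω x))
        _ = _ := by ring
  calc _ ≤ _ := this
    _ = _ := by ring

theorem faceCoef_minusPart_abs_le (hA : UpwindBounds A a) (hd : 1 ≤ d) (hΩ : IsPolytope Ω)
    (T : M.Cell) (F : M.Face) (x : E d) :
    |M.faceCoef D (minusPart A) (minusPart abs) T F x| ≤ a * |M.bn D T F x| := by
  have ha := hA.one_le
  have h0 : 0 ≤ M.faceCoef D A abs T F x := hA.nonneg (νF_nonneg D hΩ F) (M.hF_pos hd F) _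
  have h1 : M.faceCoef D A abs T F x ≤ a * |M.bn D T F x| :=
    hA.le_abs (νF_nonneg D hΩ F) (M.hF_pos hd F) _
  have h2 : |M.bn D T F x| ≤ a * |M.bn D T F x| := le_mul_of_one_le_left (abs_nonneg _) ha
  rw [faceCoef_minusPart D hd, abs_div, abs_of_pos (zero_lt_two' ℝ), div_le_iff₀ two_pos]
  have := abs_sub (M.faceCoef D A abs T F x) (M.bn D T F x)
  rw [abs_of_nonneg h0] at this
  linarith

/-- If the velocity vanishes in a cell, so does the advective derivative. The `♯`-norm does not see
it in this case. -/
theorem integral_advRec_sq_eq_zero (hΩ : IsPolytope Ω) (T : M.Cell) (hβ : M.βc D T = 0)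
    (v : M.Dof k) : ∫ x in T.1, (M.advRec D.β T v : E d → ℝ) x ^ 2 = 0 := by
  have h0 : ∀ x ∈ closure T.1, D.β x = 0 := fun x hx =>
    norm_le_zero_iff.1 (hβ ▸ norm_β_le D T x hx)
  have h1 := integral_advRec_mul D hΩ T v (M.advRec D.β T v).2
  have h2 : ∫ x in T.1, ⟪D.β x, gradient (M.cellPart v T) x⟫ * (M.advRec D.β T v : E d → ℝ) x = 0 :=
    setIntegral_eq_zero_of_forall_eq_zero fun x hx => by
      rw [h0 x (subset_closure hx), inner_zero_left, zero_mul]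
  have h3 : ∑ F ∈ M.facesOf T, ∫ x in F.1, M.bn D T F x *
      (M.facePart v F x - M.cellPart v T x) * (M.advRec D.β T v : E d → ℝ) x ∂μHE[d - 1] = 0 :=
    Finset.sum_eq_zero fun F hF => setIntegral_eq_zero_of_forall_eq_zero fun x hx => by
      rw [bn, h0 x (M.face_subset_closure hF hx), inner_zero_left, zero_mul, zero_mul]
  rw [h2, h3, add_zero] at h1
  simpa only [sq] using h1

/-- Continuity of `a_h`, term by term; the constant may depend on the mesh and the data. -/
theorem isBoundedForm_ah (H : M.LocalBounds (k + 1) C) (hA : UpwindBounds A a) (hd : 1 ≤ d)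
    (hΩ : IsPolytope Ω) (ς : ℝ) :
    IsBoundedForm (M.sharpNorm D A) (fun w v : M.Dof k => M.ah D A ς w v) := by
  have hC := H.one_le
  have ha := hA.one_le
  have hN := sharpNorm_nonneg (M := M) (k := k) (A := A) D
  have hcell : ∀ (T : M.Cell) (v : M.Dof k), M.aνT D T v v ≤ M.sharpNorm D A v ^ 2 ∧
      (∑ F ∈ M.facesOf T, M.upwindSq D A T F v) ≤ 2 * M.sharpNorm D A v ^ 2 ∧
      (M.τc D T)⁻¹ * (∫ x in T.1, M.cellPart v T x ^ 2) ≤ M.sharpNorm D A v ^ 2 ∧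
      M.advEnergy D T v ≤ M.sharpNorm D A v ^ 2 := by
    intro T v
    have h1 := cell_le_sharpNorm_sq D hA hd hΩ T v
    have h2 := advEnergy_nonneg D hd T v
    obtain ⟨t1, t2, t3⟩ := cellEnergy_terms D hA hd hΩ T v
    rw [cellEnergy] at h1
    refine ⟨?_, ?_, ?_, ?_⟩ <;> linarith
  refine IsBoundedForm.add (IsBoundedForm.add (IsBoundedForm.sum fun T _ => ?_)
    (IsBoundedForm.sum fun T _ => IsBoundedForm.sum fun F hF =>
      IsBoundedForm.add (IsBoundedForm.neg ?_) ?_))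
    (IsBoundedForm.add (IsBoundedForm.sum fun T _ => IsBoundedForm.add (IsBoundedForm.add
      (IsBoundedForm.neg ?_) ?_) (IsBoundedForm.sum fun F hF => ?_))
      (IsBoundedForm.sum fun T _ => IsBoundedForm.sum fun F hF => ?_))
  · refine .of_sq_le hN zero_le_one fun w v => ?_
    rw [one_mul]
    exact (sq_le_mul_of_young (aνT_self_nonneg D hd hΩ T w) (aνT_self_nonneg D hd hΩ T v)
      fun t ht => abs_aνT_le D hd hΩ T w v ht).trans
      (mul_le_mul (hcell T w).1 (hcell T v).1 (aνT_self_nonneg D hd hΩ T v) (sq_nonneg _))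
  · refine .of_sq_le hN (sq_nonneg (M.traceConst k)) fun w v => ?_
    have hFT := (M.mem_bdryFacesOf.1 hF).1
    have hF0 := M.hF_pos hd F
    have hν := νF_nonneg D hΩ F
    have h1 := sq_bdryFlux_le (H.mono (Nat.le_succ k)) hd hFT w v
    have h2 := bdry_le_sharpNorm_sq D hA hd hΩ hF v
    obtain ⟨t1, t2⟩ := bdryEnergy_terms D hA hd hΩ T F v
    have h3 : M.νF D F * (∫ x in T.1, ‖gradient (M.potRec T w : E d → ℝ) x‖ ^ 2) ≤
        M.sharpNorm D A w ^ 2 := by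
      refine le_trans ?_ (hcell T w).1
      rw [aνT_self]
      refine mul_le_mul (νF_le_νT D hFT) (le_add_of_nonneg_right (Finset.sum_nonneg fun F _ => ?_))
        (integral_norm_gradient_sq_nonneg _ _) (νT_nonneg D hΩ T)
      exact mul_nonneg (inv_nonneg.2 (M.hF_pos hd F).le) (integral_nonneg fun _ => sq_nonneg _)
    simp only [mul_assoc (M.νF D F), integral_const_mul, mul_pow]
    calc _ ≤ M.νF D F ^ 2 * _ := mul_le_mul_of_nonneg_left h1 (sq_nonneg _)
      _ = M.traceConst k ^ 2 *
          (M.νF D F * (∫ x in T.1, ‖gradient (M.potRec T w : E d → ℝ) x‖ ^ 2)) *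
          (M.νF D F / M.hF F * (∫ x in F.1, M.facePart v F x ^ 2 ∂μHE[d - 1])) := by ring
      _ ≤ _ := by
        gcongr
        linarith
  · refine .of_sq_le hN (sq_nonneg ς) fun w v => ?_
    have h1 := sq_setIntegral_mul_le (m := μHE[d - 1]) (M.measurableSet_face F)
      (f := M.facePart w F) (g := M.facePart v F)
      (M.integrableOn_face F (by fun_prop)) (M.integrableOn_face F (by fun_prop))
    have h2 := bdry_le_sharpNorm_sq D hA hd hΩ hF v
    have h3 := bdry_le_sharpNorm_sq D hA hd hΩ hF w
    obtain ⟨t1, t2⟩ := bdryEnergy_terms D hA hd hΩ T F v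
    obtain ⟨s1, s2⟩ := bdryEnergy_terms D hA hd hΩ T F w
    calc _ = (ς * M.νF D F / M.hF F) ^ 2 * (∫ x in F.1,
          M.facePart w F x * M.facePart v F x ∂μHE[d - 1]) ^ 2 := mul_pow _ _ _
      _ ≤ (ς * M.νF D F / M.hF F) ^ 2 * _ := mul_le_mul_of_nonneg_left h1 (sq_nonneg _)
      _ = ς ^ 2 * (M.νF D F / M.hF F * (∫ x in F.1, M.facePart w F x ^ 2 ∂μHE[d - 1])) *
          (M.νF D F / M.hF F * (∫ x in F.1, M.facePart v F x ^ 2 ∂μHE[d - 1])) := by ring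
      _ ≤ _ := by
        gcongr <;> linarith
  · have hτ := inv_pos.1 (τc_inv_pos D hΩ T)
    have hβ := βc_nonneg D T
    have hT := M.hT_pos hd T
    refine .of_sq_le hN (c := M.τc D T * (M.βc D T / M.hT T)) (by positivity) fun w v => ?_
    have c1 := continuous_of_mem_polyFun (M.advRec D.β T v).2
    have h1 := sq_setIntegral_mul_le (m := volume) (M.isOpen_cell T).measurableSet
      (f := M.cellPart w T) (g := (M.advRec D.β T v : E d → ℝ))
      (M.integrableOn_cell T (by fun_prop)) (M.integrableOn_cell T (by fun_prop))
    have h2 : ∫ x in T.1, M.cellPart w T x ^ 2 ≤ M.τc D T * M.sharpNorm D A w ^ 2 := by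
      rw [← inv_mul_le_iff₀ hτ]
      exact (hcell T w).2.2.1
    have h3 : ∫ x in T.1, (M.advRec D.β T v : E d → ℝ) x ^ 2 ≤
        M.βc D T / M.hT T * M.sharpNorm D A v ^ 2 := by
      by_cases h0 : M.βc D T = 0
      · rw [integral_advRec_sq_eq_zero D hΩ T h0, h0, zero_div, zero_mul]
      · have h4 := (hcell T v).2.2.2
        rw [advEnergy, if_neg h0] at h4
        have h5 : M.βc D T / M.hT T * (M.hT T * (M.βc D T)⁻¹ *
            ∫ x in T.1, (M.advRec D.β T v : E d → ℝ) x ^ 2) =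
            ∫ x in T.1, (M.advRec D.β T v : E d → ℝ) x ^ 2 := by field_simp
        rw [← h5]
        gcongr
    calc _ ≤ _ := h1
      _ ≤ (M.τc D T * M.sharpNorm D A w ^ 2) * (M.βc D T / M.hT T * M.sharpNorm D A v ^ 2) :=
        mul_le_mul h2 h3 (integral_advRec_sq_nonneg D T v) (by positivity)
      _ = _ := by ring
  · refine .of_sq_le hN zero_le_one fun w v => ?_
    rw [one_mul]
    have hpos : ∀ v : M.Dof k, 0 ≤ (M.τc D T)⁻¹ * ∫ x in T.1, M.cellPart v T x ^ 2 := fun v =>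
      mul_nonneg (τc_inv_pos D hΩ T).le (integral_cellPart_sq_nonneg T v)
    exact (sq_le_mul_of_young (hpos w) (hpos v)
      fun t ht => abs_integral_μ_le D hΩ T w v ht).trans
      (mul_le_mul (hcell T w).2.2.1 (hcell T v).2.2.1 (hpos v) (sq_nonneg _))
  · refine .of_sq_le hN (c := a ^ 4 * (10 * C ^ 5) ^ 2) (by positivity) fun w v => ?_
    have h1 := sq_weighted_face_le D hA hd hΩ T F
      (f := fun x => M.facePart w F x - M.cellPart w T x)
      (g := fun x => M.facePart v F x - M.cellPart v T x)
      (faceCoef_minusPart_abs_le D hA hd hΩ T F) (by fun_prop) (by fun_prop)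
    have h2 : ∀ v : M.Dof k, M.upwindSq D A T F v + M.νF D F / M.hF F * M.jumpSq T F v ≤
        10 * C ^ 5 * M.sharpNorm D A v ^ 2 := by
      intro v
      have hF0 := M.hF_pos hd F
      have hJ := jumpSq_nonneg T F v
      have e1 := Finset.single_le_sum (f := fun F => M.upwindSq D A T F v)
        (fun F _ => upwindSq_nonneg D hA hd hΩ T F v) hF
      have e2 : (M.hF F)⁻¹ * M.jumpSq T F v ≤ M.dofEnergy T v :=
        (Finset.single_le_sum (f := fun F => (M.hF F)⁻¹ * M.jumpSq T F v) (fun F _ =>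
          mul_nonneg (inv_nonneg.2 (M.hF_pos hd F).le) (jumpSq_nonneg T F v)) hF).trans
          (le_add_of_nonneg_left (integral_norm_gradient_sq_nonneg _ _))
      have hν := νT_nonneg D hΩ T
      have e3 : M.νF D F / M.hF F * M.jumpSq T F v ≤ 8 * C ^ 5 * M.aνT D T v v := by
        calc _ = M.νF D F * ((M.hF F)⁻¹ * M.jumpSq T F v) := by ring
          _ ≤ M.νT D T * (8 * C ^ 5 * M.potEnergy T v) :=
            mul_le_mul (νF_le_νT D hF) (e2.trans (H.energy_equiv hd T v).1) (by positivity) hν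
          _ = _ := by rw [aνT_self]; ring
      have k5 : 1 ≤ C ^ 5 := one_le_pow₀ hC
      have e4 : M.sharpNorm D A v ^ 2 ≤ C ^ 5 * M.sharpNorm D A v ^ 2 :=
        le_mul_of_one_le_left (sq_nonneg _) k5
      have e5 : 8 * C ^ 5 * M.aνT D T v v ≤ 8 * C ^ 5 * M.sharpNorm D A v ^ 2 := by
        gcongr
        exact (hcell T v).1
      have e6 := (hcell T v).2.1
      linarith
    have h3 : ∀ v : M.Dof k, 0 ≤ M.upwindSq D A T F v + M.νF D F / M.hF F * M.jumpSq T F v :=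
      fun v => add_nonneg (upwindSq_nonneg D hA hd hΩ T F v)
        (mul_nonneg (div_nonneg (νF_nonneg D hΩ F) (M.hF_pos hd F).le) (jumpSq_nonneg T F v))
    have h4 := mul_le_mul (h2 w) (h2 v) (h3 v) (by positivity)
    calc _ ≤ _ := h1
      _ = a ^ 4 * ((M.upwindSq D A T F w + M.νF D F / M.hF F * M.jumpSq T F w) *
          (M.upwindSq D A T F v + M.νF D F / M.hF F * M.jumpSq T F v)) := by
        rw [mul_assoc]; rfl
      _ ≤ a ^ 4 * (10 * C ^ 5 * M.sharpNorm D A w ^ 2 * (10 * C ^ 5 * M.sharpNorm D A v ^ 2)) := by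
        gcongr
      _ = _ := by ring
  · refine .of_sq_le hN (c := a ^ 4 * 2 ^ 2) (by positivity) fun w v => ?_
    have h1 := sq_weighted_face_le D hA hd hΩ T F (f := M.facePart w F) (g := M.facePart v F)
      (faceCoef_plusPart_abs_le D hA hd hΩ T F) (by fun_prop) (by fun_prop)
    have h2 : ∀ v : M.Dof k, 0 ≤ (∫ x in F.1, M.faceCoef D A abs T F x *
        M.facePart v F x ^ 2 ∂μHE[d - 1]) +
        M.νF D F / M.hF F * (∫ x in F.1, M.facePart v F x ^ 2 ∂μHE[d - 1]) ∧
        (∫ x in F.1, M.faceCoef D A abs T F x * M.facePart v F x ^ 2 ∂μHE[d - 1]) +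
        M.νF D F / M.hF F * (∫ x in F.1, M.facePart v F x ^ 2 ∂μHE[d - 1]) ≤
        2 * M.sharpNorm D A v ^ 2 := by
      intro v
      have e1 := bdry_le_sharpNorm_sq D hA hd hΩ hF v
      obtain ⟨t1, t2⟩ := bdryEnergy_terms D hA hd hΩ T F v
      constructor <;> linarith
    have h4 := mul_le_mul (h2 w).2 (h2 v).2 (h2 v).1 (by positivity)
    calc _ ≤ _ := h1
      _ = _ := mul_assoc _ _ _
      _ ≤ a ^ 4 * (2 * M.sharpNorm D A w ^ 2 * (2 * M.sharpNorm D A v ^ 2)) := by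
        gcongr
      _ = _ := by ring

end Mesh

/-! ### The inf-sup condition -/

namespace Mesh

variable {d : ℕ} {Ω : Set (E d)} {M : Mesh Ω} {k : ℕ} {A : ℝ → ℝ} {a C : ℝ} (D : Coeffs Ω)

/-- The form `a_h` for test functions which vanish on the faces, after integration by parts. -/
theorem ah_of_facePart_eq_zero (hA : UpwindBounds A a) (hd : 1 ≤ d) (hΩ : IsPolytope Ω) (ς : ℝ)
    (w : M.Dof k) {v : M.Dof k} (hv : ∀ F, M.facePart v F = 0) :
    M.ah D A ς w v =
      (∑ T : M.Cell, ∫ x in T.1, (M.advRec D.β T w : E d → ℝ) x * M.cellPart v T x) +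
      ∑ T : M.Cell, (M.aνT D T w v +
        (∫ x in T.1, D.μ x * M.cellPart w T x * M.cellPart v T x) -
        ∑ F ∈ M.facesOf T, ∫ x in F.1, M.faceCoef D (plusPart A) (plusPart abs) T F x *
          (M.facePart w F x - M.cellPart w T x) * M.cellPart v T x ∂μHE[d - 1]) := by
  have hT : ∀ T : M.Cell, M.aβμT D A T w v =
      (∫ x in T.1, (M.advRec D.β T w : E d → ℝ) x * M.cellPart v T x) +
      (∫ x in T.1, D.μ x * M.cellPart w T x * M.cellPart v T x) -
        ∑ F ∈ M.facesOf T, ∫ x in F.1, M.faceCoef D (plusPart A) (plusPart abs) T F x *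
          (M.facePart w F x - M.cellPart w T x) * M.cellPart v T x ∂μHE[d - 1] := by
    intro T
    have h1 := integral_advRec_mul D hΩ T w (M.cellPart_mem v T)
    have h2 := M.advRec_spec D T v _ (M.cellPart_mem w T)
    simp only [advRhs, hv, Pi.zero_apply, mul_zero, zero_mul, integral_zero, Finset.sum_const_zero,
      add_zero] at h2
    have h3 : ∫ x in T.1, M.cellPart w T x * (M.advRec D.β T v : E d → ℝ) x =
        ∫ x in T.1, (M.advRec D.β T v : E d → ℝ) x * M.cellPart w T x := by simp only [mul_comm]
    have h4 : ∫ x in T.1, M.cellPart v T x * ⟪D.β x, gradient (M.cellPart w T) x⟫ =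
        ∫ x in T.1, ⟪D.β x, gradient (M.cellPart w T) x⟫ * M.cellPart v T x := by
      simp only [mul_comm]
    have h5 : M.sMinusT D A T w v =
        (∑ F ∈ M.facesOf T, ∫ x in F.1,
          M.bn D T F x * (M.facePart w F x - M.cellPart w T x) * M.cellPart v T x ∂μHE[d - 1]) -
        ∑ F ∈ M.facesOf T, ∫ x in F.1, M.faceCoef D (plusPart A) (plusPart abs) T F x *
          (M.facePart w F x - M.cellPart w T x) * M.cellPart v T x ∂μHE[d - 1] := by
      rw [sMinusT, ← Finset.sum_sub_distrib]
      refine Finset.sum_congr rfl fun F _ => ?_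
      have c1 := continuousOn_faceCoef D hA T F
      simp only [faceCoef_plusPart D hd, faceCoef_minusPart D hd, hv, Pi.zero_apply]
      rw [← integral_sub (M.integrableOn_face F (by fun_prop)) (M.integrableOn_face F (by fun_prop))]
      congr 1
      ext x
      ring
    rw [aβμT]
    linarith
  rw [ah, aν, aβμ]
  simp only [hT, hv, Pi.zero_apply, mul_zero, integral_zero, neg_zero, add_zero,
    Finset.sum_const_zero, Finset.sum_sub_distrib, Finset.sum_add_distrib]
  ring

open Classical in
variable (M) in
/-- The test function of the inf-sup condition: the scaled advective derivative in the cells where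
advection dominates, and zero elsewhere. -/
noncomputable def advTest (w : M.Dof k) : M.Dof k :=
  (fun T => if M.IsAdvective D T then (M.hT T * (M.βc D T)⁻¹) • M.advRec D.β T w else 0, 0)

theorem facePart_advTest (w : M.Dof k) (F : M.Face) : M.facePart (M.advTest D w) F = 0 := rfl

open Classical in
variable (M) in
/-- The part of the additional term of the `♯`-norm which the `♭`-norm does not control. -/
noncomputable def dominantAdvEnergy (T : M.Cell) (w : M.Dof k) : ℝ :=
  if M.IsAdvective D T then M.advEnergy D T w else 0

/-- Testing with `advTest` recovers the part of the `♯`-norm that coercivity misses, and the test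
function is small enough for its own norm to be controlled by the same quantity. -/
theorem advTest_spec (hd : 1 ≤ d) (hΩ : IsPolytope Ω) (w : M.Dof k) (T : M.Cell) :
    ∫ x in T.1, (M.advRec D.β T w : E d → ℝ) x * M.cellPart (M.advTest D w) T x =
      M.dominantAdvEnergy D T w ∧
    M.frequency D T * (∫ x in T.1, M.cellPart (M.advTest D w) T x ^ 2) ≤
      3 * M.dominantAdvEnergy D T w := by
  have hT := M.hT_pos hd T
  have hτ := τc_inv_pos D hΩ T
  have hν := νT_nonneg D hΩ T
  by_cases h : M.IsAdvective D T
  · have hc : ∀ x, M.cellPart (M.advTest D w) T x =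
        M.hT T * (M.βc D T)⁻¹ * (M.advRec D.β T w : E d → ℝ) x := by
      intro x
      simp [cellPart, advTest, h]
    have hβ : 0 < M.βc D T := (by positivity : 0 < M.hT T * (M.τc D T)⁻¹).trans h.2
    set S := ∫ x in T.1, (M.advRec D.β T w : E d → ℝ) x ^ 2 with hS
    have hS0 : 0 ≤ S := integral_advRec_sq_nonneg D T w
    have hX : M.dominantAdvEnergy D T w = M.hT T * (M.βc D T)⁻¹ * S := by
      rw [dominantAdvEnergy, if_pos h, advEnergy, if_neg hβ.ne']
    rw [hX]
    simp only [hc]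
    constructor
    · rw [hS, ← integral_const_mul]
      congr 1
      ext x
      ring
    · simp only [mul_pow (M.hT T * (M.βc D T)⁻¹), integral_const_mul]
      have h1 : M.frequency D T * (M.hT T * (M.βc D T)⁻¹) ≤ 3 := by
        have e1 : M.νT D T / M.hT T ^ 2 * (M.hT T * (M.βc D T)⁻¹) ≤ 1 := by
          have : M.νT D T / M.hT T ^ 2 * (M.hT T * (M.βc D T)⁻¹) =
            M.νT D T / (M.hT T * M.βc D T) := by field_simp
          rw [this, div_le_one (by positivity)]
          exact h.1.le
        have e2 : (M.τc D T)⁻¹ * (M.hT T * (M.βc D T)⁻¹) ≤ 1 := by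
          rw [← mul_assoc, mul_inv_le_iff₀ hβ, one_mul, mul_comm]
          exact h.2.le
        have e3 : M.βc D T / M.hT T * (M.hT T * (M.βc D T)⁻¹) = 1 := by field_simp
        rw [frequency]
        linarith
      calc _ = M.frequency D T * (M.hT T * (M.βc D T)⁻¹) * (M.hT T * (M.βc D T)⁻¹ * S) := by ring
        _ ≤ _ := by gcongr
  · have hc : ∀ x, M.cellPart (M.advTest D w) T x = 0 := by
      intro x
      simp [cellPart, advTest, h]
    simp [hc, dominantAdvEnergy, h]

theorem sharpNorm_advTest_sq_le (H : M.LocalBounds (k + 1) C) (hA : UpwindBounds A a)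
    (hd : 1 ≤ d) (hΩ : IsPolytope Ω) (w : M.Dof k) :
    M.sharpNorm D A (M.advTest D w) ^ 2 ≤
      48 * a * C ^ 7 * ∑ T : M.Cell, M.dominantAdvEnergy D T w := by
  have hC := H.one_le
  have ha := hA.one_le
  have h0 : M.bdryEnergy D A (M.advTest D w) = 0 := by
    simp [bdryEnergy, facePart_advTest]
  rw [sharpNorm_sq D hd, flatNorm_sq D hA hd hΩ, h0, add_zero, ← Finset.sum_add_distrib,
    Finset.mul_sum]
  refine Finset.sum_le_sum fun T _ => ?_
  calc _ ≤ _ := cellEnergy_add_advEnergy_le D H hA hd hΩ T (facePart_advTest D w)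
    _ ≤ 16 * a * C ^ 7 * (3 * M.dominantAdvEnergy D T w) :=
      mul_le_mul_of_nonneg_left (advTest_spec D hd hΩ w T).2 (by positivity)
    _ = _ := by ring

/-- The advective derivative of `w` tested with `advTest` dominates, up to the `♭`-norm of `w`. -/
theorem ah_advTest_ge (H : M.LocalBounds (k + 1) C) (hA : UpwindBounds A a) (hd : 1 ≤ d)
    (hΩ : IsPolytope Ω) (ς : ℝ) (w : M.Dof k) :
    1 / 2 * (∑ T : M.Cell, M.dominantAdvEnergy D T w) -
      6 * (16 * a ^ 2 * C ^ 7) ^ 2 * M.flatNorm D A w ^ 2 ≤ M.ah D A ς w (M.advTest D w) := by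
  have hC := H.one_le
  have ha := hA.one_le
  set K := 16 * a ^ 2 * C ^ 7 with hK
  have hK0 : 0 < K := by positivity
  rw [ah_of_facePart_eq_zero D hA hd hΩ ς w (facePart_advTest D w),
    Finset.sum_congr rfl fun T _ => (advTest_spec D hd hΩ w T).1]
  have hrem : ∀ T : M.Cell, -(6 * K ^ 2 * M.cellEnergy D A T w +
      1 / 2 * M.dominantAdvEnergy D T w) ≤ M.aνT D T w (M.advTest D w) +
        (∫ x in T.1, D.μ x * M.cellPart w T x * M.cellPart (M.advTest D w) T x) -
        ∑ F ∈ M.facesOf T, ∫ x in F.1, M.faceCoef D (plusPart A) (plusPart abs) T F x *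
          (M.facePart w F x - M.cellPart w T x) * M.cellPart (M.advTest D w) T x ∂μHE[d - 1] := by
    intro T
    -- the weight `6 K` leaves half of the positive term
    have h1 := abs_remainder_le D H hA hd hΩ T w (facePart_advTest D w)
      (by positivity : 0 < 6 * K)
    have h2 := (advTest_spec D hd hΩ w T).2
    have h3 : K * (6 * K * M.cellEnergy D A T w + (6 * K)⁻¹ * (M.frequency D T *
        ∫ x in T.1, M.cellPart (M.advTest D w) T x ^ 2)) ≤
        6 * K ^ 2 * M.cellEnergy D A T w + 1 / 2 * M.dominantAdvEnergy D T w := by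
      calc _ ≤ K * (6 * K * M.cellEnergy D A T w +
            (6 * K)⁻¹ * (3 * M.dominantAdvEnergy D T w)) := by gcongr
        _ = _ := by field_simp; ring
    linarith [(abs_le.1 h1).1]
  have hsum := Finset.sum_le_sum fun T (_ : T ∈ Finset.univ) => hrem T
  rw [Finset.sum_neg_distrib, Finset.sum_add_distrib, ← Finset.mul_sum, ← Finset.mul_sum] at hsum
  have h4 : 6 * K ^ 2 * (∑ T : M.Cell, M.cellEnergy D A T w) ≤
      6 * K ^ 2 * M.flatNorm D A w ^ 2 := by
    rw [flatNorm_sq D hA hd hΩ]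
    have := bdryEnergy_nonneg D hA hd hΩ w
    gcongr
    linarith
  linarith

/-- Only the cells in which advection dominates contribute to the `♯`-norm more than the `♭`-norm
does. -/
theorem sharpNorm_sq_le (H : M.LocalBounds (k + 1) C) (hA : UpwindBounds A a) (hd : 1 ≤ d)
    (hΩ : IsPolytope Ω) (w : M.Dof k) :
    M.sharpNorm D A w ^ 2 ≤ (1 + 32 * a * C ^ 7) * M.flatNorm D A w ^ 2 +
      ∑ T : M.Cell, M.dominantAdvEnergy D T w := by
  have hC := H.one_le
  have ha := hA.one_le
  have h1 : ∀ T : M.Cell, M.advEnergy D T w ≤ 32 * a * C ^ 7 * M.cellEnergy D A T w +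
      M.dominantAdvEnergy D T w := by
    intro T
    unfold dominantAdvEnergy
    split_ifs with h
    · have := cellEnergy_nonneg D hA hd hΩ T w
      have : 0 ≤ 32 * a * C ^ 7 * M.cellEnergy D A T w := by positivity
      linarith
    · rw [add_zero]
      exact advEnergy_le_cellEnergy D H hA hd hΩ h w
  have h2 := Finset.sum_le_sum fun T (_ : T ∈ Finset.univ) => h1 T
  rw [Finset.sum_add_distrib, ← Finset.mul_sum] at h2
  have h3 : 32 * a * C ^ 7 * (∑ T : M.Cell, M.cellEnergy D A T w) ≤
      32 * a * C ^ 7 * M.flatNorm D A w ^ 2 := by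
    rw [flatNorm_sq D hA hd hΩ]
    have := bdryEnergy_nonneg D hA hd hΩ w
    gcongr
    linarith
  rw [sharpNorm_sq D hd]
  linarith

theorem sharpNorm_zero (H : M.LocalBounds (k + 1) C) (hA : UpwindBounds A a) (hd : 1 ≤ d)
    (hΩ : IsPolytope Ω) : M.sharpNorm D A (0 : M.Dof k) = 0 := by
  have hf : ∀ F, M.facePart (0 : M.Dof k) F = 0 := fun F => rfl
  have hc : ∀ T, M.cellPart (0 : M.Dof k) T = 0 := fun T => rfl
  have h0 : M.bdryEnergy D A (0 : M.Dof k) = 0 := by simp [bdryEnergy, hf]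
  have h1 : M.sharpNorm D A (0 : M.Dof k) ^ 2 ≤ 0 := by
    rw [sharpNorm_sq D hd, flatNorm_sq D hA hd hΩ, h0, add_zero, ← Finset.sum_add_distrib]
    refine Finset.sum_nonpos fun T _ => ?_
    simpa [hc] using cellEnergy_add_advEnergy_le D H hA hd hΩ T hf
  exact pow_eq_zero_iff two_ne_zero |>.1 (le_antisymm h1 (sq_nonneg _))

end Mesh

/-- The algebra which concludes the proof of the inf-sup condition: `n` and `f` are the `♯`- and
`♭`-norms of a function, `m` is the `♯`-norm of the test function, and `S` is the supremum. -/
theorem infsup_algebra {K ζ f n m X S : ℝ} (hK : 1 ≤ K) (hζ : 0 < ζ) (hζ' : ζ ≤ 1 / 2)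
    (hn : 0 ≤ n) (hS : 0 ≤ S) (hcoer : ζ * f ^ 2 ≤ S * n)
    (htest : 1 / 2 * X - 6 * K ^ 2 * f ^ 2 ≤ S * m) (hm : m ^ 2 ≤ 3 * K * X)
    (hnX : n ^ 2 ≤ (1 + 2 * K) * f ^ 2 + X) : (108 * K ^ 2)⁻¹ * ζ * n ≤ S := by
  have hK0 : 0 < K := by linarith
  have hKK : K ≤ K ^ 2 := le_self_pow₀ hK (by norm_num)
  have h1 : S * m ≤ 3 * K * S ^ 2 + X / 4 := by
    have h2 := (le_abs_self _).trans (abs_mul_le_young (by positivity : 0 < 3 * K) S m)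
    have h3 : (4 * (3 * K))⁻¹ * m ^ 2 ≤ (4 * (3 * K))⁻¹ * (3 * K * X) := by gcongr
    have h4 : (4 * (3 * K))⁻¹ * (3 * K * X) = X / 4 := by field_simp
    linarith
  have h2 : n ^ 2 ≤ 27 * K ^ 2 * (f ^ 2 + S ^ 2) := by
    have e1 : (1 + 2 * K) * f ^ 2 ≤ 3 * K ^ 2 * f ^ 2 := by gcongr; linarith
    have e2 : 12 * K * S ^ 2 ≤ 27 * K ^ 2 * S ^ 2 := by gcongr; linarith
    linarith
  -- otherwise both `f ^ 2` and `S ^ 2` are at most `n ^ 2 / (108 * K ^ 2)`, too small for `h2`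
  by_contra! hlt
  set γ := (108 * K ^ 2)⁻¹ with hγ
  have hγ0 : 0 < γ := by positivity
  have hγ1 : γ ≤ 1 := inv_le_one_of_one_le₀ (by nlinarith)
  have hn0 : 0 < n := by
    refine lt_of_le_of_ne hn fun h => ?_
    rw [← h, mul_zero] at hlt
    linarith
  have h3 : f ^ 2 ≤ γ * n ^ 2 := by
    refine le_of_mul_le_mul_left (hcoer.trans ?_) hζ
    calc S * n ≤ γ * ζ * n * n := by gcongr
      _ = ζ * (γ * n ^ 2) := by ring
  have h4 : S ^ 2 ≤ γ * n ^ 2 := by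
    calc S ^ 2 ≤ (γ * ζ * n) ^ 2 := by gcongr
      _ = γ * (γ * ζ ^ 2) * n ^ 2 := by ring
      _ ≤ γ * 1 * n ^ 2 := by
        gcongr
        have : ζ ^ 2 ≤ 1 := pow_le_one₀ hζ.le (by linarith)
        exact mul_le_one₀ hγ1 (sq_nonneg _) this
      _ = γ * n ^ 2 := by ring
  have h5 : 27 * K ^ 2 * (f ^ 2 + S ^ 2) ≤ 27 * K ^ 2 * (2 * (γ * n ^ 2)) := by gcongr; linarith
  have h6 : 27 * K ^ 2 * (2 * (γ * n ^ 2)) = n ^ 2 / 2 := by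
    rw [hγ]
    field_simp
    norm_num
  have : 0 < n ^ 2 := by positivity
  linarith

end HHO

/-- The constant `γ` depends only on the dimension `d`, the degree `k`, the mesh regularity
parameter `ϱ` and the function `|A|` (here `A`): it is chosen before the domain, the mesh (hence
`h`), the coefficients `ν`, `β`, `μ` and the penalty `ς`. -/
theorem lemma5p1 (d k : ℕ) (hd : 1 ≤ d) (ϱ : ℝ) (hϱ : 0 < ϱ)
    (A : ℝ → ℝ) (hA1 : HHO.CondA1 A) (hA2 : HHO.CondA2 A) :
    ∃ γ : ℝ, 0 < γ ∧
      ∀ (Ω : Set (HHO.E d)), HHO.IsPolytope Ω → IsConnected Ω →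
      ∀ (M : HHO.Mesh Ω), M.IsAdmissible ϱ →
      ∀ (D : HHO.Coeffs Ω), M.IsCompatible D → HHO.CondA3 A D.νmin →
      ∀ (ς : ℝ), 1 + M.traceConst k ^ 2 * (M.maxFaces : ℝ) / 2 ≤ ς →
        0 < M.ζ D ∧
        (∀ v : M.Dof k, M.ζ D * M.flatNorm D A v ^ 2 ≤ M.ah D A ς v v) ∧
        ((∀ T : M.Cell, M.hT T * M.Lβ D T ≤ M.βc D T ∧ M.hT T * D.μ₀ ≤ M.βc D T) →
          ∀ w : M.Dof k,
            BddAbove (Set.range fun v : {v : M.Dof k // v ≠ 0} =>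
              M.ah D A ς w v.1 / M.sharpNorm D A v.1) ∧
            γ * M.ζ D * M.sharpNorm D A w ≤
              ⨆ v : {v : M.Dof k // v ≠ 0}, M.ah D A ς w v.1 / M.sharpNorm D A v.1) := by
  obtain ⟨a, hA⟩ := HHO.exists_upwindBounds hA1 hA2
  obtain ⟨C, hC⟩ := HHO.Mesh.exists_localBounds d (k + 1) hd hϱ
  have ha := hA.one_le
  -- `C` is known to be positive only if there is an admissible mesh, hence the maximum
  refine ⟨(108 * (16 * a ^ 2 * max C 1 ^ 7) ^ 2)⁻¹, by positivity, ?_⟩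
  intro Ω hΩ _ M hM D _ _ ς hς
  have H := hC Ω M hM
  have hC1 := H.one_le
  rw [max_eq_left hC1]
  obtain ⟨hζ, hζ', -⟩ := HHO.Mesh.ζ_bounds (M := M) D hΩ
  have hcoer := HHO.Mesh.coercive D (H.mono (Nat.le_succ k)) hA hd hΩ hς
  refine ⟨hζ, hcoer, fun _ w => ?_⟩
  obtain ⟨B, hB0, hB⟩ := HHO.Mesh.isBoundedForm_ah D H hA hd hΩ ς
  have hN := HHO.Mesh.sharpNorm_nonneg (M := M) (k := k) (A := A) D
  have hbdd : BddAbove (Set.range fun v : {v : M.Dof k // v ≠ 0} =>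
      M.ah D A ς w v.1 / M.sharpNorm D A v.1) := by
    refine ⟨B * M.sharpNorm D A w, ?_⟩
    rintro _ ⟨v, rfl⟩
    refine div_le_of_le_mul₀ (hN v.1) (mul_nonneg hB0 (hN w)) ?_
    rw [mul_assoc]
    exact (le_abs_self _).trans (hB w v.1)
  refine ⟨hbdd, ?_⟩
  set S := ⨆ v : {v : M.Dof k // v ≠ 0}, M.ah D A ς w v.1 / M.sharpNorm D A v.1 with hS
  -- continuity takes care of those `v` whose norm vanishes, for which the quotient is zero
  have hzero : ∀ u v : M.Dof k, M.sharpNorm D A u * M.sharpNorm D A v = 0 → M.ah D A ς u v = 0 := by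
    intro u v h
    have := hB u v
    rw [h, mul_zero] at this
    exact abs_nonpos_iff.1 this
  have hsup : ∀ v : M.Dof k, M.ah D A ς w v ≤ S * M.sharpNorm D A v := by
    intro v
    rcases (hN v).eq_or_lt with h0 | h0
    · rw [← h0, mul_zero, hzero w v (by rw [← h0, mul_zero])]
    · have hv : v ≠ 0 := by
        rintro rfl
        exact h0.ne' (HHO.Mesh.sharpNorm_zero D H hA hd hΩ)
      rw [← div_le_iff₀ h0]
      exact le_ciSup hbdd ⟨v, hv⟩
  have hS0 : 0 ≤ S := by
    rcases (hN w).eq_or_lt with h0 | h0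
    · refine Real.iSup_nonneg fun v => ?_
      rw [hzero w v.1 (by rw [← h0, zero_mul]), zero_div]
    · refine nonneg_of_mul_nonneg_left ?_ h0
      exact (mul_nonneg hζ.le (sq_nonneg _)).trans ((hcoer w).trans (hsup w))
  have k7 : 1 ≤ C ^ 7 := one_le_pow₀ hC1
  have ka : a ≤ a ^ 2 := le_self_pow₀ ha (by norm_num)
  have hX0 : ∀ T : M.Cell, 0 ≤ M.dominantAdvEnergy D T w := fun T => by
    unfold HHO.Mesh.dominantAdvEnergy
    split_ifs
    · exact HHO.Mesh.advEnergy_nonneg D hd T w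
    · exact le_rfl
  have hXs := Finset.sum_nonneg fun T (_ : T ∈ Finset.univ) => hX0 T
  have haC : a * C ^ 7 ≤ a ^ 2 * C ^ 7 := by gcongr
  refine HHO.infsup_algebra (f := M.flatNorm D A w) ?_ hζ hζ' (hN w) hS0
    ((hcoer w).trans (hsup w))
    ((HHO.Mesh.ah_advTest_ge D H hA hd hΩ ς w).trans (hsup _))
    ((HHO.Mesh.sharpNorm_advTest_sq_le D H hA hd hΩ w).trans ?_)
    ((HHO.Mesh.sharpNorm_sq_le D H hA hd hΩ w).trans ?_)
  · have : 1 ≤ a ^ 2 * C ^ 7 := one_le_mul_of_one_le_of_one_le (ha.trans ka) k7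
    linarith
  · exact mul_le_mul_of_nonneg_right (by linarith) hXs
  · exact add_le_add_left (mul_le_mul_of_nonneg_right (by linarith) (sq_nonneg _)) _
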